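/- Let $F$ be a field and let $A$ be a central simple $F$-algebra of degree $n$, i.e. a finite-dimensional simple $F$-algebra with center $F$ and $\dim_F A=n^2$. Let $X=\operatorname{SB}(A)$ be the Severi–Brauer variety of $A$: the $F$-scheme whose $R$-points, for every commutative $F$-algebra $R$ and naturally in $R$, are the right ideals of $R\otimes_F A$ that are direct summands of $R\otimes_F A$ as $R$-modules and have constant rank $n$ over $R$ (over a field: the right ideals of dimension $n$, that is, of reduced dimension $1$). Let $\mathcal I\subset \mathcal O_X\otimes_F A$ be the tautological sheaf of right ideals on $X$, i.e. the subsheaf of $\mathcal O_X$-modules whose sections over an affine open $V\subset X$ form the right ideal of $\Gamma(V,\mathcal O_X)\otimes_F A$ that corresponds to the inclusion $V\hookrightarrow X$, and let \[\mathcal T=\mathcal O_X\oplus\mathcal I\oplus\mathcal I^{\otimes 2}\oplus\dots\oplus\mathcal I^{\otimes (n-1)},\] the tensor powers being taken over $\mathcal O_X$. Then the ring $\operatorname{End}_{\mathcal O_X}(\mathcal T)$ of global endomorphisms of $\mathcal T$ has finite global dimension; that is, the supremum of the projective dimensions of all left $\operatorname{End}_{\mathcal O_X}(\mathcal T)$-modules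 is finite. -/

import Mathlib

universe u

open CategoryTheory Limits AlgebraicGeometry Opposite

open scoped TensorProduct

noncomputable section

/-- The (left) global dimension of a ring: the supremum of the projective dimensions of all
left modules. -/
def globalDimension (R : Type u) [Ring R] : WithBot ℕ∞ :=
  ⨆ M : ModuleCat.{u} R, projectiveDimension M

namespace SeveriBrauer

section Points

variable (F : Type u) [Field F] (A : Type u) [Ring A] [Algebra F A] (n : ℕ)

/-- For a central simple `F`-algebra `A` of degree `n` and a commutative `F`-algebra `R`: a right
ideal of `R ⊗[F] A` which is an `R`-direct summand of constant rank `n`. As `A` has dimension `n ^ 2`,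
this says that the quotient is a projective `R`-module of constant rank `n ^ 2 - n`, that is, the
right ideal is a point of Mathlib's Grassmannian of rank `n ^ 2 - n` quotients. If `R` is a field,
these are the right ideals of dimension `n`, i.e. of reduced dimension `1`. -/
structure IdealPoint (R : Type u) [CommRing R] [Algebra F R] extends
    Module.Grassmannian R (R ⊗[F] A) (n ^ 2 - n) where
  mul_mem : ∀ x ∈ toSubmodule, ∀ a : R ⊗[F] A, x * a ∈ toSubmodule

variable {F A n}

lemma IdealPoint.ext_grassmannian {R : Type u} [CommRing R] [Algebra F R]
    {J K : IdealPoint F A n R} (h : J.toGrassmannian = K.toGrassmannian) : J = K := by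
  cases J; cases K; congr 1

lemma mul_mem_map {R S : Type u} [CommRing R] [Algebra F R] [CommRing S] [Algebra F S]
    (f : R →ₐ[F] S) (J : IdealPoint F A n R) :
    ∀ x ∈ (Module.Grassmannian.map f J.toGrassmannian).toSubmodule, ∀ a : S ⊗[F] A,
      x * a ∈ (Module.Grassmannian.map f J.toGrassmannian).toSubmodule := by
  let : Algebra R S := f.toAlgebra
  let : IsScalarTower F R S :=
    IsScalarTower.of_algebraMap_eq' <| IsScalarTower.algebraMap_eq F R S
  rw [Module.Grassmannian.map_toSubmodule]
  intro x hx a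
  induction a using TensorProduct.induction_on with
  | zero => simp
  | add a b ha hb => rw [mul_add]; exact add_mem ha hb
  | tmul s a =>
    have h0 : J.toSubmodule ≤ J.toSubmodule.comap
        (LinearMap.mulRight R ((1 : R) ⊗ₜ[F] a)) := fun y hy => J.mul_mem y hy _
    have key : Module.Grassmannian.baseChangeMkQ S J.toSubmodule ∘ₗ
          LinearMap.mulRight S (s ⊗ₜ[F] a) =
        s • ((J.toSubmodule.mapQ J.toSubmodule _ h0).baseChange S ∘ₗ
          Module.Grassmannian.baseChangeMkQ S J.toSubmodule) := by
      ext b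
      simp [Module.Grassmannian.baseChangeMkQ]
      rw [TensorProduct.smul_tmul', smul_eq_mul, mul_one]
    rw [LinearMap.mem_ker] at hx ⊢
    have := LinearMap.congr_fun key x
    exact this.trans (by simp only [LinearMap.smul_apply, LinearMap.comp_apply]; erw [hx]; simp)

/-- Base change of a right ideal along `R → S`: the image of `S ⊗[R] J` in `S ⊗[F] A`. -/
def IdealPoint.map {R S : Type u} [CommRing R] [Algebra F R] [CommRing S] [Algebra F S]
    (f : R →ₐ[F] S) (J : IdealPoint F A n R) : IdealPoint F A n S where
  toGrassmannian := Module.Grassmannian.map f J.toGrassmannian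
  mul_mem := mul_mem_map f J

variable (F A n) in
/-- The functor of points of the Severi-Brauer variety: it sends a commutative `F`-algebra `R` to
the set of right ideals of `R ⊗[F] A` that are `R`-direct summands of rank `n`. -/
def functor : CommAlgCat.{u} F ⥤ Type u where
  obj R := IdealPoint F A n R
  map f := ↾IdealPoint.map f.hom
  map_id R := by
    refine ConcreteCategory.hom_ext _ _ fun J => ?_
    exact IdealPoint.ext_grassmannian (Module.Grassmannian.map_id _ R J.toGrassmannian)
  map_comp f g := by
    refine ConcreteCategory.hom_ext _ _ fun J => ?_
    exact IdealPoint.ext_grassmannian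
      (Module.Grassmannian.map_comp _ f.hom g.hom J.toGrassmannian)

end Points

section Sheaf

variable {F : Type u} [Field F] (X : Over (Spec (.of F)))

/-- The ring of sections of the structure sheaf of an `F`-scheme, as an `F`-algebra. -/
abbrev sectionsAlgebra (U : X.left.Opens) : Algebra F Γ(X.left, U) :=
  ((Scheme.ΓSpecIso (.of F)).inv ≫ X.hom.appTop ≫
    X.left.presheaf.map (homOfLE (le_top : U ≤ ⊤)).op).hom.toAlgebra

attribute [local instance] sectionsAlgebra

lemma algebraMap_res {U V : X.left.Opens} (h : V ≤ U) (r : F) :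
    X.left.presheaf.map (homOfLE h).op (algebraMap F Γ(X.left, U) r) =
      algebraMap F Γ(X.left, V) r := by
  simp only [RingHom.algebraMap_toAlgebra]
  rw [← CommRingCat.comp_apply, Category.assoc, Category.assoc, ← Functor.map_comp]
  rfl

/-- Restriction of functions, as a homomorphism of `F`-algebras. -/
def res {U V : X.left.Opens} (h : V ≤ U) : Γ(X.left, U) →ₐ[F] Γ(X.left, V) where
  __ := (X.left.presheaf.map (homOfLE h).op).hom
  commutes' r := algebraMap_res X h r

lemma fromSpec_comp_hom {V : X.left.Opens} (hV : IsAffineOpen V) :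
    hV.fromSpec ≫ X.hom = Spec.map (CommRingCat.ofHom (algebraMap F Γ(X.left, V))) := by
  rw [← cancel_mono (Spec (CommRingCat.of F)).toSpecΓ, Category.assoc, Scheme.toSpecΓ_naturality,
    hV.fromSpec_toSpecΓ_assoc]
  simp [RingHom.algebraMap_toAlgebra, Spec.map_comp]
  erw [Category.comp_id]

/-- The inclusion of an affine open subset `V`, as a `Γ(X, V)`-valued point of `X` over `F`. -/
def affinePoint {V : X.left.Opens} (hV : IsAffineOpen V) :
    (algSpec (.of F)).obj (op (CommAlgCat.of F Γ(X.left, V))) ⟶ X :=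
  Over.homMk hV.fromSpec (fromSpec_comp_hom X hV)

/-- The functor of points of an `F`-scheme `X` on commutative `F`-algebras: it sends `R` to the set
of morphisms `Spec R ⟶ X` over `Spec F`. -/
abbrev points : CommAlgCat.{u} F ⥤ Type u :=
  (algSpec (.of F)).rightOp ⋙ yoneda.obj X

variable (A : Type u) [Ring A] [Algebra F A] (n : ℕ)

/-- Restriction of sections of the constant sheaf of algebras `A`. -/
def resTensor {U V : X.left.Opens} (h : V ≤ U) :
    Γ(X.left, U) ⊗[F] A →ₗ[F] Γ(X.left, V) ⊗[F] A :=
  (res X h).toLinearMap.rTensor A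

variable {A} in
@[simp]
lemma resTensor_tmul {U V : X.left.Opens} (h : V ≤ U) (r : Γ(X.left, U)) (a : A) :
    resTensor X A h (r ⊗ₜ[F] a) = X.left.presheaf.map (homOfLE h).op r ⊗ₜ[F] a := rfl

lemma resTensor_id {U : X.left.Opens} (x : Γ(X.left, U) ⊗[F] A) :
    resTensor X A le_rfl x = x := by
  induction x using TensorProduct.induction_on with
  | zero => simp
  | add x y hx hy => rw [map_add, hx, hy]
  | tmul r a => simp

lemma resTensor_resTensor {U V W : X.left.Opens} (h : V ≤ U) (h' : W ≤ V)
    (x : Γ(X.left, U) ⊗[F] A) :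
    resTensor X A h' (resTensor X A h x) = resTensor X A (h'.trans h) x := by
  induction x using TensorProduct.induction_on with
  | zero => simp
  | add x y hx hy => simp only [map_add, hx, hy]
  | tmul r a =>
    simp only [resTensor_tmul]
    rw [← CommRingCat.comp_apply, ← Functor.map_comp]
    rfl

lemma resTensor_smul {U V : X.left.Opens} (h : V ≤ U) (r : Γ(X.left, U))
    (x : Γ(X.left, U) ⊗[F] A) :
    resTensor X A h (r • x) = X.left.presheaf.map (homOfLE h).op r • resTensor X A h x := by
  induction x using TensorProduct.induction_on with
  | zero => simp
  | add x y hx hy => simp only [smul_add, map_add, hx, hy]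
  | tmul s a => simp [TensorProduct.smul_tmul']

/-- The underlying presheaf of abelian groups of `constantModule`. -/
def constantPresheaf : X.left.Opensᵒᵖ ⥤ Ab.{u} where
  obj U := .of (Γ(X.left, U.unop) ⊗[F] A)
  map f := AddCommGrpCat.ofHom (resTensor X A (leOfHom f.unop)).toAddMonoidHom
  map_id U := by
    ext x
    exact resTensor_id X A x
  map_comp f g := by
    ext x
    exact (resTensor_resTensor X A _ _ x).symm

instance (U : X.left.Opensᵒᵖ) :
    Module ((X.left.presheaf ⋙ forget₂ CommRingCat RingCat).obj U)
      ((constantPresheaf X A).obj U) :=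
  inferInstanceAs (Module Γ(X.left, U.unop) (Γ(X.left, U.unop) ⊗[F] A))

/-- The constant sheaf of algebras `A` on `X`, i.e. the `𝒪_X`-module `U ↦ Γ(X, U) ⊗[F] A`. -/
def constantModule : PresheafOfModules.{u} (X.left.presheaf ⋙ forget₂ CommRingCat RingCat) :=
  PresheafOfModules.ofPresheaf (constantPresheaf X A)
    fun _ _ f r m => resTensor_smul X A (leOfHom f.unop) r m

variable {X A n} (e : points X ≅ functor F A n)

/-- For an `F`-scheme `X` representing the Severi-Brauer functor and an affine open subset `V`, the
right ideal of `Γ(X, V) ⊗[F] A` that corresponds to the inclusion of `V` into `X`. -/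
def idealOfAffine {V : X.left.Opens} (hV : IsAffineOpen V) : IdealPoint F A n Γ(X.left, V) :=
  e.hom.app (CommAlgCat.of F Γ(X.left, V)) (affinePoint X hV)

/-- The sections over `U` of the tautological subsheaf of the constant sheaf `A`. -/
def tautologicalSections (U : X.left.Opens) :
    Submodule Γ(X.left, U) (Γ(X.left, U) ⊗[F] A) where
  carrier := {s | ∀ (V : X.left.Opens) (hV : IsAffineOpen V) (h : V ≤ U),
    resTensor X A h s ∈ (idealOfAffine e hV).toSubmodule}
  zero_mem' := fun V hV h => by rw [map_zero]; exact zero_mem _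
  add_mem' := fun {x y} hx hy V hV h => by rw [map_add]; exact add_mem (hx V hV h) (hy V hV h)
  smul_mem' := fun r x hx V hV h => by
    rw [resTensor_smul]; exact Submodule.smul_mem _ _ (hx V hV h)

/-- The tautological subsheaf `I` of the constant sheaf `A` on the Severi-Brauer variety: a section
of `A` belongs to `I` if over every affine open subset it belongs to the right ideal that this
subset parametrizes. -/
def tautologicalSubmodule : (constantModule X A).Submodule where
  obj U := tautologicalSections e U.unop
  map {U U'} f s hs V hV h := by
    have := resTensor_resTensor X A (leOfHom f.unop) h s
    exact this ▸ hs V hV _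

open MonoidalCategory in
/-- The presheaf tensor powers `U ↦ M(U)^{⊗ k}` of a presheaf of modules. -/
def tensorPower {Y : Scheme.{u}}
    (M : PresheafOfModules.{u} (Y.presheaf ⋙ forget₂ CommRingCat RingCat)) :
    ℕ → PresheafOfModules.{u} (Y.presheaf ⋙ forget₂ CommRingCat RingCat)
  | 0 => 𝟙_ _
  | k + 1 => tensorPower M k ⊗ M

/-- The sheaf of modules `I^{⊗ k}`, for the tautological sheaf `I`: the sheaf associated with the
presheaf `U ↦ I(U)^{⊗ k}`. For `k = 0` this is the structure sheaf. -/
def tautologicalPower (k : ℕ) : X.left.Modules :=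
  (PresheafOfModules.sheafification (𝟙 X.left.ringCatSheaf.obj)).obj
    (tensorPower (tautologicalSubmodule e).toPresheafOfModules k)

attribute [local instance] Abelian.hasFiniteBiproducts

/-- The sheaf `T = 𝒪 ⊕ I ⊕ I^{⊗ 2} ⊕ ⋯ ⊕ I^{⊗ (n - 1)}`. -/
def tiltingSheaf : X.left.Modules :=
  ⨁ fun k : Fin n => tautologicalPower e k

end Sheaf

end SeveriBrauer

end

/-! ### Triangular rings with semisimple corners -/

section TriangularRings

/-! Over an algebraic closure `K` of `F` the algebra `A` becomes a matrix algebra, `X` becomes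
projective space of dimension `n - 1`, and `I` becomes a sum of `n` copies of `𝒪(-1)`. So `I^{⊗ i}`
becomes a sum of `n ^ i` copies of `𝒪(-i)`. Hence there are no nonzero maps `I^{⊗ i} ⟶ I^{⊗ j}` for
`i < j` when `1 < n`, and `End(I^{⊗ i})` is an `F`-form of a matrix algebra, thus semisimple. The
ring `End(T)` is therefore triangular with semisimple diagonal blocks, and
`globalDimension_lt_top_of_triangular` bounds its global dimension by peeling off one block at a
time.

The geometry is read off the functor of points, without cohomology. A unimodular vector `v` over a
`K`-algebra `R` gives the right ideal of matrices `v wᵀ`, and a covector `c` with `c ⬝ᵥ v = 1` gives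
coordinates on `I^{⊗ k}`. In these coordinates a morphism is a matrix over `R`
(`exists_isMatrixAt`), which is multiplied by `r ^ (i - j)` when `v` is replaced by `r v`
(`IsMatrixAt.smul`). On a line the matrices `P`, `Q` of the two charts satisfy `Q(T⁻¹) = T ^ (j - i)
P(T)`, so they are constant if `i = j` and zero if `i < j` (`IsMatrixAt.exists_on_line`). Joining
points by lines parallel to the axes gives one matrix over `K` for all points
(`exists_isMatrixAt_const`).

The extension `K / F` may be infinite, so the descent to `F` tests finite families `∑ b m ⊗ φ m`,
for a basis `b` of `K`, at points with values in local `K`-algebras (`finsupp_hom_eq_zero`). This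
makes `K ⊗ End(I^{⊗ i})` embed into matrices over `K`. It fills them, because right multiplications
by `A` on the tensor factors already span (`span_range_actMatrix`). -/

/-- Over a ring `R` with an idempotent `e` whose corner ring is the semisimple ring `D`, every module
`M` receives a map from a projective module generated by its `e`-part, which is injective on the
`e`-part and whose image contains the `e`-part of `M`. -/
theorem exists_projective_of_semisimple_corner {R : Type u} [Ring R] {D : Type u} [Ring D]
    [IsSemisimpleRing D] (e : R) (j : D →ₙ+* R) (hj : j 1 = e) (hje : ∀ r, ∃ d, j d = e * r * e)
    (M : Type u) [AddCommGroup M] [Module R M] :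
    ∃ (P : Type u) (_ : AddCommGroup P) (_ : Module R P) (q : P →ₗ[R] M),
      Module.Projective R P ∧ (∀ m, e • m ∈ LinearMap.range q) ∧
      (∀ x, q x = 0 → e • x = 0) ∧ ∀ r, (∀ a, r * a * e = 0) → ∀ x : P, r • x = 0 := by
  have hjl (d : D) : e * j d = j d := by rw [← hj, ← map_mul, one_mul]
  have hee : e * e = e := by rw [← hj, ← map_mul, one_mul]
  -- `W` is the `e`-part of `M`, a `D`-module through `j`. The module `P` below plays the role of `R
  -- e ⊗ W` over `D`. Since `D` is semisimple, `W` is a retract of a free `D`-module, and this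
  -- exhibits `P` as a retract of a free `R`-module.
  let W : AddSubgroup M :=
    { carrier := {m | e • m = m}
      zero_mem' := smul_zero e
      add_mem' := fun {a b} ha hb => by
        simp only [Set.mem_ofPred_eq] at ha hb ⊢; rw [smul_add, ha, hb]
      neg_mem' := fun {a} ha => by simp only [Set.mem_ofPred_eq] at ha ⊢; rw [smul_neg, ha] }
  have hW (w : W) : e • (w : M) = w := w.2
  let : Module D W :=
    { smul := fun d w => ⟨j d • (w : M), by
        change e • j d • (w : M) = _; rw [← mul_smul, hjl]⟩
      one_smul := fun w => Subtype.ext (by change j 1 • (w : M) = w; rw [hj, hW])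
      mul_smul := fun a b w => Subtype.ext (by
        change j (a * b) • (w : M) = j a • j b • (w : M); rw [map_mul, mul_smul])
      smul_zero := fun a => Subtype.ext (smul_zero (j a))
      smul_add := fun a x y => Subtype.ext (smul_add (j a) (x : M) y)
      add_smul := fun a b x => Subtype.ext (by
        change j (a + b) • (x : M) = j a • (x : M) + j b • (x : M); rw [map_add, add_smul])
      zero_smul := fun x => Subtype.ext (by change j 0 • (x : M) = 0; rw [map_zero, zero_smul]) }
  have hsmul (d : D) (w : W) : ((d • w : W) : M) = j d • (w : M) := rfl
  obtain ⟨s, hs⟩ := Module.projective_def.mp (Module.projective_of_isSemisimpleRing D W)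
  let jl : (W →₀ D) →+ (W →₀ R) := Finsupp.mapRange.addMonoidHom j.toAddMonoidHom
  have hjlsmul (d : D) (x : W →₀ D) : jl (d • x) = j d • jl x := by
    ext w; simp [jl]
  have hjle (x : W →₀ D) : e • jl x = jl x := by
    ext w; simp [jl, hjl]
  -- The `R`-linear extension of the idempotent of `W →₀ D` whose image is the copy `s W` of `W`;
  -- `P` is its range.
  let p : (W →₀ R) →ₗ[R] (W →₀ R) := Finsupp.linearCombination R (fun w => jl (s w))
  let q : (W →₀ R) →ₗ[R] M := Finsupp.linearCombination R (fun w : W => (w : M))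
  have hqj (x : W →₀ D) : q (jl x) = (Finsupp.linearCombination D id x : W) := by
    induction x using Finsupp.induction_linear with
    | zero => simp
    | add x y hx hy => simp only [map_add, hx, hy, AddSubgroup.coe_add]
    | single w d => simp [jl, q, hsmul]
  have hpj (x : W →₀ D) : p (jl x) = jl (s (Finsupp.linearCombination D id x)) := by
    induction x using Finsupp.induction_linear with
    | zero => simp
    | add x y hx hy => simp only [map_add, hx, hy]
    | single w d =>
      have : jl (Finsupp.single w d) = Finsupp.single w (j d) := by simp [jl]
      rw [this, Finsupp.linearCombination_single, Finsupp.linearCombination_single, id, map_smul,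
        hjlsmul]
  have hpp (x : W →₀ R) : p (p x) = p x := by
    induction x using Finsupp.induction_linear with
    | zero => simp
    | add x y hx hy => simp only [map_add, hx, hy]
    | single w r =>
      have : p (Finsupp.single w r) = r • jl (s w) := by simp [p]
      rw [this, map_smul, hpj, hs]
  have hqp (x : W →₀ R) : q (p x) = q x := by
    induction x using Finsupp.induction_linear with
    | zero => simp
    | add x y hx hy => simp only [map_add, hx, hy]
    | single w r =>
      have : p (Finsupp.single w r) = r • jl (s w) := by simp [p]
      rw [this, map_smul, hqj, hs]; simp [q]
  -- On `e`-parts, `e • p x` is the image under `jl ∘ s` of the element `e • q x` of `W`. So `q x =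
  -- 0` forces `e • p x = 0`.
  have hep (x : W →₀ R) : ∃ y : W →₀ D, e • p x = jl (s (Finsupp.linearCombination D id y)) ∧
      e • q x = (Finsupp.linearCombination D id y : W) := by
    induction x using Finsupp.induction_linear with
    | zero => exact ⟨0, by simp, by simp⟩
    | add x y hx hy =>
      obtain ⟨x', hx, hx'⟩ := hx
      obtain ⟨y', hy, hy'⟩ := hy
      exact ⟨x' + y', by simp only [map_add, smul_add, hx, hy],
        by simp only [map_add, smul_add, hx', hy', AddSubgroup.coe_add]⟩
    | single w r =>
      obtain ⟨d, hd⟩ := hje r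
      refine ⟨Finsupp.single w d, ?_, ?_⟩
      · simp only [p, Finsupp.linearCombination_single, id, map_smul, hjlsmul, hd]
        rw [mul_smul, hjle, mul_smul]
      · simp only [q, Finsupp.linearCombination_single, id, hsmul, hd]
        rw [mul_smul, hW, mul_smul]
  refine ⟨LinearMap.range p, inferInstance, inferInstance, q ∘ₗ (LinearMap.range p).subtype,
    Module.Projective.of_split (LinearMap.range p).subtype p.rangeRestrict ?_, ?_, ?_, ?_⟩
  · ext ⟨_, x, rfl⟩ : 2
    exact hpp x
  · intro m
    refine ⟨⟨p (Finsupp.single ⟨e • m, by change e • e • m = _; rw [← mul_smul, hee]⟩ 1),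
      LinearMap.mem_range_self _ _⟩, ?_⟩
    change q (p _) = _
    rw [hqp]; simp [q]
  · rintro ⟨_, x, rfl⟩ h
    replace h : q (p x) = 0 := h
    refine Subtype.ext ?_
    change e • p x = 0
    obtain ⟨y, hy, hy'⟩ := hep x
    rw [hqp] at h
    rw [h, smul_zero] at hy'
    have hy0 : Finsupp.linearCombination D id y = 0 := Subtype.ext hy'.symm
    rw [hy, hy0, map_zero, map_zero]
  -- `P` is spanned over `R` by vectors fixed by `e`, so only products `r * a * e` matter.
  · rintro r hr ⟨_, x, rfl⟩
    refine Subtype.ext ?_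
    change r • p x = 0
    induction x using Finsupp.induction_linear with
    | zero => simp
    | add x y hx hy => rw [map_add, smul_add, hx, hy, add_zero]
    | single w a =>
      rw [Finsupp.linearCombination_single, ← hjle, ← mul_smul, ← mul_smul, hr, zero_smul]

/-- A ring with orthogonal idempotents `e₀, …, eₙ₋₁` of sum `1`, such that `eᵢ R eⱼ = 0` for `i < j`
and whose corner rings are semisimple, has finite global dimension. -/
theorem globalDimension_lt_top_of_triangular {R : Type u} [Ring R] {n : ℕ} (e : Fin n → R)
    (hsum : ∑ i, e i = 1) (htri : ∀ i j, i < j → ∀ a, e i * a * e j = 0)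
    (D : Fin n → Type u) [∀ i, Ring (D i)] [∀ i, IsSemisimpleRing (D i)]
    (j : ∀ i, D i →ₙ+* R) (hj : ∀ i, j i 1 = e i)
    (hje : ∀ i r, ∃ d, j i d = e i * r * e i) :
    globalDimension R < ⊤ := by
  -- Induction on the number `k` of idempotents that may act nontrivially: the first `n - k` kill
  -- `M`.
  have key : ∀ k ≤ n, ∀ M : ModuleCat.{u} R, (∀ i : Fin n, (i : ℕ) < n - k → ∀ m : M, e i • m = 0) →
      HasProjectiveDimensionLT M k := by
    intro k
    induction k with
    | zero =>
      intro _ M hM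
      have : Subsingleton M := ⟨fun a b => by
        rw [← one_smul R a, ← one_smul R b, ← hsum, Finset.sum_smul, Finset.sum_smul]
        simp [hM]⟩
      exact (ModuleCat.isZero_of_subsingleton M).hasProjectiveDimensionLT_zero
    | succ k ih =>
      intro hk M hM
      -- The first idempotent that may act nontrivially. By triangularity the earlier ones kill `P`,
      -- so kernel and cokernel of `q : P → M` are killed by `e i₀` and all earlier ones, and the
      -- induction hypothesis covers both. `M` is an extension of the cokernel by the image.
      let i₀ : Fin n := ⟨n - (k + 1), by omega⟩
      obtain ⟨P, _, _, q, hP, hq, hker, hsupp⟩ :=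
        exists_projective_of_semisimple_corner (e i₀) (j i₀) (hj i₀) (hje i₀) M
      have hlt (i : Fin n) (hi : (i : ℕ) < n - k) : i < i₀ ∨ i = i₀ := by
        rw [Fin.lt_def, Fin.ext_iff]; simp only [i₀]; omega
      have hPs (i : Fin n) (hi : i < i₀) (x : P) : e i • x = 0 := hsupp _ (htri i i₀ hi) x
      have hK : HasProjectiveDimensionLT (ModuleCat.of R (LinearMap.ker q.rangeRestrict)) k := by
        refine ih (by omega) _ fun i hi x => Subtype.ext ?_
        change e i • (x : P) = 0
        rcases hlt i hi with h | rfl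
        · exact hPs i h x
        · refine hker _ ?_
          have := x.2
          rw [LinearMap.mem_ker] at this
          exact congrArg Subtype.val this
      have hN : HasProjectiveDimensionLT (ModuleCat.of R (LinearMap.range q)) (k + 1) := by
        refine (LinearMap.shortExact_shortComplexKer
          q.surjective_rangeRestrict).hasProjectiveDimensionLT_X₃ k hK ?_
        have : Module.Projective R (ModuleCat.of R P) := hP
        have : Projective (ModuleCat.of R P) := inferInstance
        have : HasProjectiveDimensionLT (ModuleCat.of R P) 1 := inferInstance
        exact hasProjectiveDimensionLT_of_ge _ 1 (k + 1) (by omega)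
      have hC : HasProjectiveDimensionLT (ModuleCat.of R (M ⧸ LinearMap.range q)) (k + 1) := by
        have : HasProjectiveDimensionLT (ModuleCat.of R (M ⧸ LinearMap.range q)) k := by
          refine ih (by omega) _ fun i hi x => ?_
          obtain ⟨m, rfl⟩ := Submodule.Quotient.mk_surjective _ x
          rw [← Submodule.Quotient.mk_smul, Submodule.Quotient.mk_eq_zero]
          rcases hlt i hi with h | rfl
          · rw [hM i (by simpa [i₀, Fin.lt_def] using h)]; exact zero_mem _
          · exact hq m
        exact hasProjectiveDimensionLT_of_ge _ k (k + 1) (by omega)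
      let S : ShortComplex (ModuleCat.{u} R) := ShortComplex.mk
        (ModuleCat.ofHom (LinearMap.range q).subtype) (ModuleCat.ofHom (LinearMap.range q).mkQ) (by
          ext x; exact (Submodule.Quotient.mk_eq_zero _).mpr x.2)
      have hS : S.ShortExact := ModuleCat.shortComplex_shortExact S
        (LinearMap.exact_subtype_mkQ _) (Submodule.injective_subtype _) (Submodule.mkQ_surjective _)
      exact hS.hasProjectiveDimensionLT_X₂ (k + 1) hN hC
  have hle : globalDimension R ≤ (n : ℕ∞) := by
    refine iSup_le fun M => ?_
    have : HasProjectiveDimensionLT M n := key n le_rfl M (by simp)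
    exact (projectiveDimension_lt_iff.mpr this).le
  refine hle.trans_lt ?_
  exact WithBot.coe_lt_coe.mpr (ENat.natCast_lt_top n)

/-- Let `T = ⨁ Tᵢ` in a preadditive category, with no nonzero maps from `Tᵢ` to `Tⱼ` for `i < j` and
with semisimple rings `End(Tᵢ)`. Then `End(T)` has finite global dimension. -/
theorem globalDimension_end_biproduct_lt_top {C : Type*} [Category.{u} C] [Preadditive C] {n : ℕ}
    (T : Fin n → C) [HasBiproduct T] (htri : ∀ i j, i < j → ∀ f : T i ⟶ T j, f = 0)
    (hss : ∀ i, IsSemisimpleRing (End (T i))) :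
    globalDimension (End (⨁ T)) < ⊤ := by
  classical
  have hrev (i j : Fin n) (h : i < j) (a : End (⨁ T)) :
      (biproduct.π T i ≫ biproduct.ι T i) ≫ a ≫ (biproduct.π T j ≫ biproduct.ι T j) = 0 := by
    have := htri i j h (biproduct.ι T i ≫ a ≫ biproduct.π T j)
    rw [Category.assoc, ← Category.assoc a, ← Category.assoc (biproduct.ι T i), this]
    simp
  have hsum : ∑ i : Fin n, biproduct.π T i ≫ biproduct.ι T i = 𝟙 (⨁ T) := biproduct.total
  -- In `End` one has `x * y = y ≫ x`, so a product `e i * a * e j` passes from the summand of `e j`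
  -- to that of `e i`. Reversing the indices makes `htri` the required triangularity.
  refine globalDimension_lt_top_of_triangular (R := End (⨁ T))
    (fun i => biproduct.π T i.rev ≫ biproduct.ι T i.rev) ?_ ?_ (fun i => End (T i.rev))
    (fun i =>
      { toFun := fun d => (biproduct.π T i.rev ≫ d ≫ biproduct.ι T i.rev : ⨁ T ⟶ ⨁ T)
        map_zero' := by simp
        map_add' := fun x y =>
          (congrArg (biproduct.π T i.rev ≫ ·) (Preadditive.add_comp _ _ _ _ _ _)).trans
            (Preadditive.comp_add _ _ _ _ _ _)
        map_mul' := fun x y => by simp [End.mul_def] }) (fun i => ?_) (fun i r => ?_)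
  · rw [End.one_def, ← hsum]
    exact Equiv.sum_comp Fin.revPerm (fun i : Fin n => biproduct.π T i ≫ biproduct.ι T i)
  · intro i j hij a
    rw [End.mul_def, End.mul_def]
    exact hrev _ _ (Fin.rev_lt_rev.mpr hij) a
  · change biproduct.π T i.rev ≫ 𝟙 _ ≫ biproduct.ι T i.rev = _
    simp
  · refine ⟨(biproduct.ι T i.rev ≫ r ≫ biproduct.π T i.rev : T i.rev ⟶ T i.rev), ?_⟩
    change biproduct.π T i.rev ≫ (biproduct.ι T i.rev ≫ r ≫ biproduct.π T i.rev) ≫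
      biproduct.ι T i.rev = _
    simp [End.mul_def]

end TriangularRings

/-! ### Base change and descent of simple algebras -/

section CentralSimple

/-- The base change of a central simple algebra to a field extension is simple. -/
theorem isSimpleRing_tensorProduct (F K A : Type*) [Field F] [Field K] [Algebra F K] [Ring A]
    [Algebra F A] [Algebra.IsCentral F A] [IsSimpleRing A] : IsSimpleRing (K ⊗[F] A) := by
  classical
  refine isSimpleRing_iff_isTwoSided_imp.mpr ⟨inferInstance, fun I hI => ?_⟩
  refine or_iff_not_imp_left.mpr fun hne => ?_
  let b := Module.Basis.ofVectorSpace F K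
  let c := TensorProduct.equivFinsuppOfBasisLeft (N := A) b
  have hcl (a : A) (x : K ⊗[F] A) (i) : c ((1 ⊗ₜ a) * x) i = a * c x i := by
    induction x using TensorProduct.induction_on with
    | zero => simp
    | add x y hx hy => simp only [mul_add, map_add, Finsupp.add_apply, hx, hy]
    | tmul k y => simp [c]
  have hcr (a : A) (x : K ⊗[F] A) (i) : c (x * (1 ⊗ₜ a)) i = c x i * a := by
    induction x using TensorProduct.induction_on with
    | zero => simp
    | add x y hx hy => simp only [add_mul, map_add, Finsupp.add_apply, hx, hy]
    | tmul k y => simp [c]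
  obtain ⟨x₀, hx₀, hx₀0⟩ := Submodule.exists_mem_ne_zero_of_ne_bot hne
  -- A nonzero element of `I` of minimal support with respect to the basis `b` of `K` over `F`.
  obtain ⟨N, ⟨x, hxI, hx0, hxN⟩, hmin⟩ : ∃ N : ℕ, (∃ x ∈ I, x ≠ 0 ∧ (c x).support.card = N) ∧
      ∀ m < N, ¬ ∃ x ∈ I, x ≠ 0 ∧ (c x).support.card = m :=
    have h : ∃ N : ℕ, ∃ x ∈ I, x ≠ 0 ∧ (c x).support.card = N := ⟨_, x₀, hx₀, hx₀0, rfl⟩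
    ⟨Nat.find h, Nat.find_spec h, fun m hm => Nat.find_min h hm⟩
  obtain ⟨i, hi⟩ : ∃ i, c x i ≠ 0 := by
    by_contra! h
    exact hx0 (c.injective (by ext j; simp [h]))
  -- The coefficients at `i` of elements of `I` supported where `x` is form a nonzero two-sided
  -- ideal of `A`. By simplicity some such `y` has coefficient `1` at `i`.
  let T : TwoSidedIdeal A := TwoSidedIdeal.mk'
    {a | ∃ y ∈ I, (c y).support ⊆ (c x).support ∧ c y i = a}
    ⟨0, zero_mem _, by simp, by simp⟩
    (by
      rintro _ _ ⟨y, hy, hys, rfl⟩ ⟨z, hz, hzs, rfl⟩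
      exact ⟨y + z, add_mem hy hz, by
        rw [map_add]; exact Finsupp.support_add.trans (Finset.union_subset hys hzs), by simp⟩)
    (by
      rintro _ ⟨y, hy, hys, rfl⟩
      exact ⟨-y, neg_mem hy, by rw [map_neg, Finsupp.support_neg]; exact hys, by simp⟩)
    (by
      rintro a _ ⟨y, hy, hys, rfl⟩
      refine ⟨(1 ⊗ₜ a) * y, I.mul_mem_left _ hy, fun j hj => hys ?_, hcl _ _ _⟩
      rw [Finsupp.mem_support_iff, hcl] at hj
      exact Finsupp.mem_support_iff.mpr (right_ne_zero_of_mul hj))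
    (by
      rintro _ a ⟨y, hy, hys, rfl⟩
      refine ⟨y * (1 ⊗ₜ a), I.mul_mem_right _ hy, fun j hj => hys ?_, hcr _ _ _⟩
      rw [Finsupp.mem_support_iff, hcr] at hj
      exact Finsupp.mem_support_iff.mpr (left_ne_zero_of_mul hj))
  have hT (a : A) : a ∈ T ↔ ∃ y ∈ I, (c y).support ⊆ (c x).support ∧ c y i = a :=
    TwoSidedIdeal.mem_mk' _ _ _ _ _ _ _
  obtain ⟨y, hyI, hys, hyi⟩ := (hT 1).mp
    (IsSimpleRing.one_mem_of_ne_zero_mem T hi ((hT _).mpr ⟨x, hxI, subset_rfl, rfl⟩))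
  -- The commutator loses the coefficient at `i`, so minimality kills it. Hence the coefficients of
  -- `y` are central, and `y = k ⊗ 1` is invertible.
  have hcomm (a : A) : (1 ⊗ₜ a) * y - y * (1 ⊗ₜ a) = 0 := by
    by_contra h
    refine hmin _ ?_ ⟨_, sub_mem (I.mul_mem_left _ hyI) (I.mul_mem_right _ hyI), h, rfl⟩
    rw [← hxN]
    refine Finset.card_lt_card ((Finset.ssubset_iff_of_subset fun j hj => hys ?_).mpr
      ⟨i, Finsupp.mem_support_iff.mpr hi, ?_⟩)
    · rw [Finsupp.mem_support_iff, map_sub, Finsupp.sub_apply, hcl, hcr] at hj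
      rw [Finsupp.mem_support_iff]
      rintro h0
      simp [h0] at hj
    · simp [hcl, hcr, hyi]
  have hcent (j) : ∃ r : F, algebraMap F A r = c y j := by
    have : c y j ∈ Subalgebra.center F A := by
      rw [Subalgebra.mem_center_iff]
      intro a
      have := DFunLike.congr_fun (congrArg c (hcomm a)) j
      rwa [map_sub, Finsupp.sub_apply, hcl, hcr, map_zero, Finsupp.zero_apply, sub_eq_zero] at this
    exact Algebra.mem_bot.mp (Algebra.IsCentral.out this)
  choose r hr using hcent
  have hy : y = (∑ j ∈ (c y).support, r j • b j) ⊗ₜ (1 : A) := by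
    refine (c.symm_apply_apply y).symm.trans ?_
    rw [TensorProduct.equivFinsuppOfBasisLeft_symm_apply, Finsupp.sum, TensorProduct.sum_tmul]
    refine Finset.sum_congr rfl fun j _ => ?_
    rw [← hr, Algebra.algebraMap_eq_smul_one, TensorProduct.tmul_smul, TensorProduct.smul_tmul']
  set k : K := ∑ j ∈ (c y).support, r j • b j
  have hk : k ≠ 0 := by
    rintro hk
    rw [hk, TensorProduct.zero_tmul] at hy
    rw [hy] at hyi
    simp at hyi
  rw [Ideal.eq_top_iff_one]
  have := I.mul_mem_left (k⁻¹ ⊗ₜ (1 : A)) hyI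
  rwa [hy, Algebra.TensorProduct.tmul_mul_tmul, inv_mul_cancel₀ hk, one_mul] at this

/-- A central simple algebra of degree `n` splits over an algebraically closed field. -/
theorem exists_algEquiv_matrix_of_isAlgClosed (F K A : Type*) [Field F] [Field K] [Algebra F K]
    [IsAlgClosed K] [Ring A] [Algebra F A] [FiniteDimensional F A] [Algebra.IsCentral F A]
    [IsSimpleRing A] (n : ℕ) (hn : Module.finrank F A = n ^ 2) :
    Nonempty (K ⊗[F] A ≃ₐ[K] Matrix (Fin n) (Fin n) K) := by
  have := isSimpleRing_tensorProduct F K A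
  obtain ⟨m, _, ⟨θ⟩⟩ := IsSimpleRing.exists_algEquiv_matrix_of_isAlgClosed K (K ⊗[F] A)
  have h := θ.toLinearEquiv.finrank_eq
  rw [Module.finrank_baseChange, hn, Module.finrank_matrix] at h
  simp only [Fintype.card_fin, Module.finrank_self, mul_one] at h
  have : n = m := Nat.pow_left_injective two_ne_zero (h.trans (sq m).symm)
  subst this
  exact ⟨θ⟩

/-- An algebra which becomes a matrix algebra over an extension field is a semisimple ring. -/
theorem isSemisimpleRing_of_baseChange_bijective {F K E ι : Type*} [Field F] [Field K] [Algebra F K]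
    [Ring E] [Algebra F E] [Fintype ι] [DecidableEq ι] [Nonempty ι] (ρ : E →ₐ[F] Matrix ι ι K)
    (hinj : Function.Injective (TensorProduct.AlgebraTensorModule.lift
      ((LinearMap.toSpanSingleton K (E →ₗ[F] Matrix ι ι K) ρ.toLinearMap))))
    (hspan : Submodule.span K (Set.range ρ) = ⊤) :
    IsSemisimpleRing E := by
  set l : K ⊗[F] E →ₗ[K] Matrix ι ι K := TensorProduct.AlgebraTensorModule.lift
      ((LinearMap.toSpanSingleton K (E →ₗ[F] Matrix ι ι K) ρ.toLinearMap)) with hl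
  have hl1 (k : K) (x : E) : l (k ⊗ₜ x) = k • ρ x := by simp [hl]
  have hsurj : Function.Surjective l := by
    rw [← LinearMap.range_eq_top, eq_top_iff, ← hspan, Submodule.span_le]
    rintro _ ⟨x, rfl⟩
    exact ⟨1 ⊗ₜ x, by rw [hl1, one_smul]⟩
  let Φ : K ⊗[F] E ≃ₐ[K] Matrix ι ι K := AlgEquiv.ofLinearEquiv
    (LinearEquiv.ofBijective l ⟨hinj, hsurj⟩)
    (by change l (1 ⊗ₜ 1) = 1; rw [hl1, one_smul, map_one])
    (by
      intro x y
      change l (x * y) = l x * l y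
      induction x using TensorProduct.induction_on with
      | zero => simp
      | add x x' hx hx' => rw [add_mul, map_add, hx, hx', map_add, add_mul]
      | tmul k a =>
        induction y using TensorProduct.induction_on with
        | zero => simp
        | add x x' hx hx' => rw [mul_add, map_add, hx, hx', map_add, mul_add]
        | tmul k' a' => simp [hl1, smul_smul, mul_comm])
  have hs : IsSimpleRing (K ⊗[F] E) := IsSimpleRing.of_ringEquiv Φ.symm.toRingEquiv inferInstance
  have : Module.Finite K (K ⊗[F] E) := Module.Finite.equiv Φ.symm.toLinearEquiv
  have : Module.Finite F E := by
    let b := Module.Basis.ofVectorSpace F E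
    have := Module.Finite.finite_basis (b.baseChange K)
    exact Module.Finite.of_basis b
  have hnt : Nontrivial E := by
    by_contra h
    rw [not_nontrivial_iff_subsingleton] at h
    have h0 : (1 : K ⊗[F] E) = 0 := by
      rw [Algebra.TensorProduct.one_def, Subsingleton.elim (1 : E) 0, TensorProduct.tmul_zero]
    exact one_ne_zero h0
  have : IsSimpleRing E := by
    refine isSimpleRing_iff_isTwoSided_imp.mpr ⟨hnt, fun I hI => ?_⟩
    refine or_iff_not_imp_right.mpr fun hne => ?_
    have : Nontrivial (E ⧸ I) := Ideal.Quotient.nontrivial_iff.mpr hne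
    -- For proper `I` this is a homomorphism from a simple ring to a nonzero ring, hence injective;
    -- faithful flatness of `K` over `F` then gives `I = 0`.
    let q : K ⊗[F] E →ₐ[K] K ⊗[F] (E ⧸ I) :=
      Algebra.TensorProduct.map (AlgHom.id K K) (Ideal.Quotient.mkₐ F I)
    have hq : Function.Injective q := q.toRingHom.injective
    rw [eq_bot_iff]
    intro x hx
    have h1 : (1 : K) ⊗ₜ[F] x = 0 := hq (by
      rw [map_zero]
      simp [q, Ideal.Quotient.eq_zero_iff_mem.mpr hx])
    exact (Module.FaithfullyFlat.one_tmul_eq_zero_iff F E x).mp h1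
  exact IsSimpleRing.isSemisimpleRing_iff_isArtinianRing.mpr (IsArtinianRing.of_finite F E)

end CentralSimple

/-! ### Base change through its universal property -/

section SemilinearBaseChange

/-- A semilinear map `M → N` over `σ : B → R` which is universal among semilinear maps from `M` to
`R`-modules, i.e. which identifies `N` with the base change `R ⊗[B] M`. -/
def IsSemilinearBaseChange {B R : Type u} [CommRing B] [CommRing R] {σ : B →+* R}
    {M N : Type u} [AddCommGroup M] [Module B M] [AddCommGroup N] [Module R N]
    (f : M →ₛₗ[σ] N) : Prop :=
  ∀ (Q : Type u) [AddCommGroup Q] [Module R Q] (g : M →ₛₗ[σ] Q),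
    ∃! h : N →ₗ[R] Q, ∀ m, h (f m) = g m

namespace IsSemilinearBaseChange

variable {B R : Type u} [CommRing B] [CommRing R] {σ : B →+* R}
  {M N : Type u} [AddCommGroup M] [Module B M] [AddCommGroup N] [Module R N]
  {M' N' : Type u} [AddCommGroup M'] [Module B M'] [AddCommGroup N'] [Module R N']
  {f : M →ₛₗ[σ] N} {f' : M' →ₛₗ[σ] N'}

lemma hom_ext (hf : IsSemilinearBaseChange f) {Q : Type u} [AddCommGroup Q] [Module R Q]
    {g h : N →ₗ[R] Q} (H : ∀ m, g (f m) = h (f m)) : g = h :=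
  (hf Q (h.comp f)).unique H fun _ => rfl

lemma span_range (hf : IsSemilinearBaseChange f) : Submodule.span R (Set.range f) = ⊤ := by
  have : (Submodule.span R (Set.range f)).mkQ = 0 := hf.hom_ext fun m => by
    simpa using Submodule.subset_span (Set.mem_range_self m)
  rw [← Submodule.ker_mkQ (Submodule.span R (Set.range f)), this, LinearMap.ker_zero]

lemma of_span_range (hs : Submodule.span R (Set.range f) = ⊤)
    (h : ∀ (Q : Type u) [AddCommGroup Q] [Module R Q] (g : M →ₛₗ[σ] Q),
      ∃ h : N →ₗ[R] Q, ∀ m, h (f m) = g m) : IsSemilinearBaseChange f := by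
  intro Q _ _ g
  refine existsUnique_of_exists_of_unique (h Q g) fun h₁ h₂ H₁ H₂ => ?_
  refine LinearMap.ext_on hs ?_
  rintro _ ⟨m, rfl⟩
  rw [H₁, H₂]

/-- The tensor product of base changes is a base change. -/
lemma tensor (hf : IsSemilinearBaseChange f) (hf' : IsSemilinearBaseChange f') :
    IsSemilinearBaseChange (TensorProduct.map f f') := by
  refine of_span_range ?_ fun Q _ _ g => ?_
  · rw [eq_top_iff, ← TensorProduct.span_tmul_eq_top, Submodule.span_le]
    rintro _ ⟨y, y', rfl⟩
    have hy : y ∈ Submodule.span R (Set.range f) := by rw [hf.span_range]; trivial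
    have hy' : y' ∈ Submodule.span R (Set.range f') := by rw [hf'.span_range]; trivial
    change y ⊗ₜ[R] y' ∈ Submodule.span R (Set.range (TensorProduct.map f f'))
    induction hy using Submodule.span_induction with
    | zero => rw [TensorProduct.zero_tmul]; exact zero_mem _
    | add a b _ _ ha hb => rw [TensorProduct.add_tmul]; exact add_mem ha hb
    | smul r a _ ha => rw [← TensorProduct.smul_tmul']; exact Submodule.smul_mem _ _ ha
    | mem a ha =>
      obtain ⟨m, rfl⟩ := ha
      induction hy' using Submodule.span_induction with
      | zero => rw [TensorProduct.tmul_zero]; exact zero_mem _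
      | add a b _ _ ha hb => rw [TensorProduct.tmul_add]; exact add_mem ha hb
      | smul r a _ ha => rw [TensorProduct.tmul_smul]; exact Submodule.smul_mem _ _ ha
      | mem a ha =>
        obtain ⟨m', rfl⟩ := ha
        exact Submodule.subset_span ⟨m ⊗ₜ m', rfl⟩
  -- Currying: extend `g (m ⊗ ·)` to `N'` for each `m`, then extend the resulting semilinear family
  -- from `M` to `N`.
  · choose h hh hu using fun m : M => hf' Q ((TensorProduct.mk B M M' m).comp (LinearMap.id) |> g.comp)
    let h' : M →ₛₗ[σ] (N' →ₗ[R] Q) :=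
      { toFun := h
        map_add' := fun a b => hf'.hom_ext fun m => by
          rw [hh, LinearMap.add_apply, hh, hh]
          simp
        map_smul' := fun r a => hf'.hom_ext fun m => by
          rw [hh, LinearMap.smul_apply, hh]
          simp }
    obtain ⟨H, hH, -⟩ := hf (N' →ₗ[R] Q) h'
    refine ⟨TensorProduct.lift H, fun m => ?_⟩
    induction m using TensorProduct.induction_on with
    | zero => simp
    | add a b ha hb => rw [map_add, map_add, ha, hb, map_add]
    | tmul m m' =>
      rw [TensorProduct.map_tmul, TensorProduct.lift.tmul, hH]
      exact hh m m'

lemma comp_linearEquiv (hf : IsSemilinearBaseChange f) (l : N ≃ₗ[R] N') :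
    IsSemilinearBaseChange (l.toLinearMap.comp f) := by
  intro Q _ _ g
  obtain ⟨h, hh, -⟩ := hf Q g
  refine ⟨h.comp l.symm.toLinearMap, fun m => by simp [hh], fun h' H => ?_⟩
  have : h'.comp l.toLinearMap = h := hf.hom_ext fun m => by rw [hh]; exact H m
  rw [← this]
  ext; simp

lemma comp_linearEquiv_left (hf : IsSemilinearBaseChange f) (l : M' ≃ₗ[B] M) :
    IsSemilinearBaseChange (f.comp l.toLinearMap) := by
  intro Q _ _ g
  obtain ⟨h, hh, hu⟩ := hf Q (g.comp l.symm.toLinearMap)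
  refine ⟨h, fun m => by simp [hh], fun h' H => hu h' fun m => ?_⟩
  have := H (l.symm m)
  simpa using this

variable (σ) in
lemma ringHom : IsSemilinearBaseChange (σ.toSemilinearMap) := by
  refine of_span_range ?_ fun Q _ _ g => ⟨LinearMap.toSpanSingleton R Q (g 1), fun m => ?_⟩
  · rw [eq_top_iff]
    intro x _
    rw [← mul_one x, ← smul_eq_mul]
    exact Submodule.smul_mem _ _ (Submodule.subset_span ⟨1, map_one σ⟩)
  · change σ m • g 1 = g m
    rw [← map_smulₛₗ, smul_eq_mul, mul_one]

/-- If the base change of a family of modules to a localization of `B` at `r` is given by `f`, then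
elements in the kernel of `f` are killed by a power of `r`. -/
lemma exists_pow_smul_eq_zero (hf : IsSemilinearBaseChange f) (r : B)
    (hr : letI := σ.toAlgebra; IsLocalization.Away r R) {m : M} (hm : f m = 0) :
    ∃ k : ℕ, r ^ k • m = 0 := by
  let := σ.toAlgebra
  have : IsLocalization (Submonoid.powers r) R := hr
  -- The standard localization map factors through `f`, so `f m = 0` implies `1 ⊗ m = 0`.
  let g : M →ₛₗ[σ] R ⊗[B] M :=
    { toFun := TensorProduct.mk B R M 1
      map_add' := map_add _
      map_smul' := fun a x => by
        rw [map_smul]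
        exact (algebraMap_smul R a ((1 : R) ⊗ₜ[B] x)).symm }
  have : IsLocalizedModule (Submonoid.powers r) (TensorProduct.mk B R M 1) :=
    (isLocalizedModule_iff_isBaseChange _ R _).mpr (TensorProduct.isBaseChange B M R)
  obtain ⟨h, hh, -⟩ := hf _ g
  have h0 : TensorProduct.mk B R M 1 m = 0 := by
    have := hh m
    rw [hm, map_zero] at this
    exact this.symm
  obtain ⟨⟨_, k, rfl⟩, hk⟩ := (IsLocalizedModule.eq_zero_iff (Submonoid.powers r) _).mp h0
  exact ⟨k, hk⟩

lemma exists_pow_smul_eq (hf : IsSemilinearBaseChange f) (r : B)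
    (hr : letI := σ.toAlgebra; IsLocalization.Away r R) (y : N) :
    ∃ (k : ℕ) (m : M), σ r ^ k • y = f m := by
  let := σ.toAlgebra
  have : IsLocalization.Away r R := hr
  have hy : y ∈ Submodule.span R (Set.range f) := by rw [hf.span_range]; trivial
  induction hy using Submodule.span_induction with
  | zero => exact ⟨0, 0, by simp⟩
  | mem a ha =>
    obtain ⟨m, rfl⟩ := ha
    exact ⟨0, m, by simp⟩
  | add a b _ _ ha hb =>
    obtain ⟨k, m, ha⟩ := ha
    obtain ⟨l, m', hb⟩ := hb
    refine ⟨k + l, r ^ l • m + r ^ k • m', ?_⟩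
    rw [map_add, map_smulₛₗ, map_smulₛₗ, map_pow, map_pow, ← ha, ← hb, smul_add, ← mul_smul,
      ← mul_smul, ← pow_add, ← pow_add, add_comm l k]
  | smul a b _ hb =>
    obtain ⟨k, m, hb⟩ := hb
    obtain ⟨l, c, hc⟩ := IsLocalization.Away.surj r a
    refine ⟨l + k, c • m, ?_⟩
    rw [map_smulₛₗ, ← hb]
    change _ = algebraMap B R c • _
    rw [← hc, ← mul_smul, ← mul_smul]
    congr 1
    change σ r ^ (l + k) * a = a * σ r ^ l * σ r ^ k
    ring

end IsSemilinearBaseChange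

end SemilinearBaseChange

namespace SeveriBrauer

/-! ### Right ideals and their base change -/

section IdealPoints

variable {F : Type u} [Field F] {A : Type u} [Ring A] [Algebra F A] {n : ℕ}
  {R S T : Type u} [CommRing R] [Algebra F R] [CommRing S] [Algebra F S] [CommRing T] [Algebra F T]

variable (A) in
/-- The extension of scalars `R ⊗[F] A → S ⊗[F] A` along `f : R → S`. -/
noncomputable def extendTensor (f : R →ₐ[F] S) : R ⊗[F] A →ₛₗ[(f : R →+* S)] S ⊗[F] A where
  toFun := f.toLinearMap.rTensor A
  map_add' := map_add _
  map_smul' r x := by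
    induction x using TensorProduct.induction_on with
    | zero => simp
    | add x y hx hy => rw [smul_add, map_add, hx, hy, map_add, smul_add]
    | tmul s a => simp [TensorProduct.smul_tmul']

@[simp]
lemma extendTensor_tmul (f : R →ₐ[F] S) (r : R) (a : A) :
    extendTensor A f (r ⊗ₜ a) = f r ⊗ₜ a := rfl

lemma extendTensor_comp_apply (f : R →ₐ[F] S) (g : S →ₐ[F] T) (x : R ⊗[F] A) :
    extendTensor A (g.comp f) x = extendTensor A g (extendTensor A f x) := by
  induction x using TensorProduct.induction_on with
  | zero => simp
  | add x y hx hy => rw [map_add, hx, hy, map_add, map_add]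
  | tmul s a => simp

lemma extendTensor_mul (f : R →ₐ[F] S) (x y : R ⊗[F] A) :
    extendTensor A f (x * y) = extendTensor A f x * extendTensor A f y := by
  induction x using TensorProduct.induction_on with
  | zero => simp
  | add x x' hx hx' => rw [add_mul, map_add, hx, hx', map_add, add_mul]
  | tmul s a =>
    induction y using TensorProduct.induction_on with
    | zero => simp
    | add x x' hx hx' => rw [mul_add, map_add, hx, hx', map_add, mul_add]
    | tmul s a => simp

lemma isSemilinearBaseChange_extendTensor (f : R →ₐ[F] S) :
    IsSemilinearBaseChange (extendTensor A f) := by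
  refine IsSemilinearBaseChange.of_span_range ?_ fun Q _ _ g => ?_
  · rw [eq_top_iff]
    intro x _
    induction x using TensorProduct.induction_on with
    | zero => exact zero_mem _
    | add x y hx hy => exact add_mem (hx trivial) (hy trivial)
    | tmul s a =>
      rw [← mul_one s, ← smul_eq_mul, ← TensorProduct.smul_tmul']
      exact Submodule.smul_mem _ _ (Submodule.subset_span ⟨1 ⊗ₜ a, by simp⟩)
  · let : Module F Q := Module.compHom Q (algebraMap F S)
    have : IsScalarTower F S Q := ⟨fun a b c => by
      change (a • b) • c = algebraMap F S a • b • c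
      rw [Algebra.smul_def, mul_smul]⟩
    let g₀ : A →ₗ[F] Q :=
      { toFun := fun a => g (1 ⊗ₜ a)
        map_add' := fun a b => by rw [TensorProduct.tmul_add, map_add]
        map_smul' := fun c a => by
          have : (1 : R) ⊗ₜ[F] (c • a) = algebraMap F R c • (1 ⊗ₜ a) := by
            rw [TensorProduct.tmul_smul, algebraMap_smul]
          rw [this, map_smulₛₗ]
          change f (algebraMap F R c) • g (1 ⊗ₜ a) = algebraMap F S c • g (1 ⊗ₜ a)
          rw [f.commutes] }
    refine ⟨g₀.liftBaseChange S, fun x => ?_⟩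
    induction x using TensorProduct.induction_on with
    | zero => simp
    | add x y hx hy => rw [map_add, map_add, hx, hy, map_add]
    | tmul s a =>
      rw [extendTensor_tmul, LinearMap.liftBaseChange_tmul]
      change f s • g (1 ⊗ₜ a) = _
      have : s ⊗ₜ[F] a = s • ((1 : R) ⊗ₜ[F] a) := by rw [TensorProduct.smul_tmul', smul_eq_mul, mul_one]
      rw [this, map_smulₛₗ]
      rfl

lemma IdealPoint.ext {J J' : IdealPoint F A n R} (h : J.toSubmodule = J'.toSubmodule) : J = J' :=
  IdealPoint.ext_grassmannian (Module.Grassmannian.ext h)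

lemma IdealPoint.map_comp (f : R →ₐ[F] S) (g : S →ₐ[F] T) (J : IdealPoint F A n R) :
    J.map (g.comp f) = (J.map f).map g :=
  IdealPoint.ext_grassmannian (Module.Grassmannian.map_comp _ f g J.toGrassmannian)

/-- The base change of a right ideal is generated by its image. -/
lemma IdealPoint.map_toSubmodule (f : R →ₐ[F] S) (J : IdealPoint F A n R) :
    (J.map f).toSubmodule = Submodule.span S (extendTensor A f '' J.toSubmodule) := by
  let : Algebra R S := f.toAlgebra
  let : IsScalarTower F R S :=
    IsScalarTower.of_algebraMap_eq' <| IsScalarTower.algebraMap_eq F R S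
  change (Module.Grassmannian.map f J.toGrassmannian).toSubmodule = _
  rw [Module.Grassmannian.map_toSubmodule]
  have hc (x : R ⊗[F] A) : (TensorProduct.AlgebraTensorModule.cancelBaseChange F R S S A)
      (1 ⊗ₜ x) = extendTensor A f x := by
    induction x using TensorProduct.induction_on with
    | zero => simp
    | add x y hx hy => rw [TensorProduct.tmul_add, map_add, hx, hy, map_add]
    | tmul r a =>
      simp only [TensorProduct.AlgebraTensorModule.cancelBaseChange_tmul, extendTensor_tmul]
      rw [Algebra.smul_def, mul_one]
      rfl
  apply le_antisymm
  · intro x hx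
    obtain ⟨y, rfl⟩ := (TensorProduct.AlgebraTensorModule.cancelBaseChange F R S S A).surjective x
    rw [LinearMap.mem_ker] at hx
    simp only [Module.Grassmannian.baseChangeMkQ, LinearMap.comp_apply, LinearEquiv.coe_coe,
      LinearEquiv.symm_apply_apply] at hx
    -- Right exactness of the tensor product: the kernel of the base-changed quotient map is the
    -- image of `S ⊗ J`.
    have hex : Function.Exact (J.toSubmodule.subtype.lTensor S) (J.toSubmodule.mkQ.lTensor S) :=
      lTensor_exact S (LinearMap.exact_subtype_mkQ _) (Submodule.mkQ_surjective _)
    obtain ⟨z, rfl⟩ := (hex y).mp hx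
    induction z using TensorProduct.induction_on with
    | zero => simp
    | add z w hz hw =>
      rw [map_add] at hx ⊢
      rw [map_add]
      refine add_mem (hz ?_) (hw ?_)
      · exact hex.apply_apply_eq_zero z
      · exact hex.apply_apply_eq_zero w
    | tmul s j =>
      have : s ⊗ₜ[R] (j : R ⊗[F] A) = s • ((1 : S) ⊗ₜ[R] (j : R ⊗[F] A)) := by
        rw [TensorProduct.smul_tmul', smul_eq_mul, mul_one]
      rw [LinearMap.lTensor_tmul, Submodule.subtype_apply, this, map_smul, hc]
      exact Submodule.smul_mem _ _ (Submodule.subset_span ⟨j, j.2, rfl⟩)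
  · rw [Submodule.span_le]
    rintro _ ⟨x, hx, rfl⟩
    change _ ∈ LinearMap.ker _
    rw [LinearMap.mem_ker, ← hc]
    simp only [Module.Grassmannian.baseChangeMkQ, LinearMap.comp_apply, LinearEquiv.coe_coe,
      LinearEquiv.symm_apply_apply, LinearMap.baseChange_tmul]
    rw [Submodule.mkQ_apply, (Submodule.Quotient.mk_eq_zero _).mpr hx, TensorProduct.tmul_zero]

lemma IdealPoint.extendTensor_mem (f : R →ₐ[F] S) (J : IdealPoint F A n R) {x : R ⊗[F] A}
    (hx : x ∈ J.toSubmodule) : extendTensor A f x ∈ (J.map f).toSubmodule := by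
  rw [IdealPoint.map_toSubmodule]
  exact Submodule.subset_span ⟨x, hx, rfl⟩

/-- The canonical map from a right ideal to its base change. -/
noncomputable def IdealPoint.toMap (f : R →ₐ[F] S) (J : IdealPoint F A n R) {J' : IdealPoint F A n S}
    (h : J.map f = J') :
    J.toSubmodule →ₛₗ[(f : R →+* S)] J'.toSubmodule where
  toFun x := ⟨extendTensor A f x, h ▸ J.extendTensor_mem f x.2⟩
  map_add' x y := Subtype.ext (map_add (extendTensor A f) (x : R ⊗[F] A) y)
  map_smul' r x := Subtype.ext (map_smulₛₗ (extendTensor A f) r (x : R ⊗[F] A))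

/-- An ideal point is a direct summand, its quotient being projective. A semilinear map out of `J`
thus extends to `R ⊗[F] A`, is base-changed there, and is restricted to the image ideal. -/
lemma IdealPoint.isSemilinearBaseChange_toMap (f : R →ₐ[F] S) (J : IdealPoint F A n R)
    {J' : IdealPoint F A n S} (h : J.map f = J') :
    IsSemilinearBaseChange (J.toMap f h) := by
  subst h
  refine IsSemilinearBaseChange.of_span_range ?_ fun Q _ _ g => ?_
  · rw [eq_top_iff]
    rintro ⟨x, hx⟩ -
    have hx' := hx
    rw [IdealPoint.map_toSubmodule] at hx'
    induction hx' using Submodule.span_induction with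
    | zero => exact zero_mem _
    | mem x hmem =>
      obtain ⟨y, hy, rfl⟩ := hmem
      exact Submodule.subset_span ⟨⟨y, hy⟩, rfl⟩
    | add x y hx' hy' ihx ihy =>
      rw [← IdealPoint.map_toSubmodule] at hx' hy'
      exact add_mem (ihx hx') (ihy hy')
    | smul r x hx' ih =>
      rw [← IdealPoint.map_toSubmodule] at hx'
      exact Submodule.smul_mem _ r (ih hx')
  · obtain ⟨s, hs⟩ := Module.projective_lifting_property J.toSubmodule.mkQ LinearMap.id
      (Submodule.mkQ_surjective _)
    let p : R ⊗[F] A →ₗ[R] J.toSubmodule :=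
      (LinearMap.id - s ∘ₗ J.toSubmodule.mkQ).codRestrict _ fun x => by
        rw [← Submodule.Quotient.mk_eq_zero, ← Submodule.mkQ_apply, LinearMap.sub_apply, map_sub]
        have := LinearMap.congr_fun hs (J.toSubmodule.mkQ x)
        simp only [LinearMap.comp_apply, LinearMap.id_apply] at this ⊢
        rw [this, sub_self]
    have hp (x : J.toSubmodule) : p x = x := by
      refine Subtype.ext ?_
      simp [p, (Submodule.Quotient.mk_eq_zero _).mpr x.2]
    obtain ⟨h, hh, -⟩ := isSemilinearBaseChange_extendTensor (A := A) f Q (g.comp p)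
    refine ⟨h.comp (Submodule.subtype _), fun x => ?_⟩
    refine (hh x).trans ?_
    rw [LinearMap.comp_apply, hp]

end IdealPoints

/-- A module is the product of a retract `i : P → M` and of the quotient `M / i(P)`. -/
noncomputable def equivProdQuotientRange {R M P : Type*} [Ring R] [AddCommGroup M] [Module R M]
    [AddCommGroup P] [Module R P] (i : P →ₗ[R] M) (r : M →ₗ[R] P) (h : ∀ x, r (i x) = x) :
    M ≃ₗ[R] P × (M ⧸ LinearMap.range i) :=
  LinearEquiv.ofBijective (r.prod (LinearMap.range i).mkQ) (by
    constructor
    · rw [← LinearMap.ker_eq_bot, eq_bot_iff]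
      intro x hx
      have h0 : r x = 0 := congrArg Prod.fst hx
      obtain ⟨y, rfl⟩ := (Submodule.Quotient.mk_eq_zero _).mp (congrArg Prod.snd hx)
      rw [h] at h0
      simp [h0]
    · rintro ⟨x, y⟩
      obtain ⟨y, rfl⟩ := Submodule.mkQ_surjective _ y
      refine ⟨y - i (r y) + i x, ?_⟩
      refine Prod.ext (by simp [h]) ?_
      change (LinearMap.range i).mkQ _ = _
      rw [map_add, map_sub]
      have h0 (z : P) : (LinearMap.range i).mkQ (i z) = 0 := by simp
      rw [h0, h0, sub_zero, add_zero])

/-! ### Right ideals of a split algebra -/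

section Split

open Matrix

variable {F : Type u} [Field F] {A : Type u} [Ring A] [Algebra F A] {n : ℕ}
  {K : Type u} [Field K] [Algebra F K] (θ : K ⊗[F] A ≃ₐ[K] Matrix (Fin n) (Fin n) K)
  (R S : Type u) [CommRing R] [Algebra F R] [Algebra K R] [IsScalarTower F K R]
  [CommRing S] [Algebra F S] [Algebra K S] [IsScalarTower F K S]

/-- The homomorphism `R ⊗[F] A → Mₙ(R)` induced by a splitting of `A` over `K`. -/
noncomputable def splitHom : R ⊗[F] A →ₐ[R] Matrix (Fin n) (Fin n) R :=
  Algebra.TensorProduct.lift (Algebra.ofId R _)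
    (((Algebra.ofId K R).mapMatrix.restrictScalars F).comp
      ((θ.toAlgHom.restrictScalars F).comp Algebra.TensorProduct.includeRight))
    fun _ _ => Algebra.commutes _ _

lemma splitHom_tmul (r : R) (a : A) :
    splitHom θ R (r ⊗ₜ a) = r • (θ (1 ⊗ₜ a)).map (algebraMap K R) := by
  rw [Algebra.smul_def]
  rfl

lemma splitHom_bijective : Function.Bijective (splitHom θ R) := by
  let e₁ : R ⊗[F] A ≃ₗ[R] R ⊗[K] (K ⊗[F] A) :=
    (TensorProduct.AlgebraTensorModule.cancelBaseChange F K R R A).symm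
  let e₂ : R ⊗[K] (K ⊗[F] A) ≃ₐ[K] R ⊗[K] Matrix (Fin n) (Fin n) K :=
    Algebra.TensorProduct.congr AlgEquiv.refl θ
  let e₃ := (matrixEquivTensor (Fin n) K R).symm
  have : ∀ x, splitHom θ R x = e₃ (e₂ (e₁ x)) := by
    intro x
    induction x using TensorProduct.induction_on with
    | zero => simp
    | add x y hx hy => rw [map_add, hx, hy, map_add, map_add, map_add]
    | tmul r a =>
      rw [splitHom_tmul]
      simp [e₁, e₂, e₃]
  rw [show ⇑(splitHom θ R) = e₃ ∘ e₂ ∘ e₁ from funext this]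
  exact e₃.bijective.comp (e₂.bijective.comp e₁.bijective)

/-- The isomorphism `R ⊗[F] A ≃ Mₙ(R)` induced by a splitting of `A` over `K`. -/
noncomputable def splitEquiv : R ⊗[F] A ≃ₐ[R] Matrix (Fin n) (Fin n) R :=
  AlgEquiv.ofBijective (splitHom θ R) (splitHom_bijective θ R)

lemma splitEquiv_tmul (r : R) (a : A) :
    splitEquiv θ R (r ⊗ₜ a) = r • (θ (1 ⊗ₜ a)).map (algebraMap K R) :=
  splitHom_tmul θ R r a

variable {R S} in
lemma splitEquiv_extendTensor (h : R →ₐ[K] S) (x : R ⊗[F] A) :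
    splitEquiv θ S (extendTensor A (h.restrictScalars F) x) = (splitEquiv θ R x).map h := by
  induction x using TensorProduct.induction_on with
  | zero => rw [map_zero, map_zero, map_zero, Matrix.map_zero _ (map_zero h)]
  | add x y hx hy => rw [map_add, map_add, hx, hy, map_add, Matrix.map_add _ (map_add h)]
  | tmul r a =>
    rw [extendTensor_tmul, splitEquiv_tmul, splitEquiv_tmul]
    ext p q
    simp

variable {R}

/-- The rank one matrices `v wᵀ` with fixed `v`, as a linear map in `w`. -/
noncomputable def splitIdealMap (v : Fin n → R) :
    (Fin n → R) →ₗ[R] R ⊗[F] A :=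
  (splitEquiv θ R).symm.toLinearMap ∘ₗ
    { toFun := vecMulVec v
      map_add' := fun x y => vecMulVec_add v x y
      map_smul' := fun r x => by ext; simp [vecMulVec_apply]; ring }

@[simp]
lemma splitEquiv_splitIdealMap (v w : Fin n → R) :
    splitEquiv θ R (splitIdealMap θ v w) = vecMulVec v w :=
  (splitEquiv θ R).apply_symm_apply _

lemma mem_range_splitIdealMap {v : Fin n → R} {x : R ⊗[F] A} :
    x ∈ LinearMap.range (splitIdealMap θ v) ↔ ∃ w, splitEquiv θ R x = vecMulVec v w := by
  constructor
  · rintro ⟨w, rfl⟩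
    exact ⟨w, splitEquiv_splitIdealMap θ v w⟩
  · rintro ⟨w, hw⟩
    exact ⟨w, (splitEquiv θ R).injective (by rw [splitEquiv_splitIdealMap, hw])⟩

/-- The coordinates `cᵀ x` of a matrix `x`. -/
noncomputable def splitCoord (c : Fin n → R) : R ⊗[F] A →ₗ[R] (Fin n → R) where
  toFun x := c ᵥ* splitEquiv θ R x
  map_add' x y := by rw [map_add, vecMul_add]
  map_smul' r x := by rw [map_smul, vecMul_smul]; rfl

lemma splitCoord_apply (c : Fin n → R) (x : R ⊗[F] A) :
    splitCoord θ c x = c ᵥ* splitEquiv θ R x := rfl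

lemma splitCoord_splitIdealMap {c v : Fin n → R} (h : c ⬝ᵥ v = 1) (w : Fin n → R) :
    splitCoord θ c (splitIdealMap θ v w) = w := by
  rw [splitCoord_apply, splitEquiv_splitIdealMap, vecMul_vecMulVec, h]
  simp

/-- The map `x ↦ x - v (cᵀ x)` vanishes on the ideal and descends to a section of the quotient map.
-/
lemma projective_quotient_splitIdealMap {c v : Fin n → R} (h : c ⬝ᵥ v = 1) :
    Module.Projective R (R ⊗[F] A ⧸ LinearMap.range (splitIdealMap θ v)) := by
  refine Module.Projective.of_split
    ((LinearMap.range (splitIdealMap θ v)).liftQ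
      (LinearMap.id - splitIdealMap θ v ∘ₗ splitCoord θ c) ?_)
    (LinearMap.range (splitIdealMap θ v)).mkQ ?_
  · rintro _ ⟨w, rfl⟩
    simp [splitCoord_splitIdealMap θ h]
  · refine LinearMap.ext fun x => ?_
    obtain ⟨x, rfl⟩ := Submodule.mkQ_surjective _ x
    have h0 : (LinearMap.range (splitIdealMap θ v)).mkQ
        (splitIdealMap θ v (splitCoord θ c x)) = 0 := by simp
    simp only [LinearMap.comp_apply, Submodule.mkQ_apply, Submodule.liftQ_apply,
      LinearMap.sub_apply, LinearMap.id_apply] at h0 ⊢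
    rw [Submodule.Quotient.mk_sub, h0, sub_zero]

variable [FiniteDimensional F A]

/-- The right ideal of matrices with columns in the line spanned by a unimodular vector `v`. -/
noncomputable def splitPoint (v : Fin n → R) (h : ∃ c, c ⬝ᵥ v = 1) : IdealPoint F A n R where
  toSubmodule := LinearMap.range (splitIdealMap θ v)
  finite_quotient := inferInstance
  projective_quotient := projective_quotient_splitIdealMap θ h.choose_spec
  rankAtStalk_eq p := by
    obtain ⟨c, hc⟩ := h
    have : Nontrivial R := p.nontrivial
    have := projective_quotient_splitIdealMap θ hc
    have h := congrFun (Module.rankAtStalk_eq_of_equiv (equivProdQuotientRange (splitIdealMap θ v)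
      (splitCoord θ c) (splitCoord_splitIdealMap θ hc))) p
    rw [Module.rankAtStalk_prod, Pi.add_apply, Module.rankAtStalk_eq_finrank_of_free,
      Module.rankAtStalk_eq_finrank_of_free,
      (splitEquiv θ R).toLinearEquiv.finrank_eq, Module.finrank_matrix] at h
    simp only [Fintype.card_fin, Module.finrank_self, mul_one, Pi.natCast_apply, Nat.cast_id,
      Module.finrank_fintype_fun_eq_card] at h
    rw [sq]
    omega
  mul_mem := by
    intro x hx a
    obtain ⟨w, hw⟩ := (mem_range_splitIdealMap θ).mp hx
    refine (mem_range_splitIdealMap θ).mpr ⟨w ᵥ* splitEquiv θ R a, ?_⟩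
    rw [map_mul, hw, vecMulVec_mul]

lemma splitPoint_toSubmodule (v : Fin n → R) (h : ∃ c, c ⬝ᵥ v = 1) :
    (splitPoint θ v h).toSubmodule = LinearMap.range (splitIdealMap θ v) := rfl

lemma exists_map_dotProduct {v : Fin n → R} (h : ∃ c, c ⬝ᵥ v = 1) (f : R →ₐ[K] S) :
    ∃ c, c ⬝ᵥ (f ∘ v) = 1 := by
  obtain ⟨c, hc⟩ := h
  exact ⟨f ∘ c, by rw [← f.map_one, ← hc]; exact ((f : R →+* S).map_dotProduct c v).symm⟩

variable {S} in
lemma splitPoint_map (f : R →ₐ[K] S) (v : Fin n → R) (h : ∃ c, c ⬝ᵥ v = 1) :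
    (splitPoint θ v h).map (f.restrictScalars F) =
      splitPoint θ (f ∘ v) (exists_map_dotProduct S h f) := by
  have key (w : Fin n → R) : extendTensor A (f.restrictScalars F) (splitIdealMap θ v w) =
      splitIdealMap θ (f ∘ v) (f ∘ w) := by
    apply (splitEquiv θ S).injective
    rw [splitEquiv_extendTensor, splitEquiv_splitIdealMap, splitEquiv_splitIdealMap]
    ext p q
    simp [vecMulVec_apply]
  refine IdealPoint.ext ?_
  rw [IdealPoint.map_toSubmodule, splitPoint_toSubmodule, splitPoint_toSubmodule]
  apply le_antisymm
  · rw [Submodule.span_le]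
    rintro _ ⟨_, ⟨w, rfl⟩, rfl⟩
    exact ⟨f ∘ w, (key w).symm⟩
  · rintro _ ⟨w, rfl⟩
    rw [pi_eq_sum_univ' w, map_sum]
    refine Submodule.sum_mem _ fun i _ => ?_
    rw [map_smul]
    refine Submodule.smul_mem _ _ (Submodule.subset_span ⟨_, ⟨Pi.single i 1, rfl⟩, ?_⟩)
    rw [key]
    congr 1
    ext j
    simp [Pi.single_apply, apply_ite f, eq_comm]

/-- Since `(r v) wᵀ = v (r w)ᵀ`, the ideal depends only on the line spanned by `v`. -/
lemma splitPoint_smul (v : Fin n → R) (h : ∃ c, c ⬝ᵥ v = 1) (r : Rˣ)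
    (h' : ∃ c, c ⬝ᵥ ((r : R) • v) = 1) : splitPoint θ ((r : R) • v) h' = splitPoint θ v h := by
  refine IdealPoint.ext ?_
  rw [splitPoint_toSubmodule, splitPoint_toSubmodule]
  ext x
  rw [mem_range_splitIdealMap, mem_range_splitIdealMap]
  constructor
  · rintro ⟨w, hw⟩
    exact ⟨(r : R) • w, by rw [hw]; ext; simp [vecMulVec_apply]; ring⟩
  · rintro ⟨w, hw⟩
    refine ⟨(↑r⁻¹ : R) • w, ?_⟩
    rw [hw]
    ext p q
    simp only [vecMulVec_apply, Pi.smul_apply, smul_eq_mul]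
    rw [mul_mul_mul_comm, Units.mul_inv, one_mul]

/-- The coordinates identify the right ideal of a unimodular vector with `Rⁿ`. -/
noncomputable def splitPointEquiv {c v : Fin n → R} (h : c ⬝ᵥ v = 1) :
    (splitPoint θ v ⟨c, h⟩).toSubmodule ≃ₗ[R] (Fin n → R) :=
  LinearEquiv.ofLinearMap (splitCoord θ c ∘ₗ Submodule.subtype _) (splitIdealMap θ v).rangeRestrict
    (LinearMap.ext fun w => splitCoord_splitIdealMap θ h w)
    (LinearMap.ext fun ⟨_, w, hw⟩ => Subtype.ext (by
      subst hw
      exact congrArg (splitIdealMap θ v) (splitCoord_splitIdealMap θ h w)))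

/-- Over a local `K`-algebra every right ideal of rank `n` is given by a unimodular vector. -/
theorem exists_eq_splitPoint [IsLocalRing R] [NeZero n] (J : IdealPoint F A n R) :
    ∃ (v : Fin n → R) (h : ∃ c, c ⬝ᵥ v = 1), J = splitPoint θ v h := by
  let ψ := splitEquiv θ R
  have hJ (x : R ⊗[F] A) (hx : x ∈ J.toSubmodule) (B : Matrix (Fin n) (Fin n) R) :
      ψ.symm (ψ x * B) ∈ J.toSubmodule := by
    have := J.mul_mem x hx (ψ.symm B)
    rwa [← ψ.symm_apply_apply x, ← map_mul] at this
  -- `I q y` has `q`-th column `y` and zeros elsewhere; `C q` extracts the `q`-th column. Right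
  -- multiplication by matrix units moves columns around, so `J` consists of the matrices all of
  -- whose columns lie in one submodule `N` of `Rⁿ`.
  let I : (Fin n) → (Fin n → R) →ₗ[R] R ⊗[F] A := fun q => ψ.symm.toLinearMap ∘ₗ
    { toFun := fun y => vecMulVec y (Pi.single q 1)
      map_add' := fun x y => add_vecMulVec x y _
      map_smul' := fun r x => by ext; simp [vecMulVec_apply]; ring }
  have hI (q y) : ψ (I q y) = vecMulVec y (Pi.single q 1) := ψ.apply_symm_apply _
  let C : (Fin n) → R ⊗[F] A →ₗ[R] (Fin n → R) := fun q =>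
    { toFun := fun x p => ψ x p q
      map_add' := fun x y => by ext; simp
      map_smul' := fun r x => by ext; simp }
  have hCI (q y) : C q (I q y) = y := by
    ext p
    change ψ (I q y) p q = _
    rw [hI]; simp [vecMulVec_apply]
  have hsum (x : R ⊗[F] A) : x = ∑ q, I q (C q x) := by
    apply ψ.injective
    rw [map_sum]
    ext p q
    simp only [hI, Matrix.sum_apply, vecMulVec_apply]
    simp [Pi.single_apply, C]
  let q₀ : Fin n := 0
  let N : Submodule R (Fin n → R) := J.toSubmodule.comap (I q₀)
  have hN (q y) : I q y ∈ J.toSubmodule ↔ y ∈ N := by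
    have aux (q q' : Fin n) (h : I q y ∈ J.toSubmodule) : I q' y ∈ J.toSubmodule := by
      have := hJ _ h (Matrix.single q q' 1)
      convert this using 1
      apply ψ.injective
      rw [ψ.apply_symm_apply, hI, hI, vecMulVec_mul]
      congr 1
      rw [single_one_vecMul]
      ext p
      simp [Matrix.single_apply, Pi.single_apply, eq_comm]
    exact ⟨aux q q₀, aux q₀ q⟩
  have hCJ (q) (x : R ⊗[F] A) (hx : x ∈ J.toSubmodule) : C q x ∈ N := by
    rw [← hN q]
    have := hJ x hx (Matrix.single q q 1)
    convert this using 1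
    apply ψ.injective
    rw [ψ.apply_symm_apply, hI]
    ext p p'
    by_cases h : p' = q
    · subst h; simp [vecMulVec_apply, C]
    · rw [Matrix.mul_single_apply_of_ne (hbj := h)]
      simp [vecMulVec_apply, h]
  have hmem (x : R ⊗[F] A) : x ∈ J.toSubmodule ↔ ∀ q, C q x ∈ N := by
    refine ⟨fun hx q => hCJ q x hx, fun h => ?_⟩
    rw [hsum x]
    exact Submodule.sum_mem _ fun q _ => (hN q _).mpr (h q)
  -- the quotient by `J` is the `n`-th power of the quotient by `N`
  let E : ((R ⊗[F] A) ⧸ J.toSubmodule) ≃ₗ[R] (Fin n → (Fin n → R) ⧸ N) :=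
    LinearEquiv.ofBijective
      (J.toSubmodule.liftQ (LinearMap.pi fun q => N.mkQ ∘ₗ C q) (fun x hx => by
        ext q : 1
        exact (Submodule.Quotient.mk_eq_zero _).mpr (hCJ q x hx))) (by
      constructor
      · rw [← LinearMap.ker_eq_bot, Submodule.ker_liftQ_eq_bot']
        ext x
        rw [hmem, LinearMap.mem_ker]
        refine ⟨fun h => funext fun q => (Submodule.Quotient.mk_eq_zero _).mpr (h q), fun h q =>
          (Submodule.Quotient.mk_eq_zero _).mp (congrFun h q)⟩
      · intro y
        choose z hz using fun q => Submodule.mkQ_surjective N (y q)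
        refine ⟨Submodule.Quotient.mk (∑ q, I q (z q)), ?_⟩
        ext q : 1
        change N.mkQ (C q (∑ q, I q (z q))) = _
        rw [← hz q]
        congr 1
        ext p
        change ψ (∑ q, I q (z q)) p q = _
        rw [map_sum]
        simp only [hI, Matrix.sum_apply, vecMulVec_apply]
        simp [Pi.single_apply])
  have hproj : Module.Projective R ((Fin n → R) ⧸ N) := by
    have : Module.Projective R (Fin n → (Fin n → R) ⧸ N) := Module.Projective.of_equiv E
    exact Module.Projective.of_split (LinearMap.single R (fun _ => (Fin n → R) ⧸ N) q₀)
      (LinearMap.proj q₀) (by ext; simp)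
  have hfree : Module.Free R ((Fin n → R) ⧸ N) := Module.free_of_flat_of_isLocalRing
  -- The `n`-th power of this quotient has rank `n ^ 2 - n = n * (n - 1)`, and `n ≠ 0`. So `N` is a
  -- free direct summand of rank one.
  have hrank : Module.finrank R ((Fin n → R) ⧸ N) = n - 1 := by
    have h1 := E.finrank_eq
    have hf : Module.Free R ((R ⊗[F] A) ⧸ J.toSubmodule) := Module.Free.of_equiv E.symm
    have h2 := J.rankAtStalk_eq (IsLocalRing.closedPoint R)
    rw [Module.rankAtStalk_eq_finrank_of_free] at h2
    simp only [Pi.natCast_apply, Nat.cast_id] at h2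
    rw [h2, Module.finrank_pi_fintype] at h1
    simp only [Finset.sum_const, Finset.card_univ, Fintype.card_fin, smul_eq_mul] at h1
    have h3 : n ^ 2 - n = n * (n - 1) := by rw [Nat.mul_sub, sq, mul_one]
    rw [h3] at h1
    exact (Nat.eq_of_mul_eq_mul_left (NeZero.pos n) h1).symm
  obtain ⟨s, hs⟩ := Module.projective_lifting_property N.mkQ LinearMap.id
    (Submodule.mkQ_surjective _)
  let p : (Fin n → R) →ₗ[R] N := (LinearMap.id - s ∘ₗ N.mkQ).codRestrict _ fun x => by
    rw [← Submodule.Quotient.mk_eq_zero, ← Submodule.mkQ_apply, LinearMap.sub_apply, map_sub]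
    have := LinearMap.congr_fun hs (N.mkQ x)
    simp only [LinearMap.comp_apply, LinearMap.id_apply] at this ⊢
    rw [this, sub_self]
  have hp (x : N) : p x = x := by
    refine Subtype.ext ?_
    simp [p, (Submodule.Quotient.mk_eq_zero _).mpr x.2]
  have hNfin : Module.Finite R N := Module.Finite.of_surjective p fun x => ⟨x, hp x⟩
  have hNproj : Module.Projective R N := Module.Projective.of_split N.subtype p
    (LinearMap.ext fun x => hp x)
  have hNfree : Module.Free R N := Module.free_of_flat_of_isLocalRing
  have hNrank : Module.finrank R N = 1 := by
    have h1 := (equivProdQuotientRange N.subtype p hp).finrank_eq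
    have e' := Submodule.quotEquivOfEq _ _ (Submodule.range_subtype N)
    have : Module.Free R ((Fin n → R) ⧸ LinearMap.range N.subtype) := Module.Free.of_equiv e'.symm
    rw [Module.finrank_prod, e'.finrank_eq, hrank, Module.finrank_fintype_fun_eq_card,
      Fintype.card_fin] at h1
    have := NeZero.pos n
    omega
  let b : Module.Basis (Fin 1) R N := Module.finBasisOfFinrankEq R N hNrank
  let v : Fin n → R := b 0
  have hv (y : Fin n → R) : y ∈ N ↔ ∃ r : R, y = r • v := by
    constructor
    · intro hy
      refine ⟨b.repr ⟨y, hy⟩ 0, ?_⟩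
      have := b.sum_repr ⟨y, hy⟩
      simp only [Fin.sum_univ_one] at this
      exact (congrArg Subtype.val this).symm
    · rintro ⟨r, rfl⟩
      exact N.smul_mem _ (b 0).2
  -- A functional with value `1` at the generator `v`; its values on the standard basis form a
  -- covector showing that `v` is unimodular.
  let ℓ : (Fin n → R) →ₗ[R] R := b.coord 0 ∘ₗ p
  have hℓ : (fun q => ℓ (Pi.single q 1)) ⬝ᵥ v = 1 := by
    have : ℓ v = 1 := by
      change b.coord 0 (p (b 0 : N)) = 1
      rw [hp]; simp
    refine Eq.trans ?_ this
    conv_rhs => rw [pi_eq_sum_univ' v, map_sum]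
    rw [dotProduct]
    refine Finset.sum_congr rfl fun q _ => ?_
    rw [map_smul, smul_eq_mul, mul_comm]
  refine ⟨v, ⟨_, hℓ⟩, IdealPoint.ext ?_⟩
  ext x
  rw [hmem, splitPoint_toSubmodule, mem_range_splitIdealMap]
  simp only [hv]
  constructor
  · intro h
    choose r hr using h
    refine ⟨r, ?_⟩
    ext p q
    rw [vecMulVec_apply, mul_comm]
    exact congrFun (hr q) p
  · rintro ⟨w, hw⟩ q
    refine ⟨w q, ?_⟩
    ext p
    have := congrFun (congrFun hw p) q
    rw [vecMulVec_apply, mul_comm] at this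
    exact this

end Split

attribute [local instance] sectionsAlgebra

/-! ### Points of the Severi–Brauer scheme and affine charts -/

section Points

variable {F : Type u} [Field F] {X : Over (Spec (.of F))} {A : Type u} [Ring A] [Algebra F A] {n : ℕ}
  (e : points X ≅ functor F A n)
  {R S : Type u} [CommRing R] [Algebra F R] [CommRing S] [Algebra F S]

variable (X S) in
/-- The points of the `F`-scheme `X` with values in the `F`-algebra `S`. -/
abbrev ValuedPoint : Type u := (algSpec (.of F)).obj (op (CommAlgCat.of F S)) ⟶ X

namespace ValuedPoint

/-- The underlying morphism of schemes. -/
noncomputable def hom (p : ValuedPoint X S) : Spec (.of S) ⟶ X.left := p.left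

lemma hom_injective {p q : ValuedPoint X S} (h : p.hom = q.hom) : p = q :=
  Over.OverMorphism.ext h

lemma hom_comp (p : ValuedPoint X S) :
    p.hom ≫ X.hom = Spec.map (CommRingCat.ofHom (algebraMap F S)) := Over.w p

/-- The composition of a point with `Spec S → Spec R`. -/
noncomputable def pull (f : R →ₐ[F] S) (p : ValuedPoint X R) : ValuedPoint X S :=
  (algSpec (.of F)).map (CommAlgCat.ofHom f).op ≫ p

lemma hom_pull (f : R →ₐ[F] S) (p : ValuedPoint X R) :
    (p.pull f).hom = Spec.map (CommRingCat.ofHom (f : R →+* S)) ≫ p.hom := rfl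

/-- The right ideal corresponding to a point. -/
noncomputable def ideal (p : ValuedPoint X S) : IdealPoint F A n S :=
  e.hom.app (CommAlgCat.of F S) p

lemma ideal_pull (f : R →ₐ[F] S) (p : ValuedPoint X R) :
    (p.pull f).ideal e = (p.ideal e).map f := by
  have h := e.hom.naturality (CommAlgCat.ofHom f)
  have h' := ConcreteCategory.congr_hom h p
  rw [ConcreteCategory.comp_apply, ConcreteCategory.comp_apply] at h'
  exact h'

lemma ideal_injective {p q : ValuedPoint X S} (h : p.ideal e = q.ideal e) : p = q := by
  have h1 (p : ValuedPoint X S) : e.inv.app (CommAlgCat.of F S) (p.ideal e) = p :=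
    ConcreteCategory.congr_hom (e.hom_inv_id_app (CommAlgCat.of F S)) p
  rw [← h1 p, h, h1]

lemma exists_ideal_eq (J : IdealPoint F A n S) : ∃ p : ValuedPoint X S, p.ideal e = J :=
  ⟨e.inv.app (CommAlgCat.of F S) J,
    ConcreteCategory.congr_hom (e.inv_hom_id_app (CommAlgCat.of F S)) J⟩

end ValuedPoint

/-- The morphism `Spec S → X` given by an affine open subset `V` and a homomorphism `Γ(X, V) → S`. -/
noncomputable def pointOfHom {V : X.left.Opens} (hV : IsAffineOpen V) (f : Γ(X.left, V) →ₐ[F] S) :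
    ValuedPoint X S :=
  ValuedPoint.pull f (affinePoint X hV)

lemma hom_pointOfHom {V : X.left.Opens} (hV : IsAffineOpen V) (f : Γ(X.left, V) →ₐ[F] S) :
    (pointOfHom hV f).hom = Spec.map (CommRingCat.ofHom (f : Γ(X.left, V) →+* S)) ≫ hV.fromSpec :=
  rfl

lemma ideal_pointOfHom {V : X.left.Opens} (hV : IsAffineOpen V) (f : Γ(X.left, V) →ₐ[F] S) :
    (pointOfHom hV f).ideal e = (idealOfAffine e hV).map f :=
  ValuedPoint.ideal_pull e f _

lemma pull_pointOfHom {V : X.left.Opens} (hV : IsAffineOpen V) (f : Γ(X.left, V) →ₐ[F] R)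
    (g : R →ₐ[F] S) : (pointOfHom hV f).pull g = pointOfHom hV (g.comp f) := by
  refine ValuedPoint.hom_injective ?_
  rw [ValuedPoint.hom_pull, hom_pointOfHom, hom_pointOfHom, ← Category.assoc, ← Spec.map_comp]
  rfl

lemma pointOfHom_injective {V : X.left.Opens} (hV : IsAffineOpen V) {f g : Γ(X.left, V) →ₐ[F] S}
    (h : pointOfHom hV f = pointOfHom hV g) : f = g := by
  have h' := congrArg ValuedPoint.hom h
  rw [hom_pointOfHom, hom_pointOfHom, cancel_mono] at h'
  have := CommRingCat.hom_ext_iff.mp (Spec.map_injective h')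
  exact AlgHom.coe_ringHom_injective this

lemma pointOfHom_comp_res {U V : X.left.Opens} (hU : IsAffineOpen U) (hV : IsAffineOpen V)
    (h : V ≤ U) (f : Γ(X.left, V) →ₐ[F] S) :
    pointOfHom hU (f.comp (res X h)) = pointOfHom hV f := by
  refine ValuedPoint.hom_injective ?_
  rw [hom_pointOfHom, hom_pointOfHom, ← hU.map_fromSpec hV (homOfLE h).op]
  rw [← Category.assoc, ← Spec.map_comp]
  rfl

lemma pointOfHom_id {V : X.left.Opens} (hV : IsAffineOpen V) :
    pointOfHom hV (AlgHom.id F Γ(X.left, V)) = affinePoint X hV := by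
  refine ValuedPoint.hom_injective ?_
  rw [hom_pointOfHom]
  exact (congrArg (· ≫ hV.fromSpec) (Spec.map_id _)).trans (Category.id_comp _)

/-- The tautological ideals on affine open subsets are compatible with restriction. -/
lemma idealOfAffine_map_res {U V : X.left.Opens} (hU : IsAffineOpen U) (hV : IsAffineOpen V)
    (h : V ≤ U) : (idealOfAffine e hU).map (res X h) = idealOfAffine e hV := by
  have h1 := pointOfHom_comp_res hU hV h (AlgHom.id F Γ(X.left, V))
  rw [pointOfHom_id, AlgHom.id_comp] at h1
  have h2 := congrArg (ValuedPoint.ideal e) h1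
  rw [ideal_pointOfHom] at h2
  exact h2

/-- The tautological ideals restrict to each other, so the condition over `V` implies the conditions
over all smaller affine open subsets. -/
lemma tautologicalSections_eq {V : X.left.Opens} (hV : IsAffineOpen V) :
    tautologicalSections e V = (idealOfAffine e hV).toSubmodule := by
  ext s
  constructor
  · intro hs
    have := hs V hV le_rfl
    rwa [resTensor_id] at this
  · intro hs W hW h
    rw [← idealOfAffine_map_res e hV hW h]
    exact (idealOfAffine e hV).extendTensor_mem (res X h) hs

/-- A point of `X` with values in an affine open subset comes from a homomorphism. -/
lemma exists_eq_pointOfHom (p : ValuedPoint X S)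
    {V : X.left.Opens} (hV : IsAffineOpen V) (h : Set.range p.hom ⊆ V) :
    ∃ f : Γ(X.left, V) →ₐ[F] S, p = pointOfHom hV f := by
  have h' : Set.range p.hom ⊆ Set.range hV.fromSpec := by rwa [hV.range_fromSpec]
  let l : Spec (.of S) ⟶ Spec Γ(X.left, V) := IsOpenImmersion.lift hV.fromSpec p.hom h'
  have hl : l ≫ hV.fromSpec = p.hom := IsOpenImmersion.lift_fac _ _ _
  obtain ⟨φ, hφ⟩ := Spec.map_surjective l
  have hcomm : CommRingCat.ofHom (algebraMap F Γ(X.left, V)) ≫ φ =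
      CommRingCat.ofHom (algebraMap F S) := by
    apply Spec.map_injective
    rw [Spec.map_comp, ← fromSpec_comp_hom X hV, ← Category.assoc, hφ, hl, p.hom_comp]
  refine ⟨{ φ.hom with
    commutes' := fun r => DFunLike.congr_fun (CommRingCat.hom_ext_iff.mp hcomm) r },
      ValuedPoint.hom_injective ?_⟩
  rw [hom_pointOfHom, ← hl, ← hφ]
  rfl

variable (F) in
/-- The localization map as a homomorphism of `F`-algebras. -/
noncomputable abbrev toAway (s : S) : S →ₐ[F] Localization.Away s :=
  IsScalarTower.toAlgHom F S (Localization.Away s)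

/-- A point with values in `S` factors, locally around a prime of `S`, through any neighbourhood of
its image. -/
lemma exists_localization_factor (p : ValuedPoint X S)
    (x : PrimeSpectrum S) {V : X.left.Opens} (hV : IsAffineOpen V) (hx : p.hom x ∈ V) :
    ∃ s : S, s ∉ x.asIdeal ∧ ∃ f : Γ(X.left, V) →ₐ[F] Localization.Away s,
      p.pull (toAway F s) = pointOfHom hV f := by
  have hx' : x ∈ (p.hom ⁻¹ᵁ V).carrier := hx
  obtain ⟨_, ⟨s, rfl⟩, hs, hsV⟩ :=
    PrimeSpectrum.isTopologicalBasis_basic_opens.exists_subset_of_mem_open hx' (p.hom ⁻¹ᵁ V).isOpen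
  refine ⟨s, hs, exists_eq_pointOfHom _ hV ?_⟩
  rintro _ ⟨y, rfl⟩
  have : PrimeSpectrum.comap (algebraMap S (Localization.Away s)) y ∈
      (PrimeSpectrum.basicOpen s : Set (PrimeSpectrum S)) := by
    rw [← PrimeSpectrum.localization_away_comap_range (Localization.Away s) s]
    exact ⟨y, rfl⟩
  exact hsV this

/-- Every point of `X` is, locally on its base, the pullback of the tautological ideal on an affine
open subset. -/
lemma exists_map_idealOfAffine (J : IdealPoint F A n S) (x : PrimeSpectrum S) :
    ∃ s : S, s ∉ x.asIdeal ∧ ∃ (V : X.left.Opens) (hV : IsAffineOpen V)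
      (f : Γ(X.left, V) →ₐ[F] Localization.Away s),
      (idealOfAffine e hV).map f = J.map (toAway F s) := by
  obtain ⟨p, rfl⟩ := ValuedPoint.exists_ideal_eq e J
  obtain ⟨_, ⟨V, hV, rfl⟩, hxV, -⟩ :=
    X.left.isBasis_affineOpens.exists_subset_of_mem_open (Set.mem_univ (p.hom x)) isOpen_univ
  replace hV : IsAffineOpen V := hV
  obtain ⟨s, hs, f, hf⟩ := exists_localization_factor p x hV hxV
  refine ⟨s, hs, V, hV, f, ?_⟩
  rw [← ideal_pointOfHom, ← hf, ValuedPoint.ideal_pull]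

/-- Two ways to obtain the same point of `X` from affine open subsets agree locally. -/
lemma exists_common_factor {U V : X.left.Opens} (hU : IsAffineOpen U) (hV : IsAffineOpen V)
    (f : Γ(X.left, U) →ₐ[F] S) (g : Γ(X.left, V) →ₐ[F] S)
    (h : (idealOfAffine e hU).map f = (idealOfAffine e hV).map g) (x : PrimeSpectrum S) :
    ∃ s : S, s ∉ x.asIdeal ∧ ∃ (W : X.left.Opens) (_ : IsAffineOpen W) (hWU : W ≤ U) (hWV : W ≤ V)
      (k : Γ(X.left, W) →ₐ[F] Localization.Away s),
      k.comp (res X hWU) = (toAway F s).comp f ∧ k.comp (res X hWV) = (toAway F s).comp g := by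
  -- Equal ideals mean equal points, because `e` is an isomorphism. Near `x` this common point lands
  -- in an affine open subset of `U ⊓ V`.
  have hp : pointOfHom hU f = pointOfHom hV g := ValuedPoint.ideal_injective e (by
    rw [ideal_pointOfHom, ideal_pointOfHom, h])
  have hmem {U : X.left.Opens} (hU : IsAffineOpen U) (f : Γ(X.left, U) →ₐ[F] S) :
      (pointOfHom hU f).hom x ∈ U := by
    have : hU.fromSpec (Spec.map (CommRingCat.ofHom (f : Γ(X.left, U) →+* S)) x) ∈
        Set.range hU.fromSpec := ⟨_, rfl⟩
    rw [hU.range_fromSpec] at this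
    exact this
  obtain ⟨_, ⟨W, hW, rfl⟩, hxW, hWUV⟩ :=
    X.left.isBasis_affineOpens.exists_subset_of_mem_open
      (show (pointOfHom hU f).hom x ∈ ((U ⊓ V : X.left.Opens) : Set X.left) from
        ⟨hmem hU f, hp ▸ hmem hV g⟩) (U ⊓ V).isOpen
  replace hW : IsAffineOpen W := hW
  obtain ⟨s, hs, k, hk⟩ := exists_localization_factor (pointOfHom hU f) x hW hxW
  have hWU : W ≤ U := fun y hy => (hWUV hy).1
  have hWV : W ≤ V := fun y hy => (hWUV hy).2
  refine ⟨s, hs, W, hW, hWU, hWV, k, pointOfHom_injective hU ?_, pointOfHom_injective hV ?_⟩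
  · rw [pointOfHom_comp_res hU hW, ← hk, pull_pointOfHom]
  · rw [pointOfHom_comp_res hV hW, ← hk, hp, pull_pointOfHom]

end Points

/-! ### Associated sheaves of modules over affine open subsets -/

section AssociatedSheaf

variable {Y : Scheme.{u}} (M N L : PresheafOfModules.{u} (Y.presheaf ⋙ forget₂ CommRingCat RingCat))

/-- The sheaf of modules associated with a presheaf of modules. -/
noncomputable def assocSheaf : Y.Modules :=
  (PresheafOfModules.sheafification (𝟙 Y.ringCatSheaf.obj)).obj M

/-- The map from a presheaf of modules to the associated sheaf, on sections. -/
noncomputable def toAssoc (U : Y.Opens) : M.obj (op U) →ₗ[Γ(Y, U)] Γ(assocSheaf M, U) :=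
  (((PresheafOfModules.sheafificationAdjunction (𝟙 Y.ringCatSheaf.obj)).unit.app M).app (op U)).hom

/-- The restriction maps of a presheaf of modules, as semilinear maps. -/
noncomputable def secRes {U V : Y.Opens} (h : V ≤ U) :
    M.obj (op U) →ₛₗ[(Y.presheaf.map (homOfLE h).op).hom] M.obj (op V) :=
  M.restrictₛₗ (homOfLE h).op

variable {M N L}

lemma secRes_secRes {U V W : Y.Opens} (h : V ≤ U) (h' : W ≤ V) (x : M.obj (op U)) :
    secRes M h' (secRes M h x) = secRes M (h'.trans h) x :=
  (M.map_comp_apply (homOfLE h).op (homOfLE h').op x).symm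

lemma toAssoc_secRes {U V : Y.Opens} (h : V ≤ U) (x : M.obj (op U)) :
    toAssoc M V (secRes M h x) = (assocSheaf M).presheaf.map (homOfLE h).op (toAssoc M U x) :=
  PresheafOfModules.naturality_apply
    ((PresheafOfModules.sheafificationAdjunction (𝟙 Y.ringCatSheaf.obj)).unit.app M)
    (homOfLE h).op x

lemma exists_secRes_eq_zero {U : Y.Opens} {x : M.obj (op U)} (h : toAssoc M U x = 0) (y : Y)
    (hy : y ∈ U) : ∃ (V : Y.Opens) (hV : V ≤ U), y ∈ V ∧ secRes M hV x = 0 := by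
  have := Presheaf.equalizerSieve_mem (Opens.grothendieckTopology Y)
    (CategoryTheory.toSheafify (Opens.grothendieckTopology Y) M.presheaf) (X := op U) x 0
    (by rw [map_zero]; exact h)
  obtain ⟨V, i, hi, hy⟩ := this y hy
  refine ⟨V, leOfHom i, hy, ?_⟩
  have h2 : M.presheaf.map i.op x = M.presheaf.map i.op 0 := hi
  rw [map_zero] at h2
  exact h2

lemma exists_toAssoc_eq {U : Y.Opens} (t : Γ(assocSheaf M, U)) (y : Y) (hy : y ∈ U) :
    ∃ (V : Y.Opens) (hV : V ≤ U), y ∈ V ∧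
      ∃ s, toAssoc M V s = (assocSheaf M).presheaf.map (homOfLE hV).op t := by
  have := Presheaf.imageSieve_mem (Opens.grothendieckTopology Y)
    (CategoryTheory.toSheafify (Opens.grothendieckTopology Y) M.presheaf) (U := op U) t
  obtain ⟨V, i, ⟨s, hs⟩, hy⟩ := this y hy
  exact ⟨V, leOfHom i, hy, s, hs⟩

lemma section_eq_zero (𝓜 : Y.Modules) {U : Y.Opens} (t : Γ(𝓜, U))
    (h : ∀ y ∈ U, ∃ (V : Y.Opens) (hV : V ≤ U), y ∈ V ∧ 𝓜.presheaf.map (homOfLE hV).op t = 0) :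
    t = 0 := by
  choose V hV hy h0 using h
  refine TopCat.Sheaf.eq_of_locally_eq' ⟨𝓜.presheaf, 𝓜.isSheaf⟩ (fun y : U => V y.1 y.2) U
    (fun y => homOfLE (hV y.1 y.2)) ?_ t 0 ?_
  · intro y hyU
    exact TopologicalSpace.Opens.mem_iSup.mpr ⟨⟨y, hyU⟩, hy y hyU⟩
  · intro y
    rw [map_zero]
    exact h0 _ _

lemma map_map_section (𝓜 : Y.Modules) {U V W : Y.Opens} (h : V ≤ U) (h' : W ≤ V) (t : Γ(𝓜, U)) :
    𝓜.presheaf.map (homOfLE h').op (𝓜.presheaf.map (homOfLE h).op t) =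
      𝓜.presheaf.map (homOfLE (h'.trans h)).op t := by
  rw [← ConcreteCategory.comp_apply, ← Functor.map_comp]
  rfl

lemma assocSheaf_hom_ext {φ ψ : assocSheaf M ⟶ assocSheaf N}
    (h : ∀ U x, φ.app U (toAssoc M U x) = ψ.app U (toAssoc M U x)) : φ = ψ := by
  apply ((PresheafOfModules.sheafificationAdjunction (𝟙 Y.ringCatSheaf.obj)).homEquiv M
    (assocSheaf N)).injective
  apply PresheafOfModules.hom_ext
  intro U
  ext x
  exact h U.unop x

/-- The morphism of associated sheaves induced by a morphism of presheaves. -/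
noncomputable def assocMap (f : M ⟶ N) : assocSheaf M ⟶ assocSheaf N :=
  (PresheafOfModules.sheafification (𝟙 Y.ringCatSheaf.obj)).map f

lemma assocMap_app_toAssoc (f : M ⟶ N) (U : Y.Opens) (x : M.obj (op U)) :
    (assocMap f).app U (toAssoc M U x) = toAssoc N U (f.app (op U) x) := by
  have := (PresheafOfModules.sheafificationAdjunction (𝟙 Y.ringCatSheaf.obj)).unit.naturality f
  have := congrArg (fun g => PresheafOfModules.Hom.app g (op U) x) this
  exact this.symm

variable (M) in
/-- A presheaf of modules whose sections on affine open subsets are compatible with localization. -/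
def IsLocalizing : Prop :=
  ∀ (V : Y.Opens) (_ : IsAffineOpen V) (f : Γ(Y, V)),
    IsSemilinearBaseChange (secRes M (Y.basicOpen_le f))

/-- Functions whose basic open sets cover an affine open set generate the unit ideal. It is applied
to the annihilator of a section, and to the ideal of functions multiplying a section into the image
of the presheaf. -/
lemma one_mem_of_forall_exists_basicOpen {V : Y.Opens} (hV : IsAffineOpen V) (I : Ideal Γ(Y, V))
    (h : ∀ y ∈ V, ∃ f ∈ I, y ∈ Y.basicOpen f) : (1 : Γ(Y, V)) ∈ I := by
  rw [← Ideal.eq_top_iff_one, ← Ideal.span_eq I, ← hV.iSup_basicOpen_eq_self_iff]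
  refine le_antisymm (iSup_le fun f => Y.basicOpen_le _) fun y hy => ?_
  obtain ⟨f, hf, hyf⟩ := h y hy
  exact TopologicalSpace.Opens.mem_iSup.mpr ⟨⟨f, hf⟩, hyf⟩

lemma exists_basicOpen_le {U V : Y.Opens} (hV : IsAffineOpen V) {y : Y} (hyV : y ∈ V)
    (hyU : y ∈ U) : ∃ f : Γ(Y, V), y ∈ Y.basicOpen f ∧ Y.basicOpen f ≤ U := by
  obtain ⟨f, hf, hyf⟩ := hV.exists_basicOpen_le ⟨y, hyU⟩ hyV
  exact ⟨f, hyf, hf⟩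

lemma mem_basicOpen_pow {V : Y.Opens} {f : Γ(Y, V)} {y : Y} (h : y ∈ Y.basicOpen f) (k : ℕ) :
    y ∈ Y.basicOpen (f ^ k) := by
  rcases k.eq_zero_or_pos with rfl | hk
  · rw [pow_zero, Y.basicOpen_of_isUnit isUnit_one]
    exact Y.basicOpen_le f h
  · rwa [Y.basicOpen_pow f hk]

namespace IsLocalizing

variable (hM : IsLocalizing M) (hN : IsLocalizing N)

include hM in
lemma exists_pow_smul_eq_zero {V : Y.Opens} (hV : IsAffineOpen V) (f : Γ(Y, V)) {x : M.obj (op V)}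
    (hx : secRes M (Y.basicOpen_le f) x = 0) : ∃ k : ℕ, f ^ k • x = 0 :=
  (hM V hV f).exists_pow_smul_eq_zero f (hV.isLocalization_basicOpen f) hx

include hM in
lemma exists_pow_smul_eq {V : Y.Opens} (hV : IsAffineOpen V) (f : Γ(Y, V))
    (x : M.obj (op (Y.basicOpen f))) :
    ∃ (k : ℕ) (m : M.obj (op V)), Y.presheaf.map (homOfLE (Y.basicOpen_le f)).op f ^ k • x =
      secRes M (Y.basicOpen_le f) m :=
  (hM V hV f).exists_pow_smul_eq f (hV.isLocalization_basicOpen f) x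

-- A section that dies in the sheaf dies on small basic open sets, so by localization its
-- annihilator contains powers of functions whose basic open sets cover `V`.
include hM in
lemma toAssoc_injective {V : Y.Opens} (hV : IsAffineOpen V) :
    Function.Injective (toAssoc M V) := by
  rw [← LinearMap.ker_eq_bot, eq_bot_iff]
  intro x hx
  rw [LinearMap.mem_ker] at hx
  have : (1 : Γ(Y, V)) ∈ LinearMap.ker (LinearMap.toSpanSingleton Γ(Y, V) (M.obj (op V)) x) := by
    refine one_mem_of_forall_exists_basicOpen hV _ fun y hy => ?_
    obtain ⟨U, hU, hyU, h0⟩ := exists_secRes_eq_zero hx y hy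
    obtain ⟨f, hyf, hf⟩ := exists_basicOpen_le hV hy hyU
    obtain ⟨k, hk⟩ := hM.exists_pow_smul_eq_zero hV f (x := x) (by
      rw [← secRes_secRes hU hf, h0, map_zero])
    exact ⟨f ^ k, hk, mem_basicOpen_pow hyf k⟩
  simpa using this

-- Locally `t` comes from the presheaf, where the localization property supplies a power of `f`;
-- compactness of `V` makes the exponent uniform.
include hM in
lemma exists_pow_smul_section_eq_zero {V : Y.Opens} (hV : IsAffineOpen V) (f : Γ(Y, V))
    (t : Γ(assocSheaf M, V))
    (ht : (assocSheaf M).presheaf.map (homOfLE (Y.basicOpen_le f)).op t = 0) :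
    ∃ k : ℕ, f ^ k • t = 0 := by
  have key : ∃ k : ℕ, ∀ y ∈ (V : Set Y), ∃ (W : Y.Opens) (hW : W ≤ V), y ∈ W ∧
      (assocSheaf M).presheaf.map (homOfLE hW).op (f ^ k • t) = 0 := by
    refine hV.isCompact.induction_on (p := fun s => ∃ k : ℕ, ∀ y ∈ s, ∃ (W : Y.Opens) (hW : W ≤ V),
      y ∈ W ∧ (assocSheaf M).presheaf.map (homOfLE hW).op (f ^ k • t) = 0) ?_ ?_ ?_ ?_
    · exact ⟨0, by simp⟩
    · rintro s s' h ⟨k, hk⟩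
      exact ⟨k, fun y hy => hk y (h hy)⟩
    · rintro s s' ⟨k, hk⟩ ⟨k', hk'⟩
      refine ⟨k + k', fun y hy => ?_⟩
      rcases hy with hy | hy
      · obtain ⟨W, hW, hyW, h⟩ := hk y hy
        refine ⟨W, hW, hyW, ?_⟩
        rw [add_comm, pow_add, mul_smul, Scheme.Modules.map_smul, h, smul_zero]
      · obtain ⟨W, hW, hyW, h⟩ := hk' y hy
        refine ⟨W, hW, hyW, ?_⟩
        rw [pow_add, mul_smul, Scheme.Modules.map_smul, h, smul_zero]
    · intro y hy
      obtain ⟨U, hU, hyU, s, hs⟩ := exists_toAssoc_eq t y hy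
      obtain ⟨g, hyg, hg⟩ := exists_basicOpen_le hV hy hyU
      have hD : IsAffineOpen (Y.basicOpen g) := hV.basicOpen g
      let f' : Γ(Y, Y.basicOpen g) := Y.presheaf.map (homOfLE (Y.basicOpen_le g)).op f
      have hle : Y.basicOpen f' ≤ Y.basicOpen f := by
        rw [Scheme.basicOpen_res]; exact inf_le_right
      have h0 : secRes M (Y.basicOpen_le f') (secRes M hg s) = 0 := by
        apply hM.toAssoc_injective (hD.basicOpen f')
        rw [map_zero, secRes_secRes, toAssoc_secRes, hs, map_map_section,
          ← map_map_section _ (Y.basicOpen_le f) hle, ht, map_zero]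
      obtain ⟨k, hk⟩ := hM.exists_pow_smul_eq_zero hD f' h0
      refine ⟨Y.basicOpen g, mem_nhdsWithin_of_mem_nhds ((Y.basicOpen g).isOpen.mem_nhds hyg), k,
        fun z hz => ⟨Y.basicOpen g, Y.basicOpen_le g, hz, ?_⟩⟩
      rw [Scheme.Modules.map_smul, map_pow, ← map_map_section _ hU hg, ← hs, ← toAssoc_secRes]
      have h2 := congrArg (toAssoc M _) hk
      rwa [map_smul, map_zero] at h2
  obtain ⟨k, hk⟩ := key
  exact ⟨k, section_eq_zero _ _ hk⟩

-- Near a point, `t` comes from the presheaf over some basic open set of `f`. Clearing denominators,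
-- `f ^ k • t` differs from a presheaf section over `V` by something that vanishes there, and a
-- further power of `f` removes the difference.
include hM in
lemma toAssoc_surjective {V : Y.Opens} (hV : IsAffineOpen V) :
    Function.Surjective (toAssoc M V) := by
  intro t
  have : (1 : Γ(Y, V)) ∈ (LinearMap.range (toAssoc M V)).comap
      (LinearMap.toSpanSingleton Γ(Y, V) Γ(assocSheaf M, V) t) := by
    refine one_mem_of_forall_exists_basicOpen hV _ fun y hy => ?_
    obtain ⟨U, hU, hyU, s, hs⟩ := exists_toAssoc_eq t y hy
    obtain ⟨f, hyf, hf⟩ := exists_basicOpen_le hV hy hyU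
    obtain ⟨k, m, hm⟩ := hM.exists_pow_smul_eq hV f (secRes M hf s)
    obtain ⟨l, hl⟩ := hM.exists_pow_smul_section_eq_zero hV f (f ^ k • t - toAssoc M V m) (by
      rw [map_sub, Scheme.Modules.map_smul, ← toAssoc_secRes, ← hm, map_smul, toAssoc_secRes, hs,
        map_map_section, map_pow, sub_self])
    refine ⟨f ^ (l + k), ⟨f ^ l • m, ?_⟩, mem_basicOpen_pow hyf _⟩
    rw [smul_sub, sub_eq_zero] at hl
    rw [map_smul, ← hl, LinearMap.toSpanSingleton_apply, pow_add, mul_smul]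
  obtain ⟨x, hx⟩ := this
  exact ⟨x, hx.trans (one_smul _ t)⟩

/-- The sections over an affine open subset of the sheaf associated with a localizing presheaf. -/
noncomputable def secEquiv {V : Y.Opens} (hV : IsAffineOpen V) :
    M.obj (op V) ≃ₗ[Γ(Y, V)] Γ(assocSheaf M, V) :=
  LinearEquiv.ofBijective (toAssoc M V) ⟨hM.toAssoc_injective hV, hM.toAssoc_surjective hV⟩

/-- The action of a morphism of sheaves on the sections over an affine open subset. -/
noncomputable def affineMap (φ : assocSheaf M ⟶ assocSheaf N) {V : Y.Opens} (hV : IsAffineOpen V) :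
    M.obj (op V) →ₗ[Γ(Y, V)] N.obj (op V) :=
  (hN.secEquiv hV).symm.toLinearMap ∘ₗ
    { toFun := fun x => φ.app V (toAssoc M V x)
      map_add' := fun x y => by rw [map_add, map_add]
      map_smul' := fun r x => by rw [map_smul, Scheme.Modules.Hom.app_smul]; rfl }

lemma toAssoc_affineMap (φ : assocSheaf M ⟶ assocSheaf N) {V : Y.Opens} (hV : IsAffineOpen V)
    (x : M.obj (op V)) : toAssoc N V (hN.affineMap φ hV x) = φ.app V (toAssoc M V x) :=
  (hN.secEquiv hV).apply_symm_apply _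

lemma app_map (φ : assocSheaf M ⟶ assocSheaf N) {U V : Y.Opens} (h : V ≤ U)
    (t : Γ(assocSheaf M, U)) : φ.app V ((assocSheaf M).presheaf.map (homOfLE h).op t) =
      (assocSheaf N).presheaf.map (homOfLE h).op (φ.app U t) :=
  ConcreteCategory.congr_hom (φ.mapPresheaf.naturality (homOfLE h).op) t

lemma affineMap_secRes (φ : assocSheaf M ⟶ assocSheaf N) {U V : Y.Opens} (hU : IsAffineOpen U)
    (hV : IsAffineOpen V) (h : V ≤ U) (x : M.obj (op U)) :
    hN.affineMap φ hV (secRes M h x) = secRes N h (hN.affineMap φ hU x) := by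
  apply hN.toAssoc_injective hV
  rw [toAssoc_affineMap, toAssoc_secRes, toAssoc_secRes, toAssoc_affineMap, app_map]

lemma affineMap_add (φ ψ : assocSheaf M ⟶ assocSheaf N) {V : Y.Opens} (hV : IsAffineOpen V)
    (x : M.obj (op V)) :
    hN.affineMap (φ + ψ) hV x = hN.affineMap φ hV x + hN.affineMap ψ hV x := by
  apply hN.toAssoc_injective hV
  rw [toAssoc_affineMap, map_add, toAssoc_affineMap, toAssoc_affineMap]
  rfl

lemma affineMap_comp (hL : IsLocalizing L) (φ : assocSheaf M ⟶ assocSheaf N)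
    (ψ : assocSheaf N ⟶ assocSheaf L) {V : Y.Opens} (hV : IsAffineOpen V) (x : M.obj (op V)) :
    hL.affineMap (φ ≫ ψ) hV x = hL.affineMap ψ hV (hN.affineMap φ hV x) := by
  apply hL.toAssoc_injective hV
  rw [toAssoc_affineMap, toAssoc_affineMap, toAssoc_affineMap]
  rfl

lemma affineMap_assocMap (f : M ⟶ N) {V : Y.Opens} (hV : IsAffineOpen V) (x : M.obj (op V)) :
    hN.affineMap (assocMap f) hV x = f.app (op V) x := by
  apply hN.toAssoc_injective hV
  rw [toAssoc_affineMap, assocMap_app_toAssoc]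

lemma affineMap_id {V : Y.Opens} (hV : IsAffineOpen V) (x : M.obj (op V)) :
    hM.affineMap (𝟙 (assocSheaf M)) hV x = x := by
  apply hM.toAssoc_injective hV
  rw [toAssoc_affineMap]
  rfl

lemma eq_zero_of_affineMap (φ : assocSheaf M ⟶ assocSheaf N)
    (h : ∀ (V : Y.Opens) (hV : IsAffineOpen V) x, hN.affineMap φ hV x = 0) : φ = 0 := by
  refine assocSheaf_hom_ext fun U x => ?_
  change φ.app U (toAssoc M U x) = 0
  refine section_eq_zero _ _ fun y hy => ?_
  obtain ⟨_, ⟨V, hV, rfl⟩, hyV, hVU⟩ :=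
    Y.isBasis_affineOpens.exists_subset_of_mem_open hy U.isOpen
  replace hV : IsAffineOpen V := hV
  replace hVU : V ≤ U := hVU
  refine ⟨V, hVU, hyV, ?_⟩
  rw [← app_map, ← toAssoc_secRes, ← hN.toAssoc_affineMap φ hV, h, map_zero]

end IsLocalizing

end AssociatedSheaf

/-! ### Coordinates on the tensor powers of the tautological sheaf -/

/-- The index set `{1, …, n} ^ k`, as an iterated product. -/
def MultiIndex (n : ℕ) : ℕ → Type
  | 0 => Unit
  | k + 1 => MultiIndex n k × Fin n

namespace MultiIndex

instance instDecidableEq (n : ℕ) : ∀ k, DecidableEq (MultiIndex n k)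
  | 0 => inferInstanceAs (DecidableEq Unit)
  | k + 1 => letI := instDecidableEq n k; inferInstanceAs (DecidableEq (MultiIndex n k × Fin n))

instance instFintype (n : ℕ) : ∀ k, Fintype (MultiIndex n k)
  | 0 => inferInstanceAs (Fintype Unit)
  | k + 1 => letI := instFintype n k; inferInstanceAs (Fintype (MultiIndex n k × Fin n))

instance instNonempty (n : ℕ) [NeZero n] : ∀ k, Nonempty (MultiIndex n k)
  | 0 => inferInstanceAs (Nonempty Unit)
  | k + 1 => letI := instNonempty n k; inferInstanceAs (Nonempty (MultiIndex n k × Fin n))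

end MultiIndex

/-- Functions on a product of finite sets, as a tensor product. -/
noncomputable def tensorPiEquiv (R ι κ : Type*) [CommRing R] [Finite ι] [Finite κ] :
    (ι → R) ⊗[R] (κ → R) ≃ₗ[R] (ι × κ → R) :=
  ((Pi.basisFun R ι).tensorProduct (Pi.basisFun R κ)).equivFun

lemma tensorPiEquiv_tmul {R ι κ : Type*} [CommRing R] [Finite ι] [Finite κ]
    (x : ι → R) (y : κ → R) (p : ι × κ) : tensorPiEquiv R ι κ (x ⊗ₜ y) p = x p.1 * y p.2 := by
  rw [tensorPiEquiv, Module.Basis.equivFun_apply, Module.Basis.tensorProduct_repr_tmul_apply,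
    Pi.basisFun_repr, Pi.basisFun_repr, smul_eq_mul, mul_comm]

section TensorPowers

variable {F : Type u} [Field F] {X : Over (Spec (.of F))} {A : Type u} [Ring A] [Algebra F A]
  {n : ℕ} (e : points X ≅ functor F A n)

attribute [local instance] sectionsAlgebra

/-- The presheaf `U ↦ I(U)^{⊗ k}`. -/
noncomputable abbrev powerPresheaf (k : ℕ) :
    PresheafOfModules.{u} (X.left.presheaf ⋙ forget₂ CommRingCat RingCat) :=
  tensorPower (tautologicalSubmodule e).toPresheafOfModules k

lemma isSemilinearBaseChange_tautologicalSubmodule {U V : X.left.Opens} (hU : IsAffineOpen U)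
    (hV : IsAffineOpen V) (h : V ≤ U) :
    IsSemilinearBaseChange (secRes (tautologicalSubmodule e).toPresheafOfModules h) := by
  have h1 := (((idealOfAffine e hU).isSemilinearBaseChange_toMap (res X h)
    (idealOfAffine_map_res e hU hV h)).comp_linearEquiv
      (LinearEquiv.ofEq _ _ (tautologicalSections_eq e hV).symm)).comp_linearEquiv_left
      (LinearEquiv.ofEq _ _ (tautologicalSections_eq e hU))
  exact h1

lemma isSemilinearBaseChange_powerPresheaf {U V : X.left.Opens} (hU : IsAffineOpen U)
    (hV : IsAffineOpen V) (h : V ≤ U) :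
    ∀ k, IsSemilinearBaseChange (secRes (powerPresheaf e k) h)
  | 0 => by
    exact IsSemilinearBaseChange.ringHom (σ := (X.left.presheaf.map (homOfLE h).op).hom)
  | k + 1 => by
    have := (isSemilinearBaseChange_powerPresheaf hU hV h k).tensor
      (isSemilinearBaseChange_tautologicalSubmodule e hU hV h)
    exact this

lemma isLocalizing_powerPresheaf (k : ℕ) : IsLocalizing (powerPresheaf e k) :=
  fun _ hV f => isSemilinearBaseChange_powerPresheaf e hV (hV.basicOpen f) _ k

variable {K : Type u} [Field K] [Algebra F K] (θ : K ⊗[F] A ≃ₐ[K] Matrix (Fin n) (Fin n) K)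
  {R S : Type u} [CommRing R] [Algebra F R] [Algebra K R] [IsScalarTower F K R]
  [CommRing S] [Algebra F S] [Algebra K S] [IsScalarTower F K S]

/-- Coordinates of the sections of the tautological sheaf at an `R`-valued point `u`. -/
noncomputable def coordOne {V : X.left.Opens} (u : Γ(X.left, V) →ₐ[F] R) (c : Fin n → R) :
    (tautologicalSubmodule e).toPresheafOfModules.obj (op V) →ₛₗ[(u : Γ(X.left, V) →+* R)]
      (Fin n → R) :=
  ((splitCoord θ c).comp (extendTensor A u)).comp (tautologicalSections e V).subtype

/-- Coordinates of the sections of the tensor powers of the tautological sheaf at an `R`-valued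
point `u`. -/
noncomputable def coord {V : X.left.Opens} (u : Γ(X.left, V) →ₐ[F] R) (c : Fin n → R) : ∀ k,
    (powerPresheaf e k).obj (op V) →ₛₗ[(u : Γ(X.left, V) →+* R)] (MultiIndex n k → R)
  | 0 => (LinearMap.pi fun _ => LinearMap.id).comp (u : Γ(X.left, V) →+* R).toSemilinearMap
  | k + 1 => (tensorPiEquiv R (MultiIndex n k) (Fin n)).toLinearMap.comp
      (TensorProduct.map (coord u c k) (coordOne e θ u c))

/-- The product of sections of `I^{⊗ k}` and `I`. -/
noncomputable def tmulSec {V : X.left.Opens} {k : ℕ} (s : (powerPresheaf e k).obj (op V))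
    (x : (tautologicalSubmodule e).toPresheafOfModules.obj (op V)) :
    (powerPresheaf e (k + 1)).obj (op V) :=
  TensorProduct.tmul Γ(X.left, V) s x

variable {e} in
lemma power_induction {V : X.left.Opens} {k : ℕ}
    {p : (powerPresheaf e (k + 1)).obj (op V) → Prop} (x) (h0 : p 0)
    (hadd : ∀ x y, p x → p y → p (x + y)) (hmul : ∀ s x, p (tmulSec e s x)) : p x := by
  refine TensorProduct.induction_on (motive := p) x h0 hmul hadd

lemma secRes_tmulSec {U V : X.left.Opens} (h : V ≤ U) {k : ℕ}
    (s : (powerPresheaf e k).obj (op U))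
    (x : (tautologicalSubmodule e).toPresheafOfModules.obj (op U)) :
    secRes (powerPresheaf e (k + 1)) h (tmulSec e s x) =
      tmulSec e (secRes (powerPresheaf e k) h s) (secRes _ h x) := rfl

lemma coordOne_apply {V : X.left.Opens} (u : Γ(X.left, V) →ₐ[F] R) (c : Fin n → R)
    (x : tautologicalSections e V) :
    coordOne e θ u c x = splitCoord θ c (extendTensor A u x) := rfl

lemma coord_tmulSec {V : X.left.Opens} (u : Γ(X.left, V) →ₐ[F] R) (c : Fin n → R) {k : ℕ}
    (s : (powerPresheaf e k).obj (op V))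
    (x : (tautologicalSubmodule e).toPresheafOfModules.obj (op V)) (i : MultiIndex n (k + 1)) :
    coord e θ u c (k + 1) (tmulSec e s x) i = coord e θ u c k s i.1 * coordOne e θ u c x i.2 :=
  tensorPiEquiv_tmul _ _ _

lemma coord_comp_res {U V : X.left.Opens} (h : V ≤ U) (u : Γ(X.left, V) →ₐ[F] R)
    (c : Fin n → R) : ∀ (k : ℕ) (x : (powerPresheaf e k).obj (op U)),
    coord e θ (u.comp (res X h)) c k x = coord e θ u c k (secRes (powerPresheaf e k) h x)
  | 0, x => rfl
  | k + 1, x => by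
    induction x using power_induction with
    | h0 => rw [map_zero, map_zero, map_zero]
    | hadd x y hx hy => rw [map_add, map_add, map_add, hx, hy]
    | hmul s x =>
      ext i
      rw [secRes_tmulSec, coord_tmulSec, coord_tmulSec, coord_comp_res h u c k]
      congr 2
      exact congrFun (congrArg (splitCoord θ c) (extendTensor_comp_apply (res X h) u _)) _

lemma coord_comp {V : X.left.Opens} (u : Γ(X.left, V) →ₐ[F] R) (c : Fin n → R) (g : R →ₐ[K] S) :
    ∀ (k : ℕ) (x : (powerPresheaf e k).obj (op V)),
    coord e θ ((g.restrictScalars F).comp u) (g ∘ c) k x = g ∘ coord e θ u c k x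
  | 0, x => rfl
  | k + 1, x => by
    induction x using power_induction with
    | h0 => rw [map_zero, map_zero]; ext; simp
    | hadd x y hx hy => rw [map_add, map_add, hx, hy]; ext; simp
    | hmul s x =>
      ext i
      rw [coord_tmulSec, coord_comp u c g k, Function.comp_apply, Function.comp_apply,
        coord_tmulSec, map_mul]
      congr 1
      have h1 : coordOne e θ ((g.restrictScalars F).comp u) (g ∘ c) x =
          g ∘ coordOne e θ u c x := by
        refine (congrArg (splitCoord θ (g ∘ c)) (extendTensor_comp_apply _ _ _)).trans ?_
        rw [splitCoord_apply, splitEquiv_extendTensor]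
        exact funext fun i => ((g : R →+* S).map_vecMul _ _ i).symm
      rw [h1]
      rfl

/-- Each of the `k` tensor factors is linear in `c`. This is how the twist `𝒪(-k)` enters. -/
lemma coord_smul {V : X.left.Opens} (u : Γ(X.left, V) →ₐ[F] R) (c : Fin n → R) (r : R) :
    ∀ (k : ℕ) (x : (powerPresheaf e k).obj (op V)),
    coord e θ u (r • c) k x = r ^ k • coord e θ u c k x
  | 0, x => by rw [pow_zero, one_smul]; rfl
  | k + 1, x => by
    induction x using power_induction with
    | h0 => rw [map_zero, map_zero, smul_zero]
    | hadd x y hx hy => rw [map_add, map_add, hx, hy, smul_add]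
    | hmul s x =>
      ext i
      rw [coord_tmulSec, coord_smul u c r k, Pi.smul_apply, Pi.smul_apply, coord_tmulSec]
      have h1 : coordOne e θ u (r • c) x = r • coordOne e θ u c x :=
        Matrix.smul_vecMul r c (splitEquiv θ R (extendTensor A u
          (Subtype.val (p := (· ∈ tautologicalSections e V)) x)))
      rw [h1, Pi.smul_apply, smul_eq_mul, smul_eq_mul, smul_eq_mul]
      ring

variable [FiniteDimensional F A]

/-- On a matrix `v wᵀ` every `c` with `c ⬝ᵥ v = 1` reads off the same `w`. -/
lemma coord_congr {V : X.left.Opens} (hV : IsAffineOpen V) (u : Γ(X.left, V) →ₐ[F] R)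
    {v c c' : Fin n → R} (hc : c ⬝ᵥ v = 1) (hc' : c' ⬝ᵥ v = 1)
    (h : (idealOfAffine e hV).map u = splitPoint θ v ⟨c, hc⟩) :
    ∀ (k : ℕ) (x : (powerPresheaf e k).obj (op V)), coord e θ u c k x = coord e θ u c' k x
  | 0, x => rfl
  | k + 1, x => by
    induction x using power_induction with
    | h0 => rw [map_zero, map_zero]
    | hadd x y hx hy => rw [map_add, map_add, hx, hy]
    | hmul s x =>
      ext i
      rw [coord_tmulSec, coord_tmulSec, coord_congr hV u hc hc' h k]
      refine congrArg (_ * ·) (congrFun ?_ _)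
      obtain ⟨x, hx⟩ := x
      have hx' : x ∈ (idealOfAffine e hV).toSubmodule := tautologicalSections_eq e hV ▸ hx
      have h1 := (idealOfAffine e hV).extendTensor_mem u hx'
      rw [h, splitPoint_toSubmodule] at h1
      obtain ⟨w, hw⟩ := h1
      refine (coordOne_apply e θ u c ⟨x, hx⟩).trans
        (Eq.trans ?_ (coordOne_apply e θ u c' ⟨x, hx⟩).symm)
      simp only
      rw [← hw, splitCoord_splitIdealMap θ hc, splitCoord_splitIdealMap θ hc']

/-- At a point given by `v`, the map `w ↦ v wᵀ` identifies the base change of `I` with `Rⁿ`, and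
base change is stable under tensor products. This is what turns morphisms of sheaves into matrices.
-/
lemma isSemilinearBaseChange_coord {V : X.left.Opens} (hV : IsAffineOpen V)
    (u : Γ(X.left, V) →ₐ[F] R) {v c : Fin n → R} (hc : c ⬝ᵥ v = 1)
    (h : (idealOfAffine e hV).map u = splitPoint θ v ⟨c, hc⟩) :
    ∀ k, IsSemilinearBaseChange (coord e θ u c k)
  | 0 => (IsSemilinearBaseChange.ringHom (σ := (u : Γ(X.left, V) →+* R))).comp_linearEquiv
      (LinearEquiv.funUnique Unit R R).symm
  | k + 1 => by
    have h1 : IsSemilinearBaseChange (coordOne e θ u c) :=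
      (((idealOfAffine e hV).isSemilinearBaseChange_toMap u h).comp_linearEquiv
        (splitPointEquiv θ hc)).comp_linearEquiv_left
        (LinearEquiv.ofEq _ _ (tautologicalSections_eq e hV))
    exact ((isSemilinearBaseChange_coord hV u hc h k).tensor h1).comp_linearEquiv
      (tensorPiEquiv R (MultiIndex n k) (Fin n))

end TensorPowers

/-! ### Checking and gluing on localizations -/

section Away

variable {R : Type u} [CommRing R]

/-- The annihilator of `x - y` is contained in no maximal ideal. -/
lemma eq_of_forall_prime_exists_away {x y : R}
    (h : ∀ p : PrimeSpectrum R, ∃ s ∉ p.asIdeal,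
      algebraMap R (Localization.Away s) x = algebraMap R (Localization.Away s) y) : x = y := by
  by_contra hxy
  let I : Ideal R := LinearMap.ker (LinearMap.toSpanSingleton R R (x - y))
  have hI : I ≠ ⊤ := by
    rw [Ne, Ideal.eq_top_iff_one]
    intro h1
    have h2 : (1 : R) • (x - y) = 0 := h1
    rw [one_smul] at h2
    exact hxy (sub_eq_zero.mp h2)
  obtain ⟨m, hm, hIm⟩ := I.exists_le_maximal hI
  obtain ⟨s, hs, hxs⟩ := h ⟨m, hm.isPrime⟩
  obtain ⟨⟨_, k, rfl⟩, hc⟩ := (IsLocalization.eq_iff_exists (Submonoid.powers s) _).mp hxs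
  refine hs (hm.isPrime.mem_of_pow_mem k (hIm ?_))
  change s ^ k • (x - y) = 0
  rw [smul_sub, sub_eq_zero]
  exact hc

lemma span_eq_top_of_forall_prime {t : Set R} (h : ∀ p : PrimeSpectrum R, ∃ s ∈ t, s ∉ p.asIdeal) :
    Ideal.span t = ⊤ := by
  by_contra hI
  obtain ⟨m, hm, hIm⟩ := Ideal.exists_le_maximal _ hI
  obtain ⟨s, hs, hsm⟩ := h ⟨m, hm.isPrime⟩
  exact hsm (hIm (Ideal.subset_span hs))

lemma exists_liftAway {K S : Type u} [Field K] [Algebra K R] [CommRing S] [Algebra K S]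
    (g : R →ₐ[K] S) {s : R} (hs : IsUnit (g s)) :
    ∃ l : Localization.Away s →ₐ[K] S, l.comp (toAway K s) = g := by
  refine ⟨IsLocalization.liftAlgHom (M := Submonoid.powers s) (f := g) ?_, ?_⟩
  · rintro ⟨_, k, rfl⟩
    simpa using hs.pow k
  · ext x
    simp

/-- Compatibility on overlaps is phrased through arbitrary `K`-algebra factorizations, the form in
which uniqueness of matrices provides it. -/
lemma exists_algebraMap_eq_of_span_eq_top (K : Type u) [Field K] [Algebra K R] {t : Set R}
    (ht : Ideal.span t = ⊤) (f : ∀ s : t, Localization.Away s.1)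
    (h : ∀ (s s' : t) (l : Localization.Away s.1 →ₐ[K] Localization.Away (s.1 * s'.1))
      (l' : Localization.Away s'.1 →ₐ[K] Localization.Away (s.1 * s'.1)),
      l.comp (toAway K s.1) = toAway K (s.1 * s'.1) →
      l'.comp (toAway K s'.1) = toAway K (s.1 * s'.1) → l (f s) = l' (f s')) :
    ∃ x : R, ∀ s : t, algebraMap R (Localization.Away s.1) x = f s := by
  refine (Localization.existsUnique_algebraMap_eq_of_span_eq_top t ht f fun s s' => ?_).exists
  have hu : IsUnit (toAway K (s.1 * s'.1) (s.1 * s'.1)) :=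
    IsLocalization.Away.algebraMap_isUnit (s.1 * s'.1)
  rw [map_mul, IsUnit.mul_iff] at hu
  obtain ⟨l, hl⟩ := exists_liftAway (toAway K (s.1 * s'.1)) hu.1
  obtain ⟨l', hl'⟩ := exists_liftAway (toAway K (s.1 * s'.1)) hu.2
  have h4 : IsLocalization.Away.awayToAwayRight (P := Localization.Away (s.1 * s'.1)) s.1 s'.1 =
      (l : Localization.Away s.1 →+* _) := by
    refine IsLocalization.ringHom_ext (Submonoid.powers s.1) (RingHom.ext fun x => ?_)
    refine (IsLocalization.Away.awayToAwayRight_eq s.1 s'.1 x).trans ?_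
    exact (DFunLike.congr_fun hl x).symm
  have h5 : IsLocalization.Away.awayToAwayLeft (P := Localization.Away (s.1 * s'.1)) s'.1 s.1 =
      (l' : Localization.Away s'.1 →+* _) := by
    refine IsLocalization.ringHom_ext (Submonoid.powers s'.1) (RingHom.ext fun x => ?_)
    refine (IsLocalization.Away.awayToAwayLeft_eq s'.1 s.1 x).trans ?_
    exact (DFunLike.congr_fun hl' x).symm
  rw [h4, h5]
  exact h s s' l l' hl hl'

end Away

/-! ### Matrices of morphisms at unimodular vectors -/

section Matrices

set_option linter.unusedSectionVars false

variable {F : Type u} [Field F] {X : Over (Spec (.of F))} {A : Type u} [Ring A] [Algebra F A]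
  [FiniteDimensional F A] {n : ℕ} (e : points X ≅ functor F A n)

attribute [local instance] sectionsAlgebra

variable {K : Type u} [Field K] [Algebra F K] (θ : K ⊗[F] A ≃ₐ[K] Matrix (Fin n) (Fin n) K)
  {R S : Type u} [CommRing R] [Algebra F R] [Algebra K R] [IsScalarTower F K R]
  [CommRing S] [Algebra F S] [Algebra K S] [IsScalarTower F K S]
  {i j k : ℕ}

/-- The action of a morphism `I^{⊗ i} ⟶ I^{⊗ j}` on sections over an affine open subset. -/
noncomputable abbrev act
    (φ : assocSheaf (powerPresheaf e i) ⟶ assocSheaf (powerPresheaf e j)) {V : X.left.Opens}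
    (hV : IsAffineOpen V) :
    (powerPresheaf e i).obj (op V) →ₗ[Γ(X.left, V)] (powerPresheaf e j).obj (op V) :=
  (isLocalizing_powerPresheaf e j).affineMap φ hV

/-- The matrix `M` describes the morphism `φ : I^{⊗ i} ⟶ I^{⊗ j}` at the right ideal given by
the unimodular vector `v`, after every extension of scalars. -/
def IsMatrixAt (φ : assocSheaf (powerPresheaf e i) ⟶ assocSheaf (powerPresheaf e j))
    (v : Fin n → R) (M : Matrix (MultiIndex n j) (MultiIndex n i) R) : Prop :=
  ∀ (S : Type u) [CommRing S] [Algebra F S] [Algebra K S] [IsScalarTower F K S] (g : R →ₐ[K] S)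
    (V : X.left.Opens) (hV : IsAffineOpen V) (u : Γ(X.left, V) →ₐ[F] S) (c : Fin n → S)
    (hc : c ⬝ᵥ (g ∘ v) = 1), (idealOfAffine e hV).map u = splitPoint θ (g ∘ v) ⟨c, hc⟩ →
    ∀ x, coord e θ u c j (act e φ hV x) = (M.map g).mulVec (coord e θ u c i x)

variable {e θ} {φ ψ : assocSheaf (powerPresheaf e i) ⟶ assocSheaf (powerPresheaf e j)}
  {χ : assocSheaf (powerPresheaf e j) ⟶ assocSheaf (powerPresheaf e k)}
  {v : Fin n → R} {M N : Matrix (MultiIndex n j) (MultiIndex n i) R}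
  {L : Matrix (MultiIndex n k) (MultiIndex n j) R}

lemma comp_dotProduct_comp {c v : Fin n → R} (h : c ⬝ᵥ v = 1) (g : R →ₐ[K] S) :
    (g ∘ c) ⬝ᵥ (g ∘ v) = 1 := by
  refine Eq.trans ?_ ((congrArg g h).trans (map_one g))
  exact ((g : R →+* S).map_dotProduct c v).symm

lemma map_mulVec_comp {ι κ : Type*} [Fintype κ] (M : Matrix ι κ R) (g : R →ₐ[K] S) (x : κ → R) :
    (M.map g).mulVec (g ∘ x) = g ∘ M.mulVec x :=
  funext fun i => ((g : R →+* S).map_mulVec M x i).symm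

namespace IsMatrixAt

lemma map (h : IsMatrixAt e θ φ v M) (f : R →ₐ[K] S) : IsMatrixAt e θ φ (f ∘ v) (M.map f) := by
  intro T _ _ _ _ g V hV u c hc hJ x
  have := h T (g.comp f) V hV u c hc hJ x
  rw [this, Matrix.map_map]
  rfl

lemma add (h : IsMatrixAt e θ φ v M) (h' : IsMatrixAt e θ ψ v N) :
    IsMatrixAt e θ (φ + ψ) v (M + N) := by
  intro T _ _ _ _ g V hV u c hc hJ x
  rw [IsLocalizing.affineMap_add, map_add, h T g V hV u c hc hJ, h' T g V hV u c hc hJ,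
    Matrix.map_add _ (map_add g), Matrix.add_mulVec]

lemma comp (h : IsMatrixAt e θ φ v M) (h' : IsMatrixAt e θ χ v L) :
    IsMatrixAt e θ (φ ≫ χ) v (L * M) := by
  intro T _ _ _ _ g V hV u c hc hJ x
  have : (L * M).map g = L.map g * M.map g := Matrix.map_mul (f := (g : R →+* T))
  rw [IsLocalizing.affineMap_comp (isLocalizing_powerPresheaf e j), h' T g V hV u c hc hJ,
    h T g V hV u c hc hJ, this, Matrix.mulVec_mulVec]

lemma id (v : Fin n → R) :
    IsMatrixAt e θ (𝟙 (assocSheaf (powerPresheaf e i))) v 1 := by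
  intro T _ _ _ _ g V hV u c hc hJ x
  rw [IsLocalizing.affineMap_id, Matrix.map_one _ (map_zero g) (map_one g), Matrix.one_mulVec]

/-- One chart suffices. Any other chart `W` of the same ideal meets it, locally on `Spec S`, in an
affine `W'` contained in both. Sections over `W'` are spanned by restrictions from `V`, so the
identity extends to `W'` by linearity and then applies to restrictions from `W`. -/
lemma of_affine {V : X.left.Opens} (hV : IsAffineOpen V) (u : Γ(X.left, V) →ₐ[F] R)
    {c : Fin n → R} (hc : c ⬝ᵥ v = 1) (hJ : (idealOfAffine e hV).map u = splitPoint θ v ⟨c, hc⟩)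
    (h : ∀ x, coord e θ u c j (act e φ hV x) = M.mulVec (coord e θ u c i x)) :
    IsMatrixAt e θ φ v M := by
  intro S _ _ _ _ g W hW u' c' hc' hJ' x
  refine funext fun q => eq_of_forall_prime_exists_away fun p => ?_
  have hJg : (idealOfAffine e hV).map ((g.restrictScalars F).comp u) =
      (idealOfAffine e hW).map u' := by
    rw [IdealPoint.map_comp, hJ, splitPoint_map, hJ']
  obtain ⟨s, hs, W', hW', hWV, hWW, l, hl, hl'⟩ := exists_common_factor e hV hW _ _ hJg p
  refine ⟨s, hs, ?_⟩
  let a : S →ₐ[K] Localization.Away s := toAway K s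
  have ha : a.restrictScalars F = toAway F s := rfl
  have hspan := (isSemilinearBaseChange_powerPresheaf e hV hW' hWV i).span_range
  have key (y : (powerPresheaf e i).obj (op W')) :
      coord e θ l (a ∘ c') j (act e φ hW' y) =
        (M.map (a.comp g)).mulVec (coord e θ l (a ∘ c') i y) := by
    have hy : y ∈ Submodule.span Γ(X.left, W') (Set.range (secRes (powerPresheaf e i) hWV)) := by
      rw [hspan]; trivial
    induction hy using Submodule.span_induction with
    | mem y hy =>
      obtain ⟨y, rfl⟩ := hy
      have hu : l.comp (res X hWV) = ((a.comp g).restrictScalars F).comp u := hl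
      have hJ2 : (idealOfAffine e hV).map (((a.comp g).restrictScalars F).comp u) =
          splitPoint θ ((a.comp g) ∘ v) ⟨a ∘ c', comp_dotProduct_comp hc' a⟩ := by
        rw [IdealPoint.map_comp, hJ, splitPoint_map]
      have hcg := comp_dotProduct_comp hc (a.comp g)
      -- The covectors coming from `S` and from `R` may differ, but both are normalized against the
      -- same vector, so `coord_congr` exchanges them.
      rw [IsLocalizing.affineMap_secRes _ φ hV hW', ← coord_comp_res, ← coord_comp_res, hu,
        coord_congr e θ hV _ (comp_dotProduct_comp hc' a) hcg hJ2,
        coord_congr e θ hV _ (comp_dotProduct_comp hc' a) hcg hJ2, coord_comp, coord_comp,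
        h, map_mulVec_comp]
    | zero => rw [map_zero, map_zero, map_zero, Matrix.mulVec_zero]
    | add y z _ _ hy hz => rw [map_add, map_add, map_add, hy, hz, Matrix.mulVec_add]
    | smul r y _ hy =>
      rw [map_smul, map_smulₛₗ, map_smulₛₗ, hy, Matrix.mulVec_smul]
  have h1 := key (secRes (powerPresheaf e i) hWW x)
  rw [IsLocalizing.affineMap_secRes _ φ hW hW', ← coord_comp_res, ← coord_comp_res, hl', ← ha,
    coord_comp, coord_comp] at h1
  have h2 : M.map (a.comp g) = (M.map g).map a := by rw [Matrix.map_map]; rfl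
  rw [h2, map_mulVec_comp] at h1
  exact congrFun h1 q

/-- Locally, a right ideal given by a unimodular vector is parametrized by an affine open subset. -/
lemma exists_affine (e : points X ≅ functor F A n) {c : Fin n → R} (hc : c ⬝ᵥ v = 1)
    (p : PrimeSpectrum R) : ∃ s ∉ p.asIdeal, ∃ (V : X.left.Opens) (hV : IsAffineOpen V)
      (u : Γ(X.left, V) →ₐ[F] Localization.Away s) (hc' : (toAway K s ∘ c) ⬝ᵥ (toAway K s ∘ v) = 1),
      (idealOfAffine e hV).map u = splitPoint θ (toAway K s ∘ v) ⟨_, hc'⟩ := by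
  obtain ⟨s, hs, V, hV, u, hu⟩ := exists_map_idealOfAffine e (splitPoint θ v ⟨c, hc⟩) p
  refine ⟨s, hs, V, hV, u, comp_dotProduct_comp hc (toAway K s), ?_⟩
  rw [hu]
  exact splitPoint_map θ (toAway K s) v _

/-- Locally on `Spec R` the coordinates of sections span the whole coordinate module, so they
determine the matrix. -/
lemma unique (hv : ∃ c, c ⬝ᵥ v = 1) (h : IsMatrixAt e θ φ v M) (h' : IsMatrixAt e θ φ v N) :
    M = N := by
  obtain ⟨c, hc⟩ := hv
  ext a b
  refine eq_of_forall_prime_exists_away fun p => ?_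
  obtain ⟨s, hs, V, hV, u, hc', hJ⟩ := exists_affine (θ := θ) e hc p
  refine ⟨s, hs, ?_⟩
  have hbc := isSemilinearBaseChange_coord e θ hV u hc' hJ i
  have h1 : (M.map (toAway K s)).mulVecLin = (N.map (toAway K s)).mulVecLin := hbc.hom_ext fun x =>
    (h _ _ V hV u _ hc' hJ x).symm.trans (h' _ _ V hV u _ hc' hJ x)
  have h2 := congrFun (congrFun (Matrix.mulVec_injective
    (congrArg DFunLike.coe h1)) a) b
  exact h2

/-- The universal property of the coordinates of `I^{⊗ i}`, applied to the coordinates of the images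
under `φ`, produces the linear map. -/
lemma exists_of_affine {V : X.left.Opens} (hV : IsAffineOpen V) (u : Γ(X.left, V) →ₐ[F] R)
    {c : Fin n → R} (hc : c ⬝ᵥ v = 1) (hJ : (idealOfAffine e hV).map u = splitPoint θ v ⟨c, hc⟩)
    (φ : assocSheaf (powerPresheaf e i) ⟶ assocSheaf (powerPresheaf e j)) :
    ∃ M, IsMatrixAt e θ φ v M := by
  obtain ⟨h, hh, -⟩ := isSemilinearBaseChange_coord e θ hV u hc hJ i (MultiIndex n j → R)
    ((coord e θ u c j).comp (act e φ hV))
  refine ⟨LinearMap.toMatrix' h, of_affine hV u hc hJ fun x => ?_⟩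
  rw [LinearMap.toMatrix'_mulVec, hh]
  rfl

/-- The description by matrices is local. -/
lemma of_local {t : Set R} (ht : Ideal.span t = ⊤)
    (h : ∀ s ∈ t, IsMatrixAt e θ φ (toAway K s ∘ v) (M.map (toAway K s))) :
    IsMatrixAt e θ φ v M := by
  intro S _ _ _ _ g V hV u c hc hJ x
  refine funext fun q => eq_of_forall_prime_exists_away fun p => ?_
  -- The elements of `t` generate the unit ideal, so their images cannot all lie in the prime `p` of
  -- `S`.
  obtain ⟨s, hs, hsp⟩ : ∃ s ∈ t, g s ∉ p.asIdeal := by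
    by_contra! hcon
    have : Ideal.span t ≤ p.asIdeal.comap (g : R →+* S) := Ideal.span_le.mpr hcon
    rw [ht, top_le_iff] at this
    exact p.2.ne_top (Ideal.comap_eq_top_iff.mp this)
  refine ⟨g s, hsp, ?_⟩
  let a : S →ₐ[K] Localization.Away (g s) := toAway K (g s)
  obtain ⟨l, hl⟩ := exists_liftAway (a.comp g) (s := s)
    (IsLocalization.Away.algebraMap_isUnit (g s))
  have hlv (x : R) : l (toAway K s x) = a (g x) := DFunLike.congr_fun hl x
  have hla : l ∘ (toAway K s ∘ v) = a ∘ (g ∘ v) := funext fun x => hlv _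
  have hca := comp_dotProduct_comp hc a
  have h1 := h s hs _ l V hV ((a.restrictScalars F).comp u) (a ∘ c) (by rw [hla, hca]) (by
    rw [IdealPoint.map_comp, hJ, splitPoint_map]
    congr 1
    exact hla.symm) x
  have h2 : (M.map (toAway K s)).map l = (M.map g).map a := by
    ext x y
    exact hlv _
  rw [h2, coord_comp, coord_comp, map_mulVec_comp] at h1
  exact congrFun h1 q

end IsMatrixAt

/-- Matrices exist locally, where the ideal comes from an affine chart; by uniqueness they agree on
overlaps, so their entries glue. -/
theorem exists_isMatrixAt (e : points X ≅ functor F A n)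
    (θ : K ⊗[F] A ≃ₐ[K] Matrix (Fin n) (Fin n) K) (hv : ∃ c, c ⬝ᵥ v = 1)
    (φ : assocSheaf (powerPresheaf e i) ⟶ assocSheaf (powerPresheaf e j)) :
    ∃ M, IsMatrixAt e θ φ v M := by
  obtain ⟨c, hc⟩ := hv
  let t : Set R := {s | ∃ M, IsMatrixAt e θ φ (toAway K s ∘ v) M}
  have ht : Ideal.span t = ⊤ := span_eq_top_of_forall_prime fun p => by
    obtain ⟨s, hs, V, hV, u, hc', hJ⟩ := IsMatrixAt.exists_affine (θ := θ) e hc p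
    exact ⟨s, IsMatrixAt.exists_of_affine hV u hc' hJ φ, hs⟩
  choose M hM using fun s : t => s.2
  have hglue (q : MultiIndex n j) (r : MultiIndex n i) :
      ∃ x : R, ∀ s : t, algebraMap R (Localization.Away s.1) x = M s q r := by
    refine exists_algebraMap_eq_of_span_eq_top K ht (fun s => M s q r) fun s s' l l' hl hl' => ?_
    have h1 := (hM s).map l
    have h2 := (hM s').map l'
    have hlv : l ∘ (toAway K s.1 ∘ v) = toAway K (s.1 * s'.1) ∘ v :=
      funext fun x => DFunLike.congr_fun hl (v x)
    have hlv' : l' ∘ (toAway K s'.1 ∘ v) = toAway K (s.1 * s'.1) ∘ v :=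
      funext fun x => DFunLike.congr_fun hl' (v x)
    rw [hlv] at h1
    rw [hlv'] at h2
    exact congrFun (congrFun
      (IsMatrixAt.unique (exists_map_dotProduct _ ⟨c, hc⟩ (toAway K (s.1 * s'.1))) h1 h2) q) r
  choose m hm using hglue
  refine ⟨Matrix.of m, IsMatrixAt.of_local ht fun s hs => ?_⟩
  have : (Matrix.of m).map (toAway K s) = M ⟨s, hs⟩ := by
    ext q r
    exact hm q r ⟨s, hs⟩
  rw [this]
  exact hM ⟨s, hs⟩

end Matrices

/-! ### Laurent polynomials and sections on the projective line -/

section Laurent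

open Polynomial LaurentPolynomial

variable {R : Type*} [CommRing R] {p q : R[X]}

lemma coeff_toLaurent_natCast (p : R[X]) (m : ℕ) : (toLaurent p).coeff (m : ℤ) = p.coeff m := by
  rw [coeff_toLaurent]
  exact Finsupp.mapDomain_apply Nat.cast_injective _ m

lemma coeff_toLaurent_neg (p : R[X]) {m : ℤ} (hm : m < 0) : (toLaurent p).coeff m = 0 := by
  rw [coeff_toLaurent]
  refine Finsupp.mapDomain_of_notMem_range _ _ ?_
  rintro ⟨k, rfl⟩
  exact absurd hm (not_lt.mpr (Int.natCast_nonneg k))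

/-- A function on the projective line without poles is constant. -/
lemma eq_C_of_invert_toLaurent (h : invert (toLaurent q) = toLaurent p) :
    p = Polynomial.C (p.coeff 0) ∧ q = Polynomial.C (p.coeff 0) := by
  have h' (m : ℤ) : (toLaurent q).coeff (-m) = (toLaurent p).coeff m := by
    rw [← invert_apply, h]
  constructor <;> ext m <;> rw [Polynomial.coeff_C] <;> split_ifs with hm
  · rw [hm]
  · rw [← coeff_toLaurent_natCast, ← h', coeff_toLaurent_neg]
    omega
  · have := h' 0
    rw [hm, ← coeff_toLaurent_natCast, ← coeff_toLaurent_natCast, ← h']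
    simp
  · have := h' (-m)
    rw [neg_neg, coeff_toLaurent_natCast] at this
    rw [this, coeff_toLaurent_neg]
    omega

/-- A line bundle of negative degree on the projective line has no sections. -/
lemma eq_zero_of_invert_toLaurent {d : ℕ} (hd : 0 < d)
    (h : invert (toLaurent q) = LaurentPolynomial.T d * toLaurent p) : p = 0 := by
  -- With the twist absorbed, `X ^ d * p` is constant; its constant term is zero because `0 < d`.
  rw [← toLaurent_X_pow, ← map_mul] at h
  have h1 := (eq_C_of_invert_toLaurent h).1
  rw [Polynomial.coeff_X_pow_mul', if_neg (by omega), map_zero] at h1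
  ext m
  have := congrArg (fun f => Polynomial.coeff f (m + d)) h1
  simpa [Polynomial.coeff_X_pow_mul] using this

end Laurent

/-! ### Constancy of the matrix along lines -/

section Matrices

set_option linter.unusedSectionVars false

variable {F : Type u} [Field F] {X : Over (Spec (.of F))} {A : Type u} [Ring A] [Algebra F A]
  [FiniteDimensional F A] {n : ℕ} {e : points X ≅ functor F A n}
  {K : Type u} [Field K] [Algebra F K] {θ : K ⊗[F] A ≃ₐ[K] Matrix (Fin n) (Fin n) K}
  {R S : Type u} [CommRing R] [Algebra F R] [Algebra K R] [IsScalarTower F K R]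
  [CommRing S] [Algebra F S] [Algebra K S] [IsScalarTower F K S]
  {i j : ℕ} {φ : assocSheaf (powerPresheaf e i) ⟶ assocSheaf (powerPresheaf e j)}
  {v : Fin n → R} {M N : Matrix (MultiIndex n j) (MultiIndex n i) R}

attribute [local instance] sectionsAlgebra

namespace IsMatrixAt

/-- If `c` is normalized against `r v`, then `r c` is normalized against `v`. Coordinates on `I^{⊗
k}` change by `r ^ k`, so the matrix changes by `r ^ (i - j)`. -/
lemma smul (h : IsMatrixAt e θ φ v M) (r : Rˣ) :
    IsMatrixAt e θ φ ((r : R) • v) (((r ^ i * (r⁻¹) ^ j : Rˣ) : R) • M) := by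
  intro S _ _ _ _ g V hV u c hc hJ x
  let ρ : Sˣ := Units.map (g : R →* S) r
  have hρ : g ∘ ((r : R) • v) = (ρ : S) • (g ∘ v) := by
    ext; simp [ρ]
  have hc' : ((ρ : S) • c) ⬝ᵥ (g ∘ v) = 1 := by
    rw [smul_dotProduct, ← dotProduct_smul, ← hρ, hc]
  have hJ' : (idealOfAffine e hV).map u = splitPoint θ (g ∘ v) ⟨_, hc'⟩ := by
    rw [hJ, ← splitPoint_smul θ (g ∘ v) ⟨_, hc'⟩ ρ (by rw [← hρ]; exact ⟨c, hc⟩)]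
    congr 1
  have h1 := h S g V hV u _ hc' hJ' x
  rw [coord_smul, coord_smul, Matrix.mulVec_smul] at h1
  have h2 : ((((r ^ i * (r⁻¹) ^ j : Rˣ) : R) • M).map g) =
      ((ρ ^ i * (ρ⁻¹) ^ j : Sˣ) : S) • M.map g := by
    have : ρ ^ i * (ρ⁻¹) ^ j = Units.map (g : R →* S) (r ^ i * (r⁻¹) ^ j) := by
      rw [map_mul, map_pow, map_pow, map_inv]
    rw [this]
    ext a b
    exact map_mul g _ _
  rw [h2, Matrix.smul_mulVec, Units.val_mul, mul_comm, mul_smul, Units.val_pow_eq_pow_val ρ, ← h1,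
    smul_smul, ← Units.val_pow_eq_pow_val ρ, ← Units.val_mul, ← mul_pow,
    inv_mul_cancel, one_pow, Units.val_one, one_smul]

-- A computation on the projective line joining `a` to the `l`-th basis vector. The vectors `w₁`,
-- `w₂` are its two charts, with inverse parameters; the entries of the matrix are sections of a
-- line bundle of degree `i - j ≤ 0`, hence constant, and zero if the degree is negative. The basis
-- vector is the point at infinity.
open Polynomial LaurentPolynomial in
lemma exists_on_line (e : points X ≅ functor F A n)
    (θ : K ⊗[F] A ≃ₐ[K] Matrix (Fin n) (Fin n) K) (hij : i ≤ j)
    (φ : assocSheaf (powerPresheaf e i) ⟶ assocSheaf (powerPresheaf e j)) {a : Fin n → R}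
    {k l : Fin n} (hkl : k ≠ l) (hk : a k = 1) (hl : a l = 0) :
    ∃ M, (i < j → M = 0) ∧ (∀ r : R, IsMatrixAt e θ φ (a + Pi.single l r) M) ∧
      IsMatrixAt e θ φ (Pi.single l (1 : R)) M := by
  let w₁ : Fin n → R[X] := Polynomial.C ∘ a + Pi.single l Polynomial.X
  let w₂ : Fin n → R[X] := (Polynomial.X : R[X]) • (Polynomial.C ∘ a) + Pi.single l 1
  obtain ⟨P, hP⟩ := exists_isMatrixAt e θ (v := w₁) ⟨Pi.single k 1, by
    simp [w₁, hk, hkl]⟩ φ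
  obtain ⟨Q, hQ⟩ := exists_isMatrixAt e θ (v := w₂) ⟨Pi.single l 1, by
    simp [w₂, hl]⟩ φ
  let f₁ : R[X] →ₐ[K] R[T;T⁻¹] := toLaurentAlg.restrictScalars K
  let f₂ : R[X] →ₐ[K] R[T;T⁻¹] := (LaurentPolynomial.invert.toAlgHom.restrictScalars K).comp f₁
  let t : R[T;T⁻¹]ˣ := ⟨LaurentPolynomial.T (-1), LaurentPolynomial.T 1,
    by rw [← LaurentPolynomial.T_add]; simp, by rw [← LaurentPolynomial.T_add]; simp⟩
  -- With `e_l` the `l`-th basis vector, `T⁻¹ a + e_l = T⁻¹ (a + T e_l)`: here `f₂` sends `X` to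
  -- `T⁻¹`, and `t = T⁻¹`.
  have hw : f₂ ∘ w₂ = (t : R[T;T⁻¹]) • (f₁ ∘ w₁) := by
    ext1 x
    have hT : (T (-1) * T 1 : R[T;T⁻¹]) = 1 := by rw [← T_add]; simp
    by_cases hx : x = l
    · subst hx
      simp [w₁, w₂, f₁, f₂, t, hl, hT]
    · simp [w₁, w₂, f₁, f₂, t, hx]
  have h1 := (hP.map f₁).smul t
  rw [← hw] at h1
  have hPQ := (hQ.map f₂).unique (exists_map_dotProduct _ ⟨Pi.single l 1, by simp [w₂, hl]⟩ f₂) h1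
  have hentry (x y) : invert (toLaurent (Q x y)) = T ((j - i : ℕ) : ℤ) * toLaurent (P x y) := by
    have h2 := congrFun (congrFun hPQ x) y
    have h3 : ((t ^ i * t⁻¹ ^ j : R[T;T⁻¹]ˣ) : R[T;T⁻¹]) = T ((j - i : ℕ) : ℤ) := by
      have : ((t ^ i * t⁻¹ ^ j : R[T;T⁻¹]ˣ) : R[T;T⁻¹]) = T (-1) ^ i * T 1 ^ j := rfl
      rw [this, T_pow, T_pow, ← T_add]
      congr 1
      push_cast [hij]
      ring
    rw [h3] at h2
    exact h2
  have hconst (x y) : ∃ z, P x y = Polynomial.C z ∧ Q x y = Polynomial.C z := by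
    rcases hij.eq_or_lt with rfl | hlt
    · have h2 := hentry x y
      rw [Nat.sub_self, Nat.cast_zero, T_zero, one_mul] at h2
      exact ⟨_, eq_C_of_invert_toLaurent h2⟩
    · have h2 := hentry x y
      have h3 := eq_zero_of_invert_toLaurent (by omega) h2
      rw [h3, map_zero, mul_zero, map_eq_zero_iff _ invert.injective,
        Polynomial.toLaurent_eq_zero] at h2
      exact ⟨0, by rw [h3, map_zero], by rw [h2, map_zero]⟩
  refine ⟨P.map (aeval (0 : R)), fun h => ?_, fun r => ?_, ?_⟩
  · ext x y
    rw [Matrix.map_apply, eq_zero_of_invert_toLaurent (by omega) (hentry x y), map_zero]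
    rfl
  · have h2 := hP.map ((aeval r).restrictScalars K)
    have h3 : ((aeval r).restrictScalars K : R[X] →ₐ[K] R) ∘ w₁ = a + Pi.single l r := by
      ext x
      by_cases hx : x = l
      · subst hx
        simp [w₁, hl]
      · simp [w₁, hx]
    have h4 : P.map ((aeval r).restrictScalars K : R[X] →ₐ[K] R) = P.map (aeval (0 : R)) := by
      ext x y
      obtain ⟨z, hz, -⟩ := hconst x y
      simp [hz]
    rwa [h3, h4] at h2
  · have h2 := hQ.map ((aeval (0 : R)).restrictScalars K)
    have h3 : ((aeval (0 : R)).restrictScalars K : R[X] →ₐ[K] R) ∘ w₂ = Pi.single l 1 := by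
      ext x
      by_cases hx : x = l
      · subst hx
        simp [w₂, hl]
      · simp [w₂, hx]
    have h4 : Q.map ((aeval (0 : R)).restrictScalars K : R[X] →ₐ[K] R) = P.map (aeval (0 : R)) := by
      ext x y
      obtain ⟨z, hz, hz'⟩ := hconst x y
      simp [hz, hz']
    rwa [h3, h4] at h2

lemma congr_matrix (h : IsMatrixAt e θ φ v M) (hMN : M = N) : IsMatrixAt e θ φ v N := hMN ▸ h

end IsMatrixAt

/-- Starting from the `k`-th basis vector, the other coordinates of `v` are switched on one at a
time. Each change moves along a line on which the matrix is constant, and uniqueness identifies the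
matrix at the starting point. -/
lemma isMatrixAt_of_apply_eq_one (hij : i ≤ j) {k : Fin n}
    {M : Matrix (MultiIndex n j) (MultiIndex n i) R}
    (hM : IsMatrixAt e θ φ (Pi.single k (1 : R)) M) (hv : v k = 1) : IsMatrixAt e θ φ v M := by
  classical
  have key (s : Finset (Fin n)) :
      IsMatrixAt e θ φ (fun x => if x ∈ s ∨ x = k then v x else 0) M := by
    induction s using Finset.induction_on with
    | empty =>
      convert hM using 2 with x
      by_cases hx : x = k
      · subst hx; simp [hv]
      · simp [hx]
    | insert l s hl ih =>
      by_cases hlk : l = k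
      · convert ih using 2 with x
        grind
      · set a : Fin n → R := fun x => if x ∈ s ∨ x = k then v x else 0 with ha
        obtain ⟨N, -, hN, -⟩ := IsMatrixAt.exists_on_line e θ hij φ (a := a) (Ne.symm hlk)
          (by simp [ha, hv]) (by simp [ha, hl, hlk])
        have h0 := hN 0
        rw [Pi.single_zero, add_zero] at h0
        have hNM : N = M := h0.unique ⟨Pi.single k 1, by simp [ha, hv]⟩ ih
        subst hNM
        convert hN (v l) using 2 with x
        by_cases hx : x = l
        · subst hx; simp [ha, hl, hlk]
        · simp [ha, hx]
  simpa using key Finset.univ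

/-- Any two basis vectors lie on a line, so they share one matrix, and it spreads to all `v` with a
coordinate equal to `1`. Rescaling a unit coordinate `r` to `1` costs a factor `r ^ (i - j)`,
harmless when `i = j` and also when the matrix is zero. For `n = 1` there are no lines and the
vanishing fails, hence the condition `1 < n`. -/
theorem exists_isMatrixAt_const (e : points X ≅ functor F A n)
    (θ : K ⊗[F] A ≃ₐ[K] Matrix (Fin n) (Fin n) K) [NeZero n] (hij : i = j ∨ i < j ∧ 1 < n)
    (φ : assocSheaf (powerPresheaf e i) ⟶ assocSheaf (powerPresheaf e j)) :
    ∃ M : Matrix (MultiIndex n j) (MultiIndex n i) K, (i < j → M = 0) ∧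
      ∀ (R : Type u) [CommRing R] [Algebra F R] [Algebra K R] [IsScalarTower F K R]
        (v : Fin n → R) (k : Fin n), IsUnit (v k) → IsMatrixAt e θ φ v (M.map (algebraMap K R)) := by
  have hle : i ≤ j := by omega
  have hsingle (k : Fin n) : ∃ c, c ⬝ᵥ (Pi.single k 1 : Fin n → K) = 1 :=
    ⟨Pi.single k 1, by simp⟩
  choose M hM using fun k : Fin n => exists_isMatrixAt e θ (hsingle k) φ
  have hline {k l : Fin n} (hkl : k ≠ l) : (i < j → M l = 0) ∧ M k = M l := by
    obtain ⟨N, hN0, hN, hNl⟩ := IsMatrixAt.exists_on_line e θ hle φ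
      (a := (Pi.single k 1 : Fin n → K)) hkl (by simp) (by simp [hkl.symm])
    have h0 := hN 0
    rw [Pi.single_zero, add_zero] at h0
    have h1 : M k = N := (hM k).unique (hsingle k) h0
    have h2 : M l = N := (hM l).unique (hsingle l) hNl
    exact ⟨fun h => h2.trans (hN0 h), h1.trans h2.symm⟩
  have hMk (k) : M k = M 0 := by
    by_cases hk : k = 0
    · rw [hk]
    · exact (hline hk).2
  have hzero (h : i < j) : M 0 = 0 := by
    have hn : 1 < n := by omega
    exact (hline (k := ⟨1, hn⟩) (l := 0) (by simp [Fin.ext_iff])).1 h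
  refine ⟨M 0, hzero, fun R _ _ _ _ v k hk => ?_⟩
  obtain ⟨r, hr⟩ := hk
  have h1 := (hM k).map (Algebra.ofId K R)
  have h2 : (Algebra.ofId K R) ∘ (Pi.single k 1 : Fin n → K) = Pi.single k 1 := by
    ext x
    by_cases hx : x = k
    · subst hx; simp
    · simp [hx]
  rw [h2, hMk] at h1
  have h3 := (isMatrixAt_of_apply_eq_one hle (v := ((r⁻¹ : Rˣ) : R) • v) h1 (by simp [← hr])).smul r
  rw [smul_smul, Units.mul_inv, one_smul] at h3
  refine h3.congr_matrix ?_
  rcases hij with rfl | h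
  · rw [← mul_pow, mul_inv_cancel, one_pow, Units.val_one, one_smul]
    rfl
  · rw [hzero h.1]
    ext
    simp

end Matrices

/-! ### Detecting zero over local algebras -/

section LocalVanishing

attribute [local instance] Algebra.TensorProduct.rightAlgebra

/-- The elements `y m` of a `B`-module vanish if `∑ b m ⊗ y m` vanishes in the base change to every
local `K`-algebra under `B`. -/
lemma eq_zero_of_forall_local {F K B P ι : Type u} [Field F] [Field K] [Algebra F K] [CommRing B]
    [Algebra F B] [AddCommGroup P] [Module B P] (b : Module.Basis ι F K) (y : ι →₀ P)
    (h : ∀ (R : Type u) [CommRing R] [Algebra F R] [Algebra K R] [IsScalarTower F K R]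
      [IsLocalRing R] (u : B →ₐ[F] R) (Q : Type u) [AddCommGroup Q] [Module R Q]
      (g : P →ₛₗ[(u : B →+* R)] Q), y.sum (fun m p => algebraMap K R (b m) • g p) = 0) :
    y = 0 := by
  let S := B ⊗[F] K
  -- Vanishing is tested at the maximal ideals of `B ⊗[F] K`, whose localizations are local
  -- `K`-algebras under `B`. As the `1 ⊗ b m` form a `B`-basis of `B ⊗[F] K`, each `y m` is then
  -- zero.
  have hy : y.sum (fun m p => (Algebra.TensorProduct.basis B b m : S) ⊗ₜ[B] p) = 0 := by
    refine Module.eq_zero_of_localization_maximal (R := S)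
      (fun p _ => LocalizedModule p.primeCompl (S ⊗[B] P))
      (fun p _ => LocalizedModule.mkLinearMap p.primeCompl (S ⊗[B] P)) _ fun p _ => ?_
    let R := Localization.AtPrime p
    let u : B →ₐ[F] R := (IsScalarTower.toAlgHom F S R).comp Algebra.TensorProduct.includeLeft
    let l := LocalizedModule.mkLinearMap p.primeCompl (S ⊗[B] P)
    let g : P →ₛₗ[(u : B →+* R)] LocalizedModule p.primeCompl (S ⊗[B] P) :=
      { toFun := fun x => l ((1 : S) ⊗ₜ x)
        map_add' := fun x y => by rw [TensorProduct.tmul_add, map_add]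
        map_smul' := fun r x => by
          have h1 : (1 : S) ⊗ₜ[B] (r • x) = (r ⊗ₜ[F] (1 : K) : S) • ((1 : S) ⊗ₜ[B] x) := by
            rw [← TensorProduct.smul_tmul, TensorProduct.smul_tmul', smul_eq_mul, mul_one]
            congr 1
            exact (Algebra.smul_def _ _).trans (mul_one _)
          rw [h1, map_smul]
          exact (algebraMap_smul R _ _).symm }
    have : IsScalarTower F K R := IsScalarTower.of_algebraMap_eq fun x => by
      rw [IsScalarTower.algebraMap_apply F S R, IsScalarTower.algebraMap_apply K S R,
        IsScalarTower.algebraMap_apply F K S]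
    have h1 := h R u (LocalizedModule p.primeCompl (S ⊗[B] P)) g
    refine Eq.trans ?_ h1
    rw [map_finsuppSum]
    refine Finsupp.sum_congr fun m _ => ?_
    rw [Algebra.TensorProduct.basis_apply]
    change l _ = _ • l _
    have h2 : ((1 : B) ⊗ₜ[F] b m : S) ⊗ₜ[B] y m =
        ((1 : B) ⊗ₜ[F] b m : S) • ((1 : S) ⊗ₜ[B] y m) := by
      rw [TensorProduct.smul_tmul', smul_eq_mul, mul_one]
    rw [h2, map_smul]
    exact (algebraMap_smul R ((1 : B) ⊗ₜ[F] b m : S) _).symm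
  exact TensorProduct.sum_tmul_basis_left_eq_zero (Algebra.TensorProduct.basis B b) y hy

end LocalVanishing

/-! ### Detecting zero morphisms -/

section Morphisms

variable {F : Type u} [Field F] {X : Over (Spec (.of F))} {A : Type u} [Ring A] [Algebra F A]
  [FiniteDimensional F A] {n : ℕ} [NeZero n] (e : points X ≅ functor F A n)
  {K : Type u} [Field K] [Algebra F K] (θ : K ⊗[F] A ≃ₐ[K] Matrix (Fin n) (Fin n) K)
  {i j : ℕ}

attribute [local instance] sectionsAlgebra

/-- Morphisms `φ m` vanish if `∑ b m ⊗ φ m` vanishes at all points with values in local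
`K`-algebras. -/
theorem finsupp_hom_eq_zero {ι : Type u} (b : Module.Basis ι F K)
    (φ : ι →₀ (assocSheaf (powerPresheaf e i) ⟶ assocSheaf (powerPresheaf e j)))
    (h : ∀ (R : Type u) [CommRing R] [Algebra F R] [Algebra K R] [IsScalarTower F K R]
      [IsLocalRing R] (V : X.left.Opens) (hV : IsAffineOpen V) (u : Γ(X.left, V) →ₐ[F] R)
      (v c : Fin n → R) (hc : c ⬝ᵥ v = 1),
      (idealOfAffine e hV).map u = splitPoint θ v ⟨c, hc⟩ → ∀ x,
      φ.sum (fun m f => algebraMap K R (b m) • coord e θ u c j (act e f hV x)) = 0) :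
    φ = 0 := by
  ext1 m
  refine (isLocalizing_powerPresheaf e j).eq_zero_of_affineMap _ fun V hV x => ?_
  let ev : (assocSheaf (powerPresheaf e i) ⟶ assocSheaf (powerPresheaf e j)) →+
      (powerPresheaf e j).obj (op V) :=
    AddMonoidHom.mk' (fun f => act e f hV x) fun f g => IsLocalizing.affineMap_add _ f g hV x
  have key : φ.mapRange ev (map_zero ev) = 0 := by
    refine eq_zero_of_forall_local (B := Γ(X.left, V)) b _ fun R _ _ _ _ _ u Q _ _ g => ?_
    -- Over a local ring the ideal is given by a unimodular vector, and every semilinear map out of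
    -- the sections factors through their coordinates.
    obtain ⟨v, ⟨c, hc⟩, hJ⟩ := exists_eq_splitPoint θ ((idealOfAffine e hV).map u)
    obtain ⟨l, hl, -⟩ := isSemilinearBaseChange_coord e θ hV u hc hJ j Q g
    rw [Finsupp.sum_mapRange_index (fun m => by rw [map_zero, smul_zero])]
    have h1 := congrArg l (h R V hV u v c hc hJ x)
    rw [map_finsuppSum, map_zero] at h1
    rw [← h1]
    refine Finsupp.sum_congr fun m _ => ?_
    rw [map_smul, hl]
    rfl
  exact DFunLike.congr_fun key m

end Morphisms

/-! ### Endomorphisms given by right multiplication -/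

section Action

variable {F : Type u} [Field F] {X : Over (Spec (.of F))} {A : Type u} [Ring A] [Algebra F A]
  {n : ℕ} (e : points X ≅ functor F A n)

attribute [local instance] sectionsAlgebra

lemma resTensor_mul_tmul {U V : X.left.Opens} (h : V ≤ U) (x : Γ(X.left, U) ⊗[F] A) (a : A) :
    resTensor X A h (x * (1 ⊗ₜ a)) = resTensor X A h x * (1 ⊗ₜ a) := by
  induction x using TensorProduct.induction_on with
  | zero => rw [zero_mul, map_zero, zero_mul]
  | add x y hx hy => rw [add_mul, map_add, hx, hy, map_add, add_mul]
  | tmul r b =>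
    rw [Algebra.TensorProduct.tmul_mul_tmul, resTensor_tmul, resTensor_tmul,
      Algebra.TensorProduct.tmul_mul_tmul, mul_one, mul_one]

/-- Right multiplication by an element of `A` on sections of the tautological sheaf. -/
noncomputable def mulRightSections (a : A) (U : X.left.Opens) :
    tautologicalSections e U →ₗ[Γ(X.left, U)] tautologicalSections e U where
  toFun x := ⟨x.1 * (1 ⊗ₜ a), fun V hV h => by
    rw [resTensor_mul_tmul]
    exact (idealOfAffine e hV).mul_mem _ (x.2 V hV h) _⟩
  map_add' x y := Subtype.ext (add_mul x.1 y.1 _)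
  map_smul' r x := Subtype.ext (smul_mul_assoc r x.1 _)

/-- Right multiplication by an element of `A` on the tautological sheaf. -/
noncomputable def mulRightHom (a : A) : (tautologicalSubmodule e).toPresheafOfModules ⟶
    (tautologicalSubmodule e).toPresheafOfModules :=
  PresheafOfModules.homMk
    { app := fun U => AddCommGrpCat.ofHom (mulRightSections e a U.unop).toAddMonoidHom
      naturality := fun U V f => by
        ext x
        exact Subtype.ext (resTensor_mul_tmul (leOfHom f.unop) _ a).symm }
    fun U r x => map_smul (mulRightSections e a U.unop) r x

/-- Multiplication by a scalar on the structure sheaf. -/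
noncomputable def scalarHom (r : F) : powerPresheaf e 0 ⟶ powerPresheaf e 0 :=
  PresheafOfModules.homMk
    { app := fun U => AddCommGrpCat.ofHom
        (LinearMap.mulLeft Γ(X.left, U.unop) (algebraMap F Γ(X.left, U.unop) r)).toAddMonoidHom
      naturality := fun U V f => by
        ext x
        refine Eq.symm ((map_mul (X.left.presheaf.map f).hom _ _).trans ?_)
        exact congrArg (· * _) (algebraMap_res X (leOfHom f.unop) r) }
    fun U s x => mul_left_comm (algebraMap F Γ(X.left, U.unop) r) (s : Γ(X.left, U.unop)) x

variable (F A) in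
/-- Data for an endomorphism of `I^{⊗ k}`: a scalar and elements of `A` for each of the factors. -/
def ActIndex : ℕ → Type u
  | 0 => F
  | k + 1 => ActIndex k × A

open MonoidalCategory in
/-- The endomorphism of `I^{⊗ k}` given by right multiplications on the factors. -/
noncomputable def actHom : ∀ k, ActIndex F A k → (powerPresheaf e k ⟶ powerPresheaf e k)
  | 0, r => scalarHom e r
  | k + 1, g => actHom k g.1 ⊗ₘ mulRightHom e g.2

lemma actHom_tmulSec {V : X.left.Opens} {k : ℕ} (g : ActIndex F A (k + 1))
    (s : (powerPresheaf e k).obj (op V))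
    (x : (tautologicalSubmodule e).toPresheafOfModules.obj (op V)) :
    (actHom e (k + 1) g).app (op V) (tmulSec e s x) =
      tmulSec e ((actHom e k g.1).app (op V) s) ((mulRightHom e g.2).app (op V) x) := rfl

variable {K : Type u} [Field K] [Algebra F K] (θ : K ⊗[F] A ≃ₐ[K] Matrix (Fin n) (Fin n) K)
  {R : Type u} [CommRing R] [Algebra F R] [Algebra K R] [IsScalarTower F K R]

open scoped Kronecker in
/-- The matrix of `actHom`. -/
noncomputable def actMatrix : ∀ k, ActIndex F A k → Matrix (MultiIndex n k) (MultiIndex n k) K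
  | 0, r => algebraMap F (Matrix Unit Unit K) r
  | k + 1, g => (actMatrix k g.1) ⊗ₖ (θ (1 ⊗ₜ g.2)).transpose

/-- Since `cᵀ (x a) = (cᵀ x) a`, right multiplication acts on rows of coordinates; written on
columns it is the transpose. -/
lemma coordOne_mulRightHom {V : X.left.Opens} (u : Γ(X.left, V) →ₐ[F] R) (c : Fin n → R) (a : A)
    (x : (tautologicalSubmodule e).toPresheafOfModules.obj (op V)) :
    coordOne e θ u c ((mulRightHom e a).app (op V) x) =
      ((θ (1 ⊗ₜ a)).transpose.map (algebraMap K R)).mulVec (coordOne e θ u c x) := by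
  obtain ⟨x, hx⟩ : tautologicalSections e V := x
  change splitCoord θ c (extendTensor A u (x * (1 ⊗ₜ a))) =
    Matrix.mulVec _ (splitCoord θ c (extendTensor A u x))
  rw [extendTensor_mul, extendTensor_tmul, map_one, splitCoord_apply, splitCoord_apply, map_mul,
    splitEquiv_tmul, one_smul, ← Matrix.vecMul_vecMul, Matrix.transpose_map, Matrix.mulVec_transpose]

lemma coord_actHom {V : X.left.Opens} (u : Γ(X.left, V) →ₐ[F] R) (c : Fin n → R) :
    ∀ (k : ℕ) (g : ActIndex F A k) (x : (powerPresheaf e k).obj (op V)),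
    coord e θ u c k ((actHom e k g).app (op V) x) =
      ((actMatrix θ k g).map (algebraMap K R)).mulVec (coord e θ u c k x)
  | 0, (r : F), x => by
    have h : (algebraMap F (Matrix Unit Unit K) r).map (algebraMap K R) =
        Matrix.diagonal fun _ => algebraMap F R r := by
      rw [Matrix.algebraMap_eq_diagonal, Matrix.diagonal_map (map_zero _)]
      congr 1
      ext
      exact (IsScalarTower.algebraMap_apply F K R r).symm
    have h' (y : Unit → R) : ((algebraMap F (Matrix Unit Unit K) r).map (algebraMap K R)).mulVec y =
        algebraMap F R r • y := by
      rw [h]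
      ext
      simp [Matrix.mulVec_diagonal]
    refine Eq.trans ?_ (h' _).symm
    ext q
    exact (map_mul u _ _).trans (congrArg (· * _) (u.commutes r))
  | k + 1, g, x => by
    induction x using power_induction with
    | h0 => rw [map_zero, map_zero, Matrix.mulVec_zero]
    | hadd x y hx hy => rw [map_add, map_add, map_add, hx, hy, Matrix.mulVec_add]
    | hmul s x =>
      ext q
      rw [actHom_tmulSec, coord_tmulSec, coord_actHom u c k, coordOne_mulRightHom]
      change _ = ∑ p : MultiIndex n k × Fin n,
        algebraMap K R (actMatrix θ k g.1 q.1 p.1 * (θ (1 ⊗ₜ g.2)).transpose q.2 p.2) *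
          coord e θ u c (k + 1) (tmulSec e s x) p
      rw [Fintype.sum_prod_type, Matrix.mulVec, Matrix.mulVec, dotProduct, dotProduct]
      refine (Finset.sum_mul_sum _ _ _ _).trans
        (Finset.sum_congr rfl fun p _ => Finset.sum_congr rfl fun p' _ => ?_)
      refine Eq.trans ?_ (congrArg (_ * ·) (coord_tmulSec e θ u c s x (p, p')).symm)
      rw [map_mul, Matrix.map_apply, Matrix.map_apply]
      ring

-- The scalar is put in the factor of degree zero and `1` in the others. This makes the image of the
-- endomorphism ring an `F`-subalgebra of the matrices.
variable (F A) in
lemma exists_actMatrix_eq_algebraMap (r : F) : ∀ k, ∃ g : ActIndex F A k,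
    actMatrix θ k g = algebraMap F (Matrix (MultiIndex n k) (MultiIndex n k) K) r
  | 0 => ⟨r, rfl⟩
  | k + 1 => by
    obtain ⟨g, hg⟩ := exists_actMatrix_eq_algebraMap r k
    refine ⟨(g, 1), ?_⟩
    have : actMatrix θ (k + 1) (g, 1) =
      Matrix.kroneckerMap (· * ·) (actMatrix θ k g) (θ (1 ⊗ₜ 1)).transpose := rfl
    rw [this, hg, ← Algebra.TensorProduct.one_def, map_one, Matrix.transpose_one,
      Matrix.algebraMap_eq_diagonal, Matrix.algebraMap_eq_diagonal, ← Matrix.diagonal_one,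
      Matrix.diagonal_kronecker_diagonal]
    simp only [mul_one]
    rfl

lemma span_range_transpose_tmul :
    Submodule.span K (Set.range fun a : A => (θ (1 ⊗ₜ[F] a)).transpose) = ⊤ := by
  have h1 : Submodule.span K (Set.range fun a : A => (1 : K) ⊗ₜ[F] a) = ⊤ := by
    rw [eq_top_iff]
    intro x _
    induction x using TensorProduct.induction_on with
    | zero => exact zero_mem _
    | add x y hx hy => exact add_mem (hx trivial) (hy trivial)
    | tmul r a =>
      have : r ⊗ₜ[F] a = r • ((1 : K) ⊗ₜ[F] a) := by
        rw [TensorProduct.smul_tmul', smul_eq_mul, mul_one]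
      rw [this]
      exact Submodule.smul_mem _ _ (Submodule.subset_span ⟨a, rfl⟩)
  let l : K ⊗[F] A ≃ₗ[K] Matrix (Fin n) (Fin n) K :=
    θ.toLinearEquiv.trans (Matrix.transposeLinearEquiv (Fin n) (Fin n) K K)
  have h2 : (Set.range fun a : A => (θ (1 ⊗ₜ[F] a)).transpose) =
      l.toLinearMap '' Set.range fun a : A => (1 : K) ⊗ₜ[F] a := by
    rw [← Set.range_comp]
    rfl
  rw [h2, Submodule.span_image, h1, Submodule.map_top, LinearEquiv.range]

/-- Matrix units on a product of index sets are Kronecker products of matrix units. -/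
lemma map₂_kroneckerBilinear_top {ι κ : Type*} [Fintype ι] [Fintype κ] [DecidableEq ι]
    [DecidableEq κ] : Submodule.map₂ (Matrix.kroneckerBilinear (R := K) :
      Matrix ι ι K →ₗ[K] Matrix κ κ K →ₗ[K] Matrix (ι × κ) (ι × κ) K) ⊤ ⊤ = ⊤ := by
  rw [eq_top_iff]
  intro M _
  rw [Matrix.matrix_eq_sum_single M]
  refine sum_mem fun p _ => sum_mem fun q _ => ?_
  have : Matrix.single p q (M p q) =
      Matrix.kroneckerBilinear (R := K) (Matrix.single p.1 q.1 (M p q)) (Matrix.single p.2 q.2 (1 : K)) := by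
    refine Eq.symm ((Matrix.single_kronecker_single _ _ _ _ _ _).trans ?_)
    rw [mul_one]
  rw [this]
  exact Submodule.apply_mem_map₂ _ trivial trivial

/-- By induction, Kronecker products of spanning sets span. This gives the surjectivity of `K ⊗
End(I^{⊗ k})` onto the matrices. -/
lemma span_range_actMatrix : ∀ k, Submodule.span K (Set.range (actMatrix (F := F) (A := A) θ k)) = ⊤
  | 0 => by
    rw [eq_top_iff]
    intro M _
    have : M = M () () • actMatrix (F := F) (A := A) θ 0 (1 : F) := by
      ext a b
      have : actMatrix (F := F) (A := A) θ 0 (1 : F) = (1 : Matrix Unit Unit K) :=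
        map_one (algebraMap F (Matrix Unit Unit K))
      rw [this]
      change M a b = M () () * (1 : Matrix Unit Unit K) () ()
      rw [Matrix.one_apply_eq, mul_one]
      rfl
    rw [this]
    exact Submodule.smul_mem _ _ (Submodule.subset_span ⟨_, rfl⟩)
  | k + 1 => by
    have h := Submodule.map₂_span_span K (Matrix.kroneckerBilinear (R := K) :
      Matrix (MultiIndex n k) (MultiIndex n k) K →ₗ[K] Matrix (Fin n) (Fin n) K →ₗ[K] _)
      (Set.range (actMatrix (F := F) (A := A) θ k))
      (Set.range fun a : A => (θ (1 ⊗ₜ[F] a)).transpose)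
    rw [span_range_actMatrix k, span_range_transpose_tmul, map₂_kroneckerBilinear_top] at h
    rw [eq_top_iff]
    refine h.le.trans (Submodule.span_mono ?_)
    rintro _ ⟨_, ⟨g, rfl⟩, _, ⟨a, rfl⟩, rfl⟩
    exact ⟨(g, a), rfl⟩

end Action

/-! ### Vanishing of morphisms and semisimplicity of endomorphism rings -/

section Endomorphisms

/-- Otherwise `c ⬝ᵥ v` would lie in the maximal ideal. This brings all points over local algebras
within reach of the constant matrix. -/
lemma exists_isUnit_of_dotProduct_eq_one {R : Type*} [CommRing R] [IsLocalRing R] {n : ℕ}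
    {c v : Fin n → R}
    (h : c ⬝ᵥ v = 1) : ∃ k, IsUnit (v k) := by
  by_contra! hv
  have : c ⬝ᵥ v ∈ IsLocalRing.maximalIdeal R :=
    sum_mem fun k _ => Ideal.mul_mem_left _ _ (hv k)
  rw [h] at this
  exact (Ideal.ne_top_iff_one _).mp (IsLocalRing.maximalIdeal.isMaximal R).ne_top this

variable {F : Type u} [Field F] {X : Over (Spec (.of F))} {A : Type u} [Ring A] [Algebra F A]
  [FiniteDimensional F A] {n : ℕ} [NeZero n] (e : points X ≅ functor F A n)
  {K : Type u} [Field K] [Algebra F K] (θ : K ⊗[F] A ≃ₐ[K] Matrix (Fin n) (Fin n) K)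
  {i j : ℕ}

attribute [local instance] sectionsAlgebra

/-- The matrix over `K` of a morphism `I^{⊗ i} ⟶ I^{⊗ j}` determines the morphism. -/
lemma finsupp_eq_zero_of_matrix {ι : Type u} (b : Module.Basis ι F K)
    (φ : ι →₀ (assocSheaf (powerPresheaf e i) ⟶ assocSheaf (powerPresheaf e j)))
    (M : ι → Matrix (MultiIndex n j) (MultiIndex n i) K)
    (hM : ∀ m ∈ φ.support, ∀ (R : Type u) [CommRing R] [Algebra F R] [Algebra K R] [IsScalarTower F K R]
        (v : Fin n → R) (k : Fin n), IsUnit (v k) →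
        IsMatrixAt e θ (φ m) v ((M m).map (algebraMap K R)))
    (h : ∑ m ∈ φ.support, b m • M m = 0) : φ = 0 := by
  refine finsupp_hom_eq_zero e θ b φ fun R _ _ _ _ _ V hV u v c hc hJ x => ?_
  obtain ⟨k, hk⟩ := exists_isUnit_of_dotProduct_eq_one hc
  have h1 (m : ι) (hm : m ∈ φ.support) : coord e θ u c j (act e (φ m) hV x) =
      ((M m).map (algebraMap K R)).mulVec (coord e θ u c i x) :=
    hM m hm R v k hk R (AlgHom.id K R) V hV u c hc hJ x
  have h2 : (∑ m ∈ φ.support, b m • M m).map (algebraMap K R) = 0 := by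
    rw [h, Matrix.map_zero _ (map_zero _)]
  have h3 : ∑ m ∈ φ.support, algebraMap K R (b m) • (M m).map (algebraMap K R) =
      (∑ m ∈ φ.support, b m • M m).map (algebraMap K R) := by
    ext p q
    simp [Matrix.sum_apply, Algebra.smul_def]
  have h4 : (∑ m ∈ φ.support, algebraMap K R (b m) • (M m).map (algebraMap K R)).mulVec
      (coord e θ u c i x) = 0 := by
    rw [h3, h2, Matrix.zero_mulVec]
  rw [Matrix.sum_mulVec] at h4
  refine (Finset.sum_congr rfl fun m hm => ?_).trans h4
  beta_reduce
  rw [h1 m hm, Matrix.smul_mulVec]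

-- The constant matrix of `φ` is zero, and a matrix determines its morphism: a family with one
-- member is enough.
include θ in
theorem hom_eq_zero_of_lt (hij : i < j) (hn : 1 < n)
    (φ : assocSheaf (powerPresheaf e i) ⟶ assocSheaf (powerPresheaf e j)) : φ = 0 := by
  classical
  obtain ⟨M, hM0, hM⟩ := exists_isMatrixAt_const e θ (Or.inr ⟨hij, hn⟩) φ
  let b := Module.Basis.ofVectorSpace F K
  obtain ⟨m⟩ := b.index_nonempty
  refine Finsupp.single_eq_zero.mp (finsupp_eq_zero_of_matrix e θ b (Finsupp.single m φ)
    (fun _ => M) (fun m' hm' R _ _ _ _ v k hk => ?_) ?_)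
  · obtain rfl := Finset.mem_singleton.mp (Finsupp.support_single_subset hm')
    rw [Finsupp.single_eq_same]
    exact hM R v k hk
  · simp [hM0 hij]

/-- The matrix of an endomorphism of `I^{⊗ i}`. -/
noncomputable def matrixOf (φ : End (assocSheaf (powerPresheaf e i))) :
    Matrix (MultiIndex n i) (MultiIndex n i) K :=
  (exists_isMatrixAt_const e θ (Or.inl rfl) φ).choose

lemma isMatrixAt_matrixOf (φ : End (assocSheaf (powerPresheaf e i))) (R : Type u) [CommRing R]
    [Algebra F R] [Algebra K R] [IsScalarTower F K R] (v : Fin n → R) (k : Fin n)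
    (hk : IsUnit (v k)) : IsMatrixAt e θ φ v ((matrixOf e θ φ).map (algebraMap K R)) :=
  (exists_isMatrixAt_const e θ (Or.inl rfl) φ).choose_spec.2 R v k hk

variable {e θ} in
lemma matrixOf_eq {φ : End (assocSheaf (powerPresheaf e i))}
    {M : Matrix (MultiIndex n i) (MultiIndex n i) K}
    (h : IsMatrixAt e θ φ (Pi.single 0 (1 : K)) M) : matrixOf e θ φ = M :=
  (isMatrixAt_matrixOf e θ φ K (Pi.single 0 1) 0 (by simp)).unique ⟨Pi.single 0 1, by simp⟩ h

lemma isMatrixAt_matrixOf_single (φ : End (assocSheaf (powerPresheaf e i))) :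
    IsMatrixAt e θ φ (Pi.single 0 (1 : K)) (matrixOf e θ φ) :=
  isMatrixAt_matrixOf e θ φ K (Pi.single 0 1) 0 (by simp)

/-- The representation of the endomorphism ring of `I^{⊗ i}` by matrices over `K`. -/
noncomputable def matrixHom (i : ℕ) :
    End (assocSheaf (powerPresheaf e i)) →+* Matrix (MultiIndex n i) (MultiIndex n i) K where
  toFun := matrixOf e θ
  map_one' := matrixOf_eq (IsMatrixAt.id _)
  -- `φ * ψ` is `ψ ≫ φ`, which matches the order of the matrix product.
  map_mul' φ ψ := matrixOf_eq
    ((isMatrixAt_matrixOf_single e θ ψ).comp (isMatrixAt_matrixOf_single e θ φ))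
  map_add' φ ψ := matrixOf_eq
    ((isMatrixAt_matrixOf_single e θ φ).add (isMatrixAt_matrixOf_single e θ ψ))
  map_zero' := by
    have h := (isMatrixAt_matrixOf_single e θ (0 : End (assocSheaf (powerPresheaf e i)))).add
      (isMatrixAt_matrixOf_single e θ (0 : End (assocSheaf (powerPresheaf e i))))
    rw [add_zero] at h
    simpa using matrixOf_eq h

lemma matrixHom_assocMap_actHom (g : ActIndex F A i) :
    matrixHom e θ i (assocMap (actHom e i g)) = actMatrix θ i g := by
  refine matrixOf_eq fun S _ _ _ _ f V hV u c hc hJ x => ?_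
  refine (congrArg (coord e θ u c i) (IsLocalizing.affineMap_assocMap _ _ _ _)).trans ?_
  rw [coord_actHom]
  congr 2
  ext
  exact (f.commutes _).symm

/-- This is the injectivity of `K ⊗ End(I^{⊗ i})` into the matrices, expressed in a basis of `K`
over `F`. -/
lemma matrixHom_finsupp_eq_zero {ι : Type u} (b : Module.Basis ι F K)
    (φ : ι →₀ End (assocSheaf (powerPresheaf e i)))
    (h : φ.sum (fun m f => b m • matrixHom e θ i f) = 0) : φ = 0 :=
  finsupp_eq_zero_of_matrix e θ b φ (fun m => matrixOf e θ (φ m))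
    (fun m _ R _ _ _ _ v k hk => isMatrixAt_matrixOf e θ (φ m) R v k hk) h

lemma matrixHom_injective : Function.Injective (matrixHom e θ i) := by
  rw [injective_iff_map_eq_zero]
  intro φ hφ
  let b := Module.Basis.ofVectorSpace F K
  obtain ⟨m⟩ := b.index_nonempty
  have := matrixHom_finsupp_eq_zero e θ b (Finsupp.single m φ) (by
    rw [Finsupp.sum_single_index (by rw [map_zero, smul_zero]), hφ, smul_zero])
  exact Finsupp.single_eq_zero.mp this

/-- The endomorphism ring of `I^{⊗ i}`, as an algebra of matrices. -/
noncomputable def endSubalgebra (i : ℕ) :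
    Subalgebra F (Matrix (MultiIndex n i) (MultiIndex n i) K) where
  __ := (matrixHom e θ i).range.toSubsemiring
  algebraMap_mem' r := by
    obtain ⟨g, hg⟩ := exists_actMatrix_eq_algebraMap F A θ r i
    exact ⟨assocMap (actHom e i g), (matrixHom_assocMap_actHom e θ g).trans hg⟩

/-- The identification of the endomorphism ring of `I^{⊗ i}` with an algebra of matrices. -/
noncomputable def endEquiv (i : ℕ) :
    End (assocSheaf (powerPresheaf e i)) ≃+* endSubalgebra e θ i :=
  RingEquiv.ofBijective (matrixHom e θ i).rangeRestrict
    ⟨fun _ _ h => matrixHom_injective e θ (congrArg Subtype.val h),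
      (matrixHom e θ i).rangeRestrict_surjective⟩

lemma coe_endEquiv (φ : End (assocSheaf (powerPresheaf e i))) :
    (endEquiv e θ i φ : Matrix (MultiIndex n i) (MultiIndex n i) K) = matrixHom e θ i φ := rfl

-- After extension of scalars to `K` the ring becomes the full matrix algebra, injectively by
-- `matrixHom_finsupp_eq_zero` and surjectively by `span_range_actMatrix`. The `F`-algebra structure
-- needed for the descent is that of `endSubalgebra`.
include θ in
theorem isSemisimpleRing_end (i : ℕ) : IsSemisimpleRing (End (assocSheaf (powerPresheaf e i))) := by
  have : IsSemisimpleRing (endSubalgebra e θ i) := by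
    refine isSemisimpleRing_of_baseChange_bijective (endSubalgebra e θ i).val ?_ ?_
    · classical
      rw [injective_iff_map_eq_zero]
      intro z hz
      let b := Module.Basis.ofVectorSpace F K
      obtain ⟨y, rfl⟩ := (TensorProduct.equivFinsuppOfBasisLeft b).symm.surjective z
      rw [TensorProduct.equivFinsuppOfBasisLeft_symm_apply] at hz
      rw [map_finsuppSum] at hz
      have h1 := matrixHom_finsupp_eq_zero e θ b
        (y.mapRange (endEquiv e θ i).symm (map_zero _)) (by
          rw [Finsupp.sum_mapRange_index (fun m => by rw [map_zero, smul_zero])]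
          refine Eq.trans (Finsupp.sum_congr fun m _ => ?_) hz
          rw [← coe_endEquiv, RingEquiv.apply_symm_apply]
          rfl)
      have h2 : y = 0 := by
        ext1 m
        have := DFunLike.congr_fun h1 m
        rw [Finsupp.mapRange_apply] at this
        exact (map_eq_zero_iff _ (endEquiv e θ i).symm.injective).mp this
      rw [h2, map_zero]
    · rw [eq_top_iff, ← span_range_actMatrix (F := F) (A := A) θ i]
      refine Submodule.span_mono ?_
      rintro _ ⟨g, rfl⟩
      exact ⟨⟨actMatrix θ i g, assocMap (actHom e i g), matrixHom_assocMap_actHom e θ g⟩, rfl⟩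
  exact (endEquiv e θ i).symm.isSemisimpleRing

end Endomorphisms

end SeveriBrauer

/-! ### Finite global dimension of the endomorphism ring -/

/-- Let `A` be a central simple algebra of degree `n` over a field `F`, `X` its Severi-Brauer variety
(the `F`-scheme representing the functor of right ideals of reduced dimension `1`), and `T` the
sheaf `𝒪 ⊕ I ⊕ ⋯ ⊕ I^{⊗ (n - 1)}` on `X`, `I` the tautological sheaf. Then the ring `End(T)` has
finite global dimension. -/
theorem mainTheorem7 (F : Type u) [Field F] (A : Type u) [Ring A] [Algebra F A]
    [FiniteDimensional F A] [Algebra.IsCentral F A] [IsSimpleRing A]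
    (n : ℕ) (hn : Module.finrank F A = n ^ 2)
    (X : Over (Spec (.of F))) (e : SeveriBrauer.points X ≅ SeveriBrauer.functor F A n) :
    globalDimension (End (SeveriBrauer.tiltingSheaf e)) < ⊤ := by
  have : NeZero n := ⟨by
    rintro rfl
    have := Module.finrank_pos (R := F) (M := A)
    rw [hn] at this
    exact absurd this (by norm_num)⟩
  obtain ⟨θ⟩ := exists_algEquiv_matrix_of_isAlgClosed F (AlgebraicClosure F) A n hn
  have := Abelian.hasFiniteBiproducts (C := X.left.Modules)
  refine globalDimension_end_biproduct_lt_top (fun k : Fin n => SeveriBrauer.tautologicalPower e k)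
    (fun i j hij f => ?_) fun i => ?_
  -- Two distinct indices in `Fin n` force `1 < n`.
  · exact SeveriBrauer.hom_eq_zero_of_lt e θ hij (by omega) f
  · exact SeveriBrauer.isSemisimpleRing_end e θ i
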